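/- Let $M$ be a smooth $5$-manifold with an irreducible $SO(3)$-structure, i.e. a Riemannian metric $g$, an orientation and a symmetric $3$-tensor $\Upsilon$ such that near every point there is a smooth oriented orthonormal frame $E_1,\dots,E_5$ (an adapted frame) with $$\Upsilon(X,X,X)=\tfrac12x_1(6x_2^2+6x_4^2-2x_1^2-3x_3^2-3x_5^2)+\tfrac{3\sqrt3}{2}x_4(x_5^2-x_3^2)+3\sqrt3\,x_2x_3x_5,\qquad X=\sum_{i=1}^5x_iE_i .$$ Bivectors are identified with skew-symmetric endomorphisms by $g(\sigma x,y)=g(\sigma,x\wedge y)$, where $g(u\wedge v,x\wedge y)=g(u,x)g(v,y)-g(u,y)g(v,x)$. Let $g(\Upsilon_vx,y)=\Upsilon(v,x,y)$ and $\widehat\Upsilon(W)=4\sum_{j}\Upsilon_{W(e_j)}\circ\Upsilon_{e_j}$ for $W\in\mathrm{End}(T_pM)$ and an orthonormal basis $(e_j)$ of $T_pM$, and put $\Lambda^2_3T_pM=\{W:\widehat\Upsilon(W)=7W\}$. This is a $3$-dimensional space of bivectors; it is oriented by the bases $$\kappa_1=\sqrt3\,a_1\wedge a_5+a_2\wedge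 a_3+a_4\wedge a_5,\quad \kappa_2=\sqrt3\,a_1\wedge a_3+a_2\wedge a_5+a_3\wedge a_4,\quad \kappa_3=2a_2\wedge a_4+a_3\wedge a_5,$$ where $(a_i)$ is an adapted basis; they are orthogonal with $|\kappa_i|^2=5$. Let $\nabla$ be the characteristic connection, i.e. a smooth linear connection with $\nabla g=0$, $\nabla\Upsilon=0$ whose torsion $T(X,Y,Z)=g(T(X,Y),Z)$ is totally skew-symmetric (it is assumed that such a connection exists; it is then unique). Let $\pi:\mathbb T=\{\sigma\in\Lambda^2_3TM:|\sigma|^2=5\}\to M$ be the twistor space, let $\mathcal V_\sigma=\{V\in\Lambda^2_3T_{\pi(\sigma)}M: V\perp\sigma\}$ be its vertical spaces, and let $X\mapsto X^h_\sigma$ be the horizontal lift defined by the connection which $\nabla$ induces on $\Lambda^2_3TM$. For $\sigma\in\mathbb T$ put $\xi_\sigma=\frac14\ast(\sigma\wedge\sigma)\in T_{\pi(\sigma)}M$ (a unit vector) and $H^\sigma=\xi_\sigma^\perp$, oriented so that $\mathbb R\xi_\sigma\oplus H^\sigma$ has the orientation of $T_{\pi(\sigma)}M$; let $\sigma_+$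 be the self-dual part of $\sigma$ on $H^\sigma$ and let $J^\sigma_+$ be the complex structure of $H^\sigma$ given by $g(J^\sigma_+X,Y)=\frac23g(\sigma_+,X\wedge Y)$. Let $\mathcal D_\sigma=\mathcal V_\sigma\oplus(H^\sigma)^h_\sigma$, and define $\mathcal J^{(1)}_+$ on $\mathcal D$ by $$\mathcal J^{(1)}_+V=-\sigma\times V\ \ (V\in\mathcal V_\sigma),\qquad \mathcal J^{(1)}_+X^h_\sigma=(J^\sigma_+X)^h_\sigma\ \ (X\in H^\sigma),$$ where $\times$ is the vector product of $\Lambda^2_3T_{\pi(\sigma)}M$ for which $\kappa_1\times\kappa_2=\kappa_3$, $\kappa_2\times\kappa_3=\kappa_1$, $\kappa_3\times\kappa_1=\kappa_2$. Let $\omega^{(1)}_+:\mathcal D\times\mathcal D\to T\mathbb T/\mathcal D$, $\omega^{(1)}_+(A,B)=[A,B]\bmod\mathcal D$, be the Levi form of the almost $CR$-structure $(\mathcal D,\mathcal J^{(1)}_+)$ on $\mathbb T$. Then $\omega^{(1)}_+$ is $\mathcal J^{(1)}_+$-invariant, i.e. $\omega^{(1)}_+(\mathcal J^{(1)}_+A,\mathcal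 J^{(1)}_+B)=\omega^{(1)}_+(A,B)$ for all $\sigma\in\mathbb T$ and $A,B\in\mathcal D_\sigma$, if and only if the $2$-form $\ast T$ takes values in $\Lambda^2_3TM$. -/

import Mathlib

open Bundle Module
open scoped Manifold ContDiff Topology RealInnerProductSpace

noncomputable section

/-! ## Linear algebra of the irreducible representation of `SO(3)` in dimension five -/

namespace SO3Linear

/-- The cubic polynomial `Υ(x, x, x)` in the coordinates of an adapted basis (the coordinates
`x₁, …, x₅` are `x 0, …, x 4`). -/
def cubicForm (x : Fin 5 → ℝ) : ℝ :=
  (1 / 2) * x 0 * (6 * x 1 ^ 2 + 6 * x 3 ^ 2 - 2 * x 0 ^ 2 - 3 * x 2 ^ 2 - 3 * x 4 ^ 2)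
    + (3 * √3 / 2) * x 3 * (x 4 ^ 2 - x 2 ^ 2) + 3 * √3 * x 1 * x 2 * x 4

variable {V : Type*} [NormedAddCommGroup V] [InnerProductSpace ℝ V]

/-- Bivectors are identified with skew-symmetric endomorphisms by
`⟪σ x, y⟫ = g(σ, x ∧ y)`, where `g(u ∧ v, x ∧ y) = g(u, x) g(v, y) - g(u, y) g(v, x)`.
This is the endomorphism of the bivector `u ∧ v`. -/
def wedge (u v : V) : V →L[ℝ] V :=
  (innerSL ℝ u).smulRight v - (innerSL ℝ v).smulRight u

/-- The bivectors `κ₁, κ₂, κ₃` attached to a basis `a₁, …, a₅`. -/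
def kappa (a : Fin 5 → V) : Fin 3 → (V →L[ℝ] V) :=
  ![√3 • wedge (a 0) (a 4) + wedge (a 1) (a 2) + wedge (a 3) (a 4),
    √3 • wedge (a 0) (a 2) + wedge (a 1) (a 4) + wedge (a 2) (a 3),
    (2 : ℝ) • wedge (a 1) (a 3) + wedge (a 2) (a 4)]

/-! In the definitions below `e` is an orthonormal basis used to write down contractions, and
`e.toBasis.det` is the volume form of the orientation defined by `e`. The objects defined do not
depend on the choice of `e` among the positively oriented orthonormal bases (for `cross`: among the
adapted bases). -/

variable (e : OrthonormalBasis (Fin 5) ℝ V)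

/-- The inner product of bivectors, `g(σ, τ) = ∑_{i < j} σ_{ij} τ_{ij}`. -/
def bivectorInner (σ τ : V →L[ℝ] V) : ℝ := (1 / 2) * ∑ i, ⟪σ (e i), τ (e i)⟫

/-- The endomorphism `Υ_v`, `g(Υ_v x, y) = Υ(v, x, y)`. -/
def upsilonOp (Υ : V →ₗ[ℝ] V →ₗ[ℝ] V →ₗ[ℝ] ℝ) (v x : V) : V := ∑ m, Υ v x (e m) • e m

/-- `Υ̂(W)(x) = 4 ∑ⱼ Υ_{W(eⱼ)} (Υ_{eⱼ} x)`. -/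
def upsilonHat (Υ : V →ₗ[ℝ] V →ₗ[ℝ] V →ₗ[ℝ] ℝ) (W : V →L[ℝ] V) (x : V) : V :=
  (4 : ℝ) • ∑ j, upsilonOp e Υ (W (e j)) (upsilonOp e Υ (e j) x)

/-- `Λ²₃ = {W : Υ̂(W) = 7 W}`. -/
def lambda23 (Υ : V →ₗ[ℝ] V →ₗ[ℝ] V →ₗ[ℝ] ℝ) : Submodule ℝ (V →L[ℝ] V) where
  carrier := {W | ∀ x, upsilonHat e Υ W x = (7 : ℝ) • W x}
  zero_mem' := by
    intro x
    simp [upsilonHat, upsilonOp]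
  add_mem' := by
    intro W W' hW hW' x
    have h : upsilonHat e Υ (W + W') x = upsilonHat e Υ W x + upsilonHat e Υ W' x := by
      simp [upsilonHat, upsilonOp, add_smul, Finset.sum_add_distrib]
    rw [h, hW x, hW' x]
    simp
  smul_mem' := by
    intro c W hW x
    have h : upsilonHat e Υ (c • W) x = c • upsilonHat e Υ W x := by
      simp only [upsilonHat, upsilonOp, _root_.smul_apply, map_smul,
        LinearMap.smul_apply, smul_assoc, ← Finset.smul_sum]
      rw [smul_comm]
    rw [h, hW x]
    exact smul_comm c (7 : ℝ) (W x)

/-- The `4`-form `σ ∧ σ`. -/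
def wedgeSq (σ : V →L[ℝ] V) (w x y z : V) : ℝ :=
  2 * (⟪σ w, x⟫ * ⟪σ y, z⟫ - ⟪σ w, y⟫ * ⟪σ x, z⟫ + ⟪σ w, z⟫ * ⟪σ x, y⟫)

/-- The Hodge star of a `4`-form `β`, as a vector. -/
def hodgeStarFour (β : V → V → V → V → ℝ) : V :=
  ∑ m, ((1 / 24) * ∑ i, ∑ j, ∑ k, ∑ l,
    β (e i) (e j) (e k) (e l) * e.toBasis.det ![e i, e j, e k, e l, e m]) • e m

/-- The Hodge star of a `3`-form, as a `2`-form. -/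
def hodgeStarThree (β : V → V → V → ℝ) (x y : V) : ℝ :=
  (1 / 6) * ∑ i, ∑ j, ∑ k, β (e i) (e j) (e k) * e.toBasis.det ![e i, e j, e k, x, y]

/-- `ξ_σ = (1 / 4) ∗(σ ∧ σ)`. -/
def xi (σ : V →L[ℝ] V) : V := (1 / 4 : ℝ) • hodgeStarFour e (wedgeSq σ)

/-- `H^σ`, the orthogonal complement of `ξ_σ`. -/
def hSpace (σ : V →L[ℝ] V) : Submodule ℝ V := (ℝ ∙ xi e σ)ᗮ

/-- The Hodge star of the `2`-form `σ` on the oriented Euclidean `4`-space `H^σ`; the volume form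
of `H^σ` is `vol(ξ_σ, ·, ·, ·, ·)`. -/
def hodgeStarH (σ : V →L[ℝ] V) (x y : V) : ℝ :=
  (1 / 2) * ∑ i, ∑ j, ⟪σ (e i), e j⟫ * e.toBasis.det ![xi e σ, e i, e j, x, y]

/-- The self-dual part `σ₊` of `σ` on `H^σ`: the number `g(σ₊, x ∧ y)`. -/
def sigmaPlus (σ : V →L[ℝ] V) (x y : V) : ℝ := (1 / 2) * (⟪σ x, y⟫ + hodgeStarH e σ x y)

/-- The complex structure `J₊^σ` of `H^σ`: `g(J₊ x, y) = (2 / 3) g(σ₊, x ∧ y)`. -/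
def jPlus (σ : V →L[ℝ] V) (x : V) : V := ∑ m, ((2 / 3) * sigmaPlus e σ x (e m)) • e m

/-- The coordinates `yᵢ(τ) = g(τ, κᵢ) / 5`. -/
def coord (τ : V →L[ℝ] V) (i : Fin 3) : ℝ := (1 / 5) * bivectorInner e τ (kappa e i)

/-- The vector product of the oriented Euclidean space `Λ²₃`, the positively oriented basis
`κ₁, κ₂, κ₃` being orthonormal for the metric normalized so that the fibre of the twistor space is
the unit sphere. Thus `κ₁ × κ₂ = κ₃`, `κ₂ × κ₃ = κ₁` and `κ₃ × κ₁ = κ₂`. -/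
def cross (σ τ : V →L[ℝ] V) : V →L[ℝ] V :=
  ∑ i, (crossProduct (coord e σ) (coord e τ)) i • kappa e i

end SO3Linear

/-! ## The Levi form of an almost CR structure -/

namespace AlmostCR

variable {F : Type*} [NormedAddCommGroup F] [NormedSpace ℝ F] {H : Type*} [TopologicalSpace H]
  (I : ModelWithCorners ℝ F H) {N : Type*} [TopologicalSpace N] [ChartedSpace H N]
  [IsManifold I ∞ N]

/-- `T` is an embedded submanifold of the manifold `N`, and `D` a distribution on `T` which is
tangent to `T`. Smooth local sections of `D` near `x` are given by smooth vector fields of `N`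
defined near `x` whose values along `T` lie in `D`. -/
def IsLocalSection (T : Set N) (D : Π x : N, Submodule ℝ (TangentSpace I x)) (x : N)
    (X : Π y : N, TangentSpace I y) : Prop :=
  ∃ W ∈ 𝓝 x, ContMDiffOn I I.tangent ∞ (fun y ↦ (⟨y, X y⟩ : TangentBundle I N)) W ∧
    ∀ y ∈ W ∩ T, X y ∈ D y

/-- The Levi form `ω(A, B) = [X, Y] mod D`, where `X`, `Y` are sections of `D` with values `A`, `B`
at the point `x` of `T`. -/
def leviForm (T : Set N) (D : Π x : N, Submodule ℝ (TangentSpace I x)) (x : N)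
    (A B : TangentSpace I x) : TangentSpace I x ⧸ D x :=
  Classical.epsilon fun c ↦ ∃ X Y : Π y : N, TangentSpace I y,
    IsLocalSection I T D x X ∧ IsLocalSection I T D x Y ∧ X x = A ∧ Y x = B ∧
      c = (D x).mkQ (VectorField.mlieBracket I X Y x)

/-- The Levi form is invariant under the almost complex structure `J` of `D`. -/
def LeviInvariant (T : Set N) (D : Π x : N, Submodule ℝ (TangentSpace I x))
    (J : Π x : N, TangentSpace I x → TangentSpace I x) : Prop :=
  ∀ x ∈ T, ∀ A ∈ D x, ∀ B ∈ D x, leviForm I T D x (J x A) (J x B) = leviForm I T D x A B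

end AlmostCR

/-! ## Manifolds with an irreducible `SO(3)`-structure and their twistor spaces -/

/-- The model space of `5`-manifolds. -/
abbrev R5 : Type := EuclideanSpace ℝ (Fin 5)

section Manifold

variable (M : Type*) [TopologicalSpace M] [ChartedSpace R5 M]

/-- The tangent space `T_p M`. -/
abbrev TM (p : M) : Type := TangentSpace 𝓘(ℝ, R5) p

variable [IsManifold 𝓘(ℝ, R5) ∞ M]

/-- The bundle `End(TM)` as a manifold. By means of the metric it contains the bundle of bivectors
`Λ² TM` as the subbundle of skew-symmetric endomorphisms. -/
abbrev EndTM : Type _ := TotalSpace (R5 →L[ℝ] R5) (fun p : M ↦ TM M p →L[ℝ] TM M p)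

/-- The model with corners of the manifold `End(TM)`. -/
abbrev endModel : ModelWithCorners ℝ (R5 × (R5 →L[ℝ] R5)) (ModelProd R5 (R5 →L[ℝ] R5)) :=
  𝓘(ℝ, R5).prod 𝓘(ℝ, R5 →L[ℝ] R5)

variable [RiemannianBundle (fun p : M ↦ TM M p)]

/-- An irreducible `SO(3)`-structure on a Riemannian `5`-manifold: an orientation and a symmetric
tensor `Υ` of rank three which, locally, has the standard form in a smooth oriented orthonormal
frame. -/
structure IrreducibleSO3Structure where
  upsilon (p : M) : TM M p →ₗ[ℝ] TM M p →ₗ[ℝ] TM M p →ₗ[ℝ] ℝ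
  upsilon_symm (p : M) (u v w : TM M p) :
    upsilon p u v w = upsilon p v u w ∧ upsilon p u v w = upsilon p u w v
  orientation (p : M) : Orientation ℝ (TM M p) (Fin 5)
  exists_frame (p : M) : ∃ U ∈ 𝓝 p, ∃ E : Fin 5 → Π q : M, TM M q,
    (∀ i, ContMDiffOn 𝓘(ℝ, R5) 𝓘(ℝ, R5).tangent ∞
      (fun q ↦ (⟨q, E i q⟩ : TangentBundle 𝓘(ℝ, R5) M)) U) ∧
    ∀ q ∈ U, ∃ a : OrthonormalBasis (Fin 5) ℝ (TM M q), (∀ i, a i = E i q) ∧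
      a.toBasis.orientation = orientation q ∧
      ∀ x : Fin 5 → ℝ, upsilon q (∑ i, x i • a i) (∑ i, x i • a i) (∑ i, x i • a i)
        = SO3Linear.cubicForm x

end Manifold

namespace IrreducibleSO3Structure

variable {M : Type*} [TopologicalSpace M] [ChartedSpace R5 M] [IsManifold 𝓘(ℝ, R5) ∞ M]
  [RiemannianBundle (fun p : M ↦ TM M p)]
  (S : IrreducibleSO3Structure M)

/-- Adapted bases of `T_p M`. -/
def IsAdapted {p : M} (a : OrthonormalBasis (Fin 5) ℝ (TM M p)) : Prop :=
  a.toBasis.orientation = S.orientation p ∧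
    ∀ x : Fin 5 → ℝ, S.upsilon p (∑ i, x i • a i) (∑ i, x i • a i) (∑ i, x i • a i)
      = SO3Linear.cubicForm x

theorem exists_isAdapted (p : M) :
    ∃ a : OrthonormalBasis (Fin 5) ℝ (TM M p), S.IsAdapted a := by
  obtain ⟨U, hU, E, -, h⟩ := S.exists_frame p
  obtain ⟨a, -, ha⟩ := h p (mem_of_mem_nhds hU)
  exact ⟨a, ha⟩

/-- A choice of an adapted basis at each point; the objects defined below by means of it do not
depend on the choice. -/
def adaptedBasis (p : M) : OrthonormalBasis (Fin 5) ℝ (TM M p) :=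
  (S.exists_isAdapted p).choose

/-- `Λ²₃ T_p M`. -/
def lambda23 (p : M) : Submodule ℝ (TM M p →L[ℝ] TM M p) :=
  SO3Linear.lambda23 (S.adaptedBasis p) (S.upsilon p)

/-- The twistor space `𝕋 = {σ ∈ Λ²₃ TM : |σ|² = 5}`, as a submanifold of `End(TM)`. -/
def twistorSpace : Set (EndTM M) :=
  {σ | σ.2 ∈ S.lambda23 σ.1 ∧ SO3Linear.bivectorInner (S.adaptedBasis σ.1) σ.2 σ.2 = 5}

/-- The vertical space `𝒱_σ`, the orthogonal complement of `σ` in `Λ²₃ T_p M`. -/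
def verticalSpace (σ : EndTM M) : Submodule ℝ (TM M σ.1 →L[ℝ] TM M σ.1) where
  carrier := {V | V ∈ S.lambda23 σ.1 ∧
    SO3Linear.bivectorInner (S.adaptedBasis σ.1) V σ.2 = 0}
  zero_mem' := ⟨Submodule.zero_mem _, by simp [SO3Linear.bivectorInner]⟩
  add_mem' := by
    rintro V W ⟨hV, hV'⟩ ⟨hW, hW'⟩
    refine ⟨Submodule.add_mem _ hV hW, ?_⟩
    have h : SO3Linear.bivectorInner (S.adaptedBasis σ.1) (V + W) σ.2
        = SO3Linear.bivectorInner (S.adaptedBasis σ.1) V σ.2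
          + SO3Linear.bivectorInner (S.adaptedBasis σ.1) W σ.2 := by
      simp [SO3Linear.bivectorInner, inner_add_left, Finset.sum_add_distrib, mul_add]
    rw [h, hV', hW', add_zero]
  smul_mem' := by
    rintro c V ⟨hV, hV'⟩
    refine ⟨Submodule.smul_mem _ c hV, ?_⟩
    have h : SO3Linear.bivectorInner (S.adaptedBasis σ.1) (c • V) σ.2
        = c * SO3Linear.bivectorInner (S.adaptedBasis σ.1) V σ.2 := by
      simp only [SO3Linear.bivectorInner, _root_.smul_apply, inner_smul_left,
        ← Finset.mul_sum]
      simp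
      ring
    rw [h, hV', mul_zero]

/-- The complex structure `𝒥 V = -σ × V` of the fibre of `𝕋` through `σ`. -/
def fibreJ (σ : EndTM M) (V : TM M σ.1 →L[ℝ] TM M σ.1) : TM M σ.1 →L[ℝ] TM M σ.1 :=
  -SO3Linear.cross (S.adaptedBasis σ.1) σ.2 V

end IrreducibleSO3Structure

section Connection

variable {M : Type*} [TopologicalSpace M] [ChartedSpace R5 M] [IsManifold 𝓘(ℝ, R5) ∞ M]
  (cov : CovariantDerivative 𝓘(ℝ, R5) R5 (fun p : M ↦ TM M p))

theorem tensorialAt_endCov (s : Π p : M, TM M p →L[ℝ] TM M p) (p : M)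
    (hs : MDifferentiableAt 𝓘(ℝ, R5) (endModel) (fun q ↦ (⟨q, s q⟩ : EndTM M)) p) :
    TensorialAt 𝓘(ℝ, R5) R5 (V := fun p : M ↦ TM M p)
      (fun Y ↦ cov (fun q ↦ s q (Y q)) p - (s p).comp (cov Y p)) p where
  smul {f Y} hf hY := by
    have hsY := hs.clm_bundle_apply hY
    have h : (fun q ↦ s q ((f • Y) q)) = f • fun q ↦ s q (Y q) := by
      ext1 q
      simp
    rw [h, cov.isCovariantDerivativeOnUniv.leibniz hsY hf,
      cov.isCovariantDerivativeOnUniv.leibniz hY hf]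
    ext1 v
    simp [smul_sub]
  add {Y Z} hY hZ := by
    have hsY := hs.clm_bundle_apply hY
    have hsZ := hs.clm_bundle_apply hZ
    have h : (fun q ↦ s q ((Y + Z) q)) = (fun q ↦ s q (Y q)) + fun q ↦ s q (Z q) := by
      ext1 q
      simp
    rw [h, cov.isCovariantDerivativeOnUniv.add hsY hsZ,
      cov.isCovariantDerivativeOnUniv.add hY hZ]
    ext1 v
    simp
    abel

/-- The connection induced by `∇` on `End(TM)`: `(∇_X s)(Y) = ∇_X (s Y) - s (∇_X Y)`.
The vector `Y` is the first argument and `X` the second one. -/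
def endCov (s : Π p : M, TM M p →L[ℝ] TM M p) (p : M)
    (hs : MDifferentiableAt 𝓘(ℝ, R5) (endModel) (fun q ↦ (⟨q, s q⟩ : EndTM M)) p) :
    TM M p →L[ℝ] TM M p →L[ℝ] TM M p :=
  TensorialAt.mkHom _ p (tensorialAt_endCov cov s p hs)

end Connection

section Lifts

variable {M : Type*} [TopologicalSpace M] [ChartedSpace R5 M] [IsManifold 𝓘(ℝ, R5) ∞ M]
  (cov : CovariantDerivative 𝓘(ℝ, R5) R5 (fun p : M ↦ TM M p))

/-- A local section of `End(TM)` with value `σ` at the point `π(σ)`. -/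
def sectionThrough (σ : EndTM M) : Π q : M, TM M q →L[ℝ] TM M q :=
  FiberBundle.extend (R5 →L[ℝ] R5) σ.2

theorem mdifferentiableAt_sectionThrough (σ : EndTM M) :
    MDifferentiableAt 𝓘(ℝ, R5) endModel
      (fun q ↦ (⟨q, sectionThrough σ q⟩ : EndTM M)) σ.1 :=
  FiberBundle.mdifferentiableAt_extend ..

theorem sectionThrough_self (σ : EndTM M) : sectionThrough σ σ.1 = σ.2 :=
  FiberBundle.extend_apply_self ..

/-- The differential at `π(σ)` of that local section, whose value there is `σ`. -/
def sectionDiff (σ : EndTM M) : TM M σ.1 →L[ℝ] TangentSpace (endModel) σ :=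
  mfderiv 𝓘(ℝ, R5) endModel (fun q ↦ (⟨q, sectionThrough σ q⟩ : EndTM M)) σ.1

variable [RiemannianBundle (fun p : M ↦ TM M p)]

/-- The vertical lift `End(T_p M) → T_σ End(TM)`, `p = π(σ)`: the differential at `σ` of the
inclusion of the fibre. -/
def verticalLift (σ : EndTM M) : (TM M σ.1 →L[ℝ] TM M σ.1) →L[ℝ] TangentSpace (endModel) σ :=
  mfderiv 𝓘(ℝ, TM M σ.1 →L[ℝ] TM M σ.1) endModel
    (fun V : TM M σ.1 →L[ℝ] TM M σ.1 ↦ (⟨σ.1, V⟩ : EndTM M)) σ.2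

/-- The horizontal lift `X ↦ X^h_σ` with respect to `∇`: for a local section `s` of `End(TM)`
with `s(p) = σ`, `p = π(σ)`, it is `X^h_σ = ds_p(X) - (∇_X s)(p)`, the second term being regarded as
a vertical vector at `σ`. It does not depend on the choice of `s`. -/
def horizontalLift (σ : EndTM M) : TM M σ.1 →L[ℝ] TangentSpace (endModel) σ :=
  sectionDiff σ - (verticalLift σ).comp
        (endCov cov (sectionThrough σ) σ.1 (mdifferentiableAt_sectionThrough σ)).flip

/-- The differential `π_* : T_σ End(TM) → T_p M` of the bundle projection, `p = π(σ)`. -/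
def projDiff (σ : EndTM M) : TangentSpace (endModel) σ →L[ℝ] TM M σ.1 :=
  mfderiv endModel 𝓘(ℝ, R5) (fun τ : EndTM M ↦ τ.1) σ

/-- The vertical component of `A ∈ T_σ End(TM)` with respect to `∇`: the endomorphism `V` with
`A = (π_* A)^h_σ + V`. -/
def verticalPart (σ : EndTM M) (A : TangentSpace (endModel) σ) : TM M σ.1 →L[ℝ] TM M σ.1 :=
  Function.invFun (verticalLift σ) (A - horizontalLift cov σ (projDiff σ A))

end Lifts

namespace IrreducibleSO3Structure

variable {M : Type*} [TopologicalSpace M] [ChartedSpace R5 M] [IsManifold 𝓘(ℝ, R5) ∞ M]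
  [RiemannianBundle (fun p : M ↦ TM M p)]
  (S : IrreducibleSO3Structure M)
  (cov : CovariantDerivative 𝓘(ℝ, R5) R5 (fun p : M ↦ TM M p))

/-- The distribution `𝒟_σ = 𝒱_σ ⊕ (H^σ)^h_σ`. -/
def distribution (σ : EndTM M) : Submodule ℝ (TangentSpace (endModel) σ) :=
  (S.verticalSpace σ).map (verticalLift σ).toLinearMap ⊔
    (SO3Linear.hSpace (S.adaptedBasis σ.1) σ.2).map (horizontalLift cov σ).toLinearMap

/-- The almost complex structure `𝒥₊⁽¹⁾` of `𝒟`: it is `𝒥` on vertical vectors, and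
`X^h_σ ↦ (J₊^σ X)^h_σ` on horizontal ones. -/
def jPlusOne (σ : EndTM M) (A : TangentSpace (endModel) σ) : TangentSpace (endModel) σ :=
  verticalLift σ (S.fibreJ σ (verticalPart cov σ A)) +
    horizontalLift cov σ (SO3Linear.jPlus (S.adaptedBasis σ.1) σ.2 (projDiff σ A))

/-- `∇ Υ = 0`. -/
def IsParallel : Prop :=
  ∀ (p : M) (X : TM M p) (Y Z W : Π q : M, TM M q),
    MDifferentiableAt 𝓘(ℝ, R5) 𝓘(ℝ, R5).tangent
      (fun q ↦ (⟨q, Y q⟩ : TangentBundle 𝓘(ℝ, R5) M)) p →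
    MDifferentiableAt 𝓘(ℝ, R5) 𝓘(ℝ, R5).tangent
      (fun q ↦ (⟨q, Z q⟩ : TangentBundle 𝓘(ℝ, R5) M)) p →
    MDifferentiableAt 𝓘(ℝ, R5) 𝓘(ℝ, R5).tangent
      (fun q ↦ (⟨q, W q⟩ : TangentBundle 𝓘(ℝ, R5) M)) p →
    mvfderiv 𝓘(ℝ, R5) (fun q ↦ S.upsilon q (Y q) (Z q) (W q)) p X
      = S.upsilon p (cov Y p X) (Z p) (W p) + S.upsilon p (Y p) (cov Z p X) (W p)
        + S.upsilon p (Y p) (Z p) (cov W p X)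

variable [IsContMDiffRiemannianBundle 𝓘(ℝ, R5) ∞ R5 (fun p : M ↦ TM M p)]

/-- The torsion as a tensor of type `(0, 3)`, `T(X, Y, Z) = g(T(X, Y), Z)`. -/
def torsionForm (p : M) (X Y Z : TM M p) : ℝ := ⟪cov.torsion p X Y, Z⟫

/-- `∇` is the characteristic connection: a smooth `SO(3)`-connection (that is, `∇ g = 0` and
`∇ Υ = 0`) whose torsion is totally skew-symmetric (being always skew-symmetric in the first two
arguments). -/
structure IsCharacteristic : Prop where
  smooth : cov.ContMDiffCovariantDerivative ∞
  metric :
    haveI : IsContMDiffRiemannianBundle 𝓘(ℝ, R5) 1 R5 (fun p : M ↦ TM M p) :=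
      IsContMDiffRiemannianBundle.of_le (n := ∞) (by simp)
    cov.IsMetricCompatible
  parallel : S.IsParallel cov
  skew (p : M) (X Y Z : TM M p) : torsionForm cov p X Y Z = -torsionForm cov p X Z Y

/-- The `2`-form `∗T` takes values in `Λ²₃ TM`. -/
def StarTorsionInLambda23 : Prop :=
  ∀ p : M, ∃ W ∈ S.lambda23 p, ∀ x y : TM M p,
    ⟪W x, y⟫ = SO3Linear.hodgeStarThree (S.adaptedBasis p) (torsionForm cov p) x y

end IrreducibleSO3Structure

end

/-!
In an adapted frame `Λ²₃` becomes the fixed space of matrices `kappaMat y`, `y ∈ ℝ³`, and the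
twistor space becomes the product of an open set of `ℝ⁵` and the unit sphere `S²`. A point `σ` is
given by `y ∈ S²`, the vector `ξ_σ` by the quadratic polynomial `xiVec y`, with polar form
`dxiVec`, and `J₊^σ` by the matrix `jMat y`, a cubic polynomial of `kappaMat y`. The quotient
`T𝕋 / 𝒟` is spanned by the class of the horizontal lift of `ξ_σ`, so the Levi form is determined by
the `ξ_σ`-component of the projection of a bracket.

For sections of `𝒟` with values `A = V + X^h` and `B = W + Y^h` at `σ`, this component is
(`mlieBracket_of_sections_lift`, `leviForm_lift`)
`-g(dξ(V), Y) + g(dξ(W), X) - T(X, Y, ξ_σ)`,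
where `dξ` is the differential of `σ ↦ ξ_σ` along the fibre. The first two terms appear when the
equation `g(π_* A, ξ_σ) = 0` of `𝒟` is differentiated along the twistor space
(`lieBracket_of_sections`). The connection form occurs twice, in the horizontal lifts and in
`[E_i, E_j] = ∇_{E_i} E_j - ∇_{E_j} E_i - T(E_i, E_j)`. Since `∇Υ = 0` and `∇g = 0` it takes values
in `Λ²₃` (`eq_kappaMat_of_annihilates`), and the map `σ ↦ ξ_σ` is equivariant (`dxiVec_cross`), so
the two contributions cancel.

The differential of `σ ↦ ξ_σ` intertwines `V ↦ -σ × V` and `J₊^σ` (`jMat_mulVec_dxiVec`). Hence the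
first two terms are always invariant, and the Levi form is invariant if and only if all the
`2`-forms `T(·, ·, ξ_σ)` on `H^σ` are `J₊^σ`-invariant. These are linear equations for `T`, with
polynomial coefficients in `y`. If `∗T` is in `Λ²₃` they hold
(`jMat_transpose_mul_contractXi_mul_jMat`), and conversely four points of the sphere already force
`∗T` to be in `Λ²₃` (`starMat_eq_kappaMat`).

The Levi form of the statement is evaluated on local sections of `𝒟`. Every vector of `𝒟` extends to
such a section (`exists_isLocalSection`), and the formula above shows that the class of the bracket
does not depend on the extensions.
-/

noncomputable section

/-! ### Independence of the orthonormal basis -/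

namespace SO3Linear

section BasisIndependence

variable {V : Type*} [NormedAddCommGroup V] [InnerProductSpace ℝ V]
  {W : Type*} [AddCommGroup W] [Module ℝ W]

/-- The trace of a bilinear map does not depend on the orthonormal basis. -/
theorem sum_diag_eq {ι : Type*} [Fintype ι] (e e' : OrthonormalBasis ι ℝ V) (f : V → V → W)
    (hl : ∀ v, IsLinearMap ℝ (fun u ↦ f u v)) (hr : ∀ u, IsLinearMap ℝ (f u)) :
    ∑ i, f (e i) (e i) = ∑ i, f (e' i) (e' i) := by
  classical
  have hL : ∀ (c : ι → ℝ) v, f (∑ i, c i • e i) v = ∑ i, c i • f (e i) v := by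
    intro c v
    have h := map_sum (IsLinearMap.mk' _ (hl v)) (fun i ↦ c i • e i) Finset.univ
    simp only [map_smul] at h
    exact h
  have hR : ∀ (c : ι → ℝ) u, f u (∑ i, c i • e i) = ∑ i, c i • f u (e i) := by
    intro c u
    have h := map_sum (IsLinearMap.mk' _ (hr u)) (fun i ↦ c i • e i) Finset.univ
    simp only [map_smul] at h
    exact h
  have key : ∀ j, f (e' j) (e' j)
      = ∑ i, ∑ k, (⟪e i, e' j⟫ * ⟪e' j, e k⟫) • f (e i) (e k) := by
    intro j
    conv_lhs => rw [← e.sum_repr' (e' j)]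
    rw [hL]
    refine Finset.sum_congr rfl fun i _ ↦ ?_
    rw [hR, Finset.smul_sum]
    refine Finset.sum_congr rfl fun k _ ↦ ?_
    rw [smul_smul, real_inner_comm (e' j) (e k)]
  rw [Finset.sum_congr rfl fun j _ ↦ key j, Finset.sum_comm]
  refine Finset.sum_congr rfl fun i _ ↦ ?_
  rw [Finset.sum_comm]
  simp only [← Finset.sum_smul, e'.sum_inner_mul_inner, e.inner_eq_ite]
  simp

variable (e e' : OrthonormalBasis (Fin 5) ℝ V)

theorem bivectorInner_eq_of_basis (σ τ : V →L[ℝ] V) :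
    bivectorInner e σ τ = bivectorInner e' σ τ := by
  unfold bivectorInner
  rw [sum_diag_eq e e' (fun u v ↦ ⟪σ u, τ v⟫)]
  · intro v; constructor <;> intros <;> simp [inner_add_left, inner_smul_left]
  · intro v; constructor <;> intros <;> simp [inner_add_right, inner_smul_right]

theorem isLinearMap_upsilonOp_left (Υ : V →ₗ[ℝ] V →ₗ[ℝ] V →ₗ[ℝ] ℝ) (x : V) :
    IsLinearMap ℝ (fun v ↦ upsilonOp e Υ v x) := by
  constructor <;> intros <;> simp [upsilonOp, add_smul, mul_smul, Finset.sum_add_distrib,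
    Finset.smul_sum]

theorem isLinearMap_upsilonOp_right (Υ : V →ₗ[ℝ] V →ₗ[ℝ] V →ₗ[ℝ] ℝ) (v : V) :
    IsLinearMap ℝ (upsilonOp e Υ v) := by
  constructor <;> intros <;> simp [upsilonOp, add_smul, mul_smul, Finset.sum_add_distrib,
    Finset.smul_sum]

theorem upsilonOp_eq_of_basis (Υ : V →ₗ[ℝ] V →ₗ[ℝ] V →ₗ[ℝ] ℝ) (v x : V) :
    upsilonOp e Υ v x = upsilonOp e' Υ v x := by
  unfold upsilonOp
  rw [sum_diag_eq e e' (fun u w ↦ Υ v x u • w)]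
  · intro v; constructor <;> intros <;> simp [add_smul, mul_smul]
  · intro v; constructor <;> intros <;> simp [smul_smul, mul_comm]

theorem upsilonHat_eq_of_basis (Υ : V →ₗ[ℝ] V →ₗ[ℝ] V →ₗ[ℝ] ℝ) (W : V →L[ℝ] V) (x : V) :
    upsilonHat e Υ W x = upsilonHat e' Υ W x := by
  unfold upsilonHat
  simp_rw [upsilonOp_eq_of_basis e e']
  rw [sum_diag_eq e e' (fun u v ↦ upsilonOp e' Υ (W u) (upsilonOp e' Υ v x))]
  · intro v
    have h := isLinearMap_upsilonOp_left e' Υ (upsilonOp e' Υ v x)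
    exact ⟨fun u u' ↦ by rw [map_add, h.map_add], fun c u ↦ by rw [map_smul, h.map_smul]⟩
  · intro u
    have h := isLinearMap_upsilonOp_left e' Υ x
    have h' := isLinearMap_upsilonOp_right e' Υ (W u)
    exact ⟨fun v v' ↦ by rw [h.map_add, h'.map_add], fun c v ↦ by rw [h.map_smul, h'.map_smul]⟩

theorem lambda23_eq_of_basis (Υ : V →ₗ[ℝ] V →ₗ[ℝ] V →ₗ[ℝ] ℝ) :
    lambda23 e Υ = lambda23 e' Υ := by
  ext W
  change (∀ x, upsilonHat e Υ W x = _) ↔ (∀ x, upsilonHat e' Υ W x = _)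
  simp_rw [upsilonHat_eq_of_basis e e']

section Slots

variable (D : V [⋀^Fin 5]→ₗ[ℝ] ℝ)

/-! The volume form is linear in each of its five arguments. -/

theorem isLinearMap_slot₀ (v w x y : V) : IsLinearMap ℝ (fun u ↦ D ![u, v, w, x, y]) := by
  have h (z : V) : ![z, v, w, x, y] = Function.update ![0, v, w, x, y] 0 z := by
    ext i; fin_cases i <;> rfl
  exact ⟨fun a b ↦ by rw [h (a + b), h a, h b, D.map_update_add],
    fun c a ↦ by rw [h (c • a), h a, D.map_update_smul]⟩

theorem isLinearMap_slot₁ (u w x y : V) : IsLinearMap ℝ (fun v ↦ D ![u, v, w, x, y]) := by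
  have h (z : V) : ![u, z, w, x, y] = Function.update ![u, 0, w, x, y] 1 z := by
    ext i; fin_cases i <;> rfl
  exact ⟨fun a b ↦ by rw [h (a + b), h a, h b, D.map_update_add],
    fun c a ↦ by rw [h (c • a), h a, D.map_update_smul]⟩

theorem isLinearMap_slot₂ (u v x y : V) : IsLinearMap ℝ (fun w ↦ D ![u, v, w, x, y]) := by
  have h (z : V) : ![u, v, z, x, y] = Function.update ![u, v, 0, x, y] 2 z := by
    ext i; fin_cases i <;> rfl
  exact ⟨fun a b ↦ by rw [h (a + b), h a, h b, D.map_update_add],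
    fun c a ↦ by rw [h (c • a), h a, D.map_update_smul]⟩

theorem isLinearMap_slot₃ (u v w y : V) : IsLinearMap ℝ (fun x ↦ D ![u, v, w, x, y]) := by
  have h (z : V) : ![u, v, w, z, y] = Function.update ![u, v, w, 0, y] 3 z := by
    ext i; fin_cases i <;> rfl
  exact ⟨fun a b ↦ by rw [h (a + b), h a, h b, D.map_update_add],
    fun c a ↦ by rw [h (c • a), h a, D.map_update_smul]⟩

theorem isLinearMap_slot₄ (u v w x : V) : IsLinearMap ℝ (fun y ↦ D ![u, v, w, x, y]) := by
  have h (z : V) : ![u, v, w, x, z] = Function.update ![u, v, w, x, 0] 4 z := by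
    ext i; fin_cases i <;> rfl
  exact ⟨fun a b ↦ by rw [h (a + b), h a, h b, D.map_update_add],
    fun c a ↦ by rw [h (c • a), h a, D.map_update_smul]⟩

end Slots

/-- The vector `ξ_σ` depends only on the orientation given by the orthonormal basis. -/
theorem xi_eq_of_basis (h : e.toBasis.orientation = e'.toBasis.orientation) (σ : V →L[ℝ] V) :
    xi e σ = xi e' σ := by
  have hdet : e.toBasis.det = e'.toBasis.det := e.same_orientation_iff_det_eq_det.2 h
  unfold xi hodgeStarFour
  congr 1
  rw [hdet]
  set D := e'.toBasis.det
  -- the contraction is a fivefold trace of a multilinear map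
  have h₀ := isLinearMap_slot₀ D
  have h₁ := isLinearMap_slot₁ D
  have h₂ := isLinearMap_slot₂ D
  have h₃ := isLinearMap_slot₃ D
  have h₄ := isLinearMap_slot₄ D
  have β₀ (x y z : V) : IsLinearMap ℝ fun w ↦ wedgeSq σ w x y z := by
    constructor <;> intros <;>
      simp only [wedgeSq, map_add, map_smul, inner_add_left, inner_smul_left, smul_eq_mul,
        RCLike.conj_to_real] <;> ring
  have β₁ (w y z : V) : IsLinearMap ℝ fun x ↦ wedgeSq σ w x y z := by
    constructor <;> intros <;>
      simp only [wedgeSq, map_add, map_smul, inner_add_left, inner_smul_left, inner_add_right,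
        inner_smul_right, smul_eq_mul, RCLike.conj_to_real] <;> ring
  have β₂ (w x z : V) : IsLinearMap ℝ fun y ↦ wedgeSq σ w x y z := by
    constructor <;> intros <;>
      simp only [wedgeSq, map_add, map_smul, inner_add_left, inner_smul_left, inner_add_right,
        inner_smul_right, smul_eq_mul, RCLike.conj_to_real] <;> ring
  have β₃ (w x y : V) : IsLinearMap ℝ fun z ↦ wedgeSq σ w x y z := by
    constructor <;> intros <;>
      simp only [wedgeSq, inner_add_right, inner_smul_right, smul_eq_mul] <;> ring
  have s₃ (u v w y : V) : ∑ l, wedgeSq σ u v w (e l) * D ![u, v, w, e l, y]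
      = ∑ l, wedgeSq σ u v w (e' l) * D ![u, v, w, e' l, y] :=
    sum_diag_eq e e' (fun a b ↦ wedgeSq σ u v w a * D ![u, v, w, b, y])
      (fun b ↦ ⟨fun _ _ ↦ by rw [(β₃ ..).map_add, add_mul],
        fun _ _ ↦ by rw [(β₃ ..).map_smul, smul_mul_assoc]⟩)
      (fun a ↦ ⟨fun _ _ ↦ by rw [(h₃ ..).map_add, mul_add],
        fun _ _ ↦ by rw [(h₃ ..).map_smul, mul_smul_comm]⟩)
  simp_rw [s₃]
  have s₂ (u v y : V) : ∑ k, ∑ l, wedgeSq σ u v (e k) (e' l) * D ![u, v, e k, e' l, y]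
      = ∑ k, ∑ l, wedgeSq σ u v (e' k) (e' l) * D ![u, v, e' k, e' l, y] :=
    sum_diag_eq e e' (fun a b ↦ ∑ l, wedgeSq σ u v a (e' l) * D ![u, v, b, e' l, y])
      (fun b ↦ ⟨fun _ _ ↦ by simp_rw [(β₂ ..).map_add, add_mul, Finset.sum_add_distrib],
        fun _ _ ↦ by simp_rw [(β₂ ..).map_smul, smul_mul_assoc, Finset.smul_sum]⟩)
      (fun a ↦ ⟨fun _ _ ↦ by simp_rw [(h₂ ..).map_add, mul_add, Finset.sum_add_distrib],
        fun _ _ ↦ by simp_rw [(h₂ ..).map_smul, mul_smul_comm, Finset.smul_sum]⟩)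
  simp_rw [s₂]
  have s₁ (u y : V) : ∑ j, ∑ k, ∑ l, wedgeSq σ u (e j) (e' k) (e' l) * D ![u, e j, e' k, e' l, y]
      = ∑ j, ∑ k, ∑ l, wedgeSq σ u (e' j) (e' k) (e' l) * D ![u, e' j, e' k, e' l, y] :=
    sum_diag_eq e e' (fun a b ↦ ∑ k, ∑ l, wedgeSq σ u a (e' k) (e' l) * D ![u, b, e' k, e' l, y])
      (fun b ↦ ⟨fun _ _ ↦ by simp_rw [(β₁ ..).map_add, add_mul, Finset.sum_add_distrib],
        fun _ _ ↦ by simp_rw [(β₁ ..).map_smul, smul_mul_assoc, Finset.smul_sum]⟩)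
      (fun a ↦ ⟨fun _ _ ↦ by simp_rw [(h₁ ..).map_add, mul_add, Finset.sum_add_distrib],
        fun _ _ ↦ by simp_rw [(h₁ ..).map_smul, mul_smul_comm, Finset.smul_sum]⟩)
  simp_rw [s₁]
  have s₀ (y : V) : ∑ i, ∑ j, ∑ k, ∑ l,
        wedgeSq σ (e i) (e' j) (e' k) (e' l) * D ![e i, e' j, e' k, e' l, y]
      = ∑ i, ∑ j, ∑ k, ∑ l,
        wedgeSq σ (e' i) (e' j) (e' k) (e' l) * D ![e' i, e' j, e' k, e' l, y] :=
    sum_diag_eq e e' (fun a b ↦ ∑ j, ∑ k, ∑ l,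
        wedgeSq σ a (e' j) (e' k) (e' l) * D ![b, e' j, e' k, e' l, y])
      (fun b ↦ ⟨fun _ _ ↦ by simp_rw [(β₀ ..).map_add, add_mul, Finset.sum_add_distrib],
        fun _ _ ↦ by simp_rw [(β₀ ..).map_smul, smul_mul_assoc, Finset.smul_sum]⟩)
      (fun a ↦ ⟨fun _ _ ↦ by simp_rw [(h₀ ..).map_add, mul_add, Finset.sum_add_distrib],
        fun _ _ ↦ by simp_rw [(h₀ ..).map_smul, mul_smul_comm, Finset.smul_sum]⟩)
  simp_rw [s₀]
  exact sum_diag_eq e e' (fun a b ↦ ((1 / 24) * ∑ i, ∑ j, ∑ k, ∑ l,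
      wedgeSq σ (e' i) (e' j) (e' k) (e' l) * D ![e' i, e' j, e' k, e' l, a]) • b)
    (fun b ↦ ⟨fun _ _ ↦ by
        simp_rw [(h₄ ..).map_add, mul_add, Finset.sum_add_distrib, mul_add, add_smul],
      fun _ _ ↦ by
        simp_rw [(h₄ ..).map_smul, mul_smul_comm, ← Finset.smul_sum, mul_smul_comm, smul_assoc]⟩)
    (fun a ↦ ⟨fun _ _ ↦ smul_add .., fun _ _ ↦ smul_comm ..⟩)

end BasisIndependence
end SO3Linear

namespace SO3Linear

/-! ### The Levi-Civita symbol -/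

section LeviCivita

/-- The sign of the pair `(i, j)`: `1`, `-1` or `0`. -/
def pairSign (i j : Fin 5) : ℝ := if i < j then 1 else if j < i then -1 else 0

/-- The Levi-Civita symbol in dimension five. -/
def leviCivita (i j k l m : Fin 5) : ℝ :=
  pairSign i j * pairSign i k * pairSign i l * pairSign i m * pairSign j k * pairSign j l *
    pairSign j m * pairSign k l * pairSign k m * pairSign l m

theorem pairSign_self (i : Fin 5) : pairSign i i = 0 := by simp [pairSign]

variable {V : Type*} [NormedAddCommGroup V] [InnerProductSpace ℝ V]
  (e : OrthonormalBasis (Fin 5) ℝ V)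

theorem det_basis_eq_leviCivita (i j k l m : Fin 5) :
    e.toBasis.det ![e i, e j, e k, e l, e m] = leviCivita i j k l m := by
  have hcomp : ![e i, e j, e k, e l, e m] = e ∘ ![i, j, k, l, m] := by
    ext a; fin_cases a <;> rfl
  by_cases hg : Function.Injective ![i, j, k, l, m]
  · set τ : Equiv.Perm (Fin 5) := Equiv.ofBijective _ (Finite.injective_iff_bijective.1 hg) with hτ
    have h1 : ![e i, e j, e k, e l, e m] = e.toBasis ∘ τ := by
      rw [hcomp]; ext a; simp [hτ]
    have ht : ∀ a, τ a = ![i, j, k, l, m] a := fun a ↦ rfl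
    rw [h1, AlternatingMap.map_perm, Basis.det_self, Equiv.Perm.sign_eq_prod_prod_Ioi]
    have hne : ∀ a b, a ≠ b → τ a ≠ τ b := fun a b h h' ↦ h (τ.injective h')
    have key : ∀ a b, a ≠ b → pairSign (τ a) (τ b)
        = (((if τ a < τ b then 1 else -1 : ℤˣ) : ℤ) : ℝ) := by
      intro a b hab
      rw [pairSign]
      rcases lt_or_gt_of_ne (hne a b hab) with h | h
      · simp [h]
      · simp [h, h.not_gt]
    have hl : leviCivita i j k l m = leviCivita (τ 0) (τ 1) (τ 2) (τ 3) (τ 4) := rfl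
    have h2 : (Finset.Ioi (0 : Fin 5)) = {1, 2, 3, 4} := by decide
    have h3 : (Finset.Ioi (1 : Fin 5)) = {2, 3, 4} := by decide
    have h4 : (Finset.Ioi (2 : Fin 5)) = {3, 4} := by decide
    have h5 : (Finset.Ioi (3 : Fin 5)) = {4} := by decide
    have h6 : (Finset.Ioi (4 : Fin 5)) = ∅ := by decide
    rw [hl, leviCivita, key 0 1 (by decide), key 0 2 (by decide), key 0 3 (by decide),
      key 0 4 (by decide), key 1 2 (by decide), key 1 3 (by decide), key 1 4 (by decide),
      key 2 3 (by decide), key 2 4 (by decide), key 3 4 (by decide)]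
    simp only [Fin.prod_univ_five, h2, h3, h4, h5, h6]
    simp only [Finset.prod_insert, Finset.prod_singleton, Finset.prod_empty, Finset.mem_insert,
      Finset.mem_singleton, Fin.reduceEq, or_self, not_false_eq_true, Units.smul_def,
      zsmul_eq_mul, mul_one, Units.val_mul, Int.cast_mul]
    ring
  · simp only [Function.Injective, not_forall] at hg
    obtain ⟨a, b, hab, hne⟩ := hg
    have h0 : leviCivita i j k l m = 0 := by
      unfold leviCivita
      fin_cases a <;> fin_cases b <;> simp at hab hne <;> subst hab <;>
        simp [pairSign_self]
    rw [h0, hcomp]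
    exact e.toBasis.det.map_eq_zero_of_eq _ (i := a) (j := b) (by simp only [Function.comp, hab]) hne

end LeviCivita

/-! ### Coordinates with respect to `κ₁, κ₂, κ₃` -/

section Coordinates

variable {V : Type*} [NormedAddCommGroup V] [InnerProductSpace ℝ V]
  (e : OrthonormalBasis (Fin 5) ℝ V)

/-- The bivector `∑ᵢ yᵢ κᵢ`. -/
def kappaSum (y : Fin 3 → ℝ) : V →L[ℝ] V := ∑ i, y i • kappa e i

/-- The matrix of `∑ᵢ yᵢ κᵢ` in an adapted basis. -/
def kappaMat (y : Fin 3 → ℝ) : Matrix (Fin 5) (Fin 5) ℝ :=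
  !![0, 0, -(√3 * y 1), 0, -(√3 * y 0);
    0, 0, -y 0, -(2 * y 2), -y 1;
    √3 * y 1, y 0, 0, -y 1, -y 2;
    0, 2 * y 2, y 1, 0, -y 0;
    √3 * y 0, y 1, y 2, y 0, 0]

/-- The coordinates of `ξ_σ`, `σ = ∑ᵢ yᵢ κᵢ`. -/
def xiVec (y : Fin 3 → ℝ) : Fin 5 → ℝ :=
  ![(y 0 ^ 2 + y 1 ^ 2 - 2 * y 2 ^ 2) / 2, -(√3 * y 0 * y 1), √3 * y 0 * y 2,
    √3 / 2 * (y 1 ^ 2 - y 0 ^ 2), -(√3 * y 1 * y 2)]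

theorem inner_kappaSum (y : Fin 3 → ℝ) (i j : Fin 5) :
    ⟪kappaSum e y (e j), e i⟫ = kappaMat y i j := by
  have h (i j : Fin 5) : ⟪e i, e j⟫ = if i = j then 1 else 0 := e.inner_eq_ite i j
  fin_cases i <;> fin_cases j <;>
    simp [kappaSum, Fin.sum_univ_three, kappa, wedge, kappaMat, inner_add_left, inner_smul_left,
      h] <;> ring

theorem kappaSum_basis (y : Fin 3 → ℝ) (j : Fin 5) :
    kappaSum e y (e j) = ∑ i, kappaMat y i j • e i := by
  rw [← e.sum_repr' (kappaSum e y (e j))]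
  refine Finset.sum_congr rfl fun i _ ↦ ?_
  rw [real_inner_comm, inner_kappaSum]

theorem xi_kappaSum (y : Fin 3 → ℝ) : xi e (kappaSum e y) = ∑ i, xiVec y i • e i := by
  unfold xi hodgeStarFour
  rw [Finset.smul_sum]
  refine Finset.sum_congr rfl fun m _ ↦ ?_
  rw [smul_smul]
  congr 1
  simp only [det_basis_eq_leviCivita, wedgeSq, inner_kappaSum]
  fin_cases m
  all_goals
    simp [Fin.sum_univ_five, leviCivita, pairSign, kappaMat, xiVec]
  all_goals ring

theorem bivectorInner_kappaSum (y z : Fin 3 → ℝ) :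
    bivectorInner e (kappaSum e y) (kappaSum e z) = 5 * (y 0 * z 0 + y 1 * z 1 + y 2 * z 2) := by
  have hr : √3 ^ 2 = 3 := Real.sq_sqrt (by norm_num)
  have h (j : Fin 5) : ⟪kappaSum e y (e j), kappaSum e z (e j)⟫
      = ∑ i, kappaMat y i j * kappaMat z i j := by
    rw [kappaSum_basis e z j]
    simp only [inner_sum, inner_smul_right, inner_kappaSum]
    exact Finset.sum_congr rfl fun _ _ ↦ mul_comm _ _
  simp only [bivectorInner, h]
  simp [Fin.sum_univ_five, kappaMat]
  linear_combination (y 0 * z 0 + y 1 * z 1) * hr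

theorem kappa_eq_kappaSum (i : Fin 3) : kappa e i = kappaSum e (Pi.single i 1) := by
  simp [kappaSum, Pi.single_apply]

theorem coord_kappaSum (y : Fin 3 → ℝ) : coord e (kappaSum e y) = y := by
  ext i
  rw [coord, kappa_eq_kappaSum, bivectorInner_kappaSum]
  fin_cases i <;> simp

theorem cross_kappaSum (y z : Fin 3 → ℝ) :
    cross e (kappaSum e y) (kappaSum e z) = kappaSum e (crossProduct y z) := by
  simp only [cross, coord_kappaSum]
  rfl

/-- On `H^σ` the endomorphism `J₊^σ` is the polynomial `(7 σ + σ³) / 6` of `σ`: indeed `σ` has the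
eigenvalues `0, ± i, ± 2i`, and `J₊^σ` takes the values `i` and `2i` to `i`. -/
def jMat (y : Fin 3 → ℝ) : Matrix (Fin 5) (Fin 5) ℝ :=
  (1 / 6 : ℝ) • ((7 : ℝ) • kappaMat y + kappaMat y * kappaMat y * kappaMat y)

end Coordinates
end SO3Linear

namespace SO3Linear

/-! ### The complex structure `J₊^σ` -/

section ComplexStructure

variable {V : Type*} [NormedAddCommGroup V] [InnerProductSpace ℝ V]
  (e : OrthonormalBasis (Fin 5) ℝ V)

set_option maxHeartbeats 1000000 in
/-- The matrix of `(2 / 3) σ₊`, with the Hodge star of `H^σ` written out, is the polynomial `jMat` of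
`σ`. -/
theorem selfDual_eq_jMat {y : Fin 3 → ℝ} (hy : y 0 ^ 2 + y 1 ^ 2 + y 2 ^ 2 = 1) (i j : Fin 5) :
    2 / 3 * (1 / 2 * (kappaMat y i j + 1 / 2 * ∑ k, ∑ l, kappaMat y l k *
      ∑ m, xiVec y m * leviCivita m k l j i)) = jMat y i j := by
  have hr : √3 ^ 2 = 3 := Real.sq_sqrt (by norm_num)
  rw [jMat]
  simp only [Matrix.smul_apply, Matrix.add_apply, Matrix.mul_apply, Fin.sum_univ_five, smul_eq_mul]
  generalize √3 = r at *
  fin_cases i <;> fin_cases j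
  all_goals simp [leviCivita, pairSign, kappaMat, xiVec]
  all_goals generalize y 0 = a at *
  all_goals generalize y 1 = b at *
  all_goals generalize y 2 = c at *
  all_goals grind

theorem isLinearMap_jPlus (σ : V →L[ℝ] V) : IsLinearMap ℝ (jPlus e σ) := by
  have h (z : V) : IsLinearMap ℝ (fun x ↦ hodgeStarH e σ x z) := by
    have h₃ := isLinearMap_slot₃ e.toBasis.det
    unfold hodgeStarH
    exact ⟨fun _ _ ↦ by simp_rw [(h₃ ..).map_add, mul_add, Finset.sum_add_distrib, mul_add],
      fun _ _ ↦ by simp_rw [(h₃ ..).map_smul, mul_smul_comm, ← Finset.smul_sum, mul_smul_comm]⟩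
  unfold jPlus sigmaPlus
  refine ⟨fun x x' ↦ ?_, fun c x ↦ ?_⟩
  · rw [← Finset.sum_add_distrib]
    refine Finset.sum_congr rfl fun m _ ↦ ?_
    rw [← add_smul, (h _).map_add, map_add, inner_add_left]
    congr 1; ring
  · rw [Finset.smul_sum]
    refine Finset.sum_congr rfl fun m _ ↦ ?_
    rw [smul_smul, (h _).map_smul, map_smul, inner_smul_left, smul_eq_mul, RCLike.conj_to_real]
    congr 1; ring

theorem jPlus_basis {y : Fin 3 → ℝ} (hy : y 0 ^ 2 + y 1 ^ 2 + y 2 ^ 2 = 1) (j : Fin 5) :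
    jPlus e (kappaSum e y) (e j) = ∑ i, jMat y i j • e i := by
  have h (k l i : Fin 5) : e.toBasis.det ![xi e (kappaSum e y), e k, e l, e j, e i]
      = ∑ m, xiVec y m * leviCivita m k l j i := by
    rw [xi_kappaSum]
    have h := map_sum (IsLinearMap.mk' _ (isLinearMap_slot₀ e.toBasis.det (e k) (e l) (e j) (e i)))
      (fun m ↦ xiVec y m • e m) Finset.univ
    simp only [map_smul, IsLinearMap.mk'_apply, det_basis_eq_leviCivita, smul_eq_mul] at h
    exact h
  unfold jPlus
  refine Finset.sum_congr rfl fun i _ ↦ ?_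
  rw [← selfDual_eq_jMat hy]
  simp only [sigmaPlus, hodgeStarH, h, inner_kappaSum]

end ComplexStructure

/-! ### The space `Λ²₃` and the stabilizer of `Υ` -/

section Upsilon

variable {V : Type*} [NormedAddCommGroup V] [InnerProductSpace ℝ V]
  (e : OrthonormalBasis (Fin 5) ℝ V) {Υ : V →ₗ[ℝ] V →ₗ[ℝ] V →ₗ[ℝ] ℝ}

/-- The components of `Υ` in an adapted basis. -/
def upsilonCoeff : Fin 5 → Matrix (Fin 5) (Fin 5) ℝ :=
  ![!![-1, 0, 0, 0, 0; 0, 1, 0, 0, 0; 0, 0, -(1 / 2), 0, 0; 0, 0, 0, 1, 0; 0, 0, 0, 0, -(1 / 2)],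
    !![0, 1, 0, 0, 0; 1, 0, 0, 0, 0; 0, 0, 0, 0, √3 / 2; 0, 0, 0, 0, 0; 0, 0, √3 / 2, 0, 0],
    !![0, 0, -(1 / 2), 0, 0; 0, 0, 0, 0, √3 / 2; -(1 / 2), 0, 0, -(√3 / 2), 0;
      0, 0, -(√3 / 2), 0, 0; 0, √3 / 2, 0, 0, 0],
    !![0, 0, 0, 1, 0; 0, 0, 0, 0, 0; 0, 0, -(√3 / 2), 0, 0; 1, 0, 0, 0, 0; 0, 0, 0, 0, √3 / 2],
    !![0, 0, 0, 0, -(1 / 2); 0, 0, √3 / 2, 0, 0; 0, √3 / 2, 0, 0, 0; 0, 0, 0, 0, √3 / 2;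
      -(1 / 2), 0, 0, √3 / 2, 0]]

theorem cubicForm_polarization (x y z : Fin 5 → ℝ) :
    cubicForm (x + y + z) - cubicForm (x + y) - cubicForm (x + z) - cubicForm (y + z)
      + cubicForm x + cubicForm y + cubicForm z
      = 6 * ∑ i, ∑ j, ∑ k, upsilonCoeff i j k * (x i * y j * z k) := by
  simp [Fin.sum_univ_five, upsilonCoeff, cubicForm]
  ring

/-- The components of `Υ` are recovered from the cubic form by polarization. -/
theorem upsilon_basis
    (hsymm : ∀ u v w, Υ u v w = Υ v u w ∧ Υ u v w = Υ u w v)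
    (hΥ : ∀ x : Fin 5 → ℝ, Υ (∑ i, x i • e i) (∑ i, x i • e i) (∑ i, x i • e i) = cubicForm x)
    (i j k : Fin 5) : Υ (e i) (e j) (e k) = upsilonCoeff i j k := by
  have hsum (x y : Fin 5 → ℝ) : ∑ i, (x + y) i • e i = ∑ i, x i • e i + ∑ i, y i • e i := by
    simp [add_smul, Finset.sum_add_distrib]
  have hsingle (i : Fin 5) : ∑ j, (Pi.single i 1 : Fin 5 → ℝ) j • e j = e i := by
    simp [Pi.single_apply]
  have h1 := hΥ (Pi.single i 1 + Pi.single j 1 + Pi.single k 1)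
  have h2 := hΥ (Pi.single i 1 + Pi.single j 1)
  have h3 := hΥ (Pi.single i 1 + Pi.single k 1)
  have h4 := hΥ (Pi.single j 1 + Pi.single k 1)
  have h5 := hΥ (Pi.single i 1)
  have h6 := hΥ (Pi.single j 1)
  have h7 := hΥ (Pi.single k 1)
  simp only [hsum, hsingle] at h1 h2 h3 h4 h5 h6 h7
  set u := e i
  set v := e j
  set w := e k
  simp only [map_add, LinearMap.add_apply] at h1 h2 h3 h4 h5 h6 h7
  have s1 := (hsymm u v w).1
  have s2 := (hsymm u v w).2
  have s3 := (hsymm v u w).2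
  have s4 := (hsymm u w v).1
  have s5 := (hsymm v w u).1
  have key : 6 * Υ u v w = cubicForm (Pi.single i 1 + Pi.single j 1 + Pi.single k 1)
      - cubicForm (Pi.single i 1 + Pi.single j 1) - cubicForm (Pi.single i 1 + Pi.single k 1)
      - cubicForm (Pi.single j 1 + Pi.single k 1) + cubicForm (Pi.single i 1)
      + cubicForm (Pi.single j 1) + cubicForm (Pi.single k 1) := by
    linarith
  have hc : cubicForm (Pi.single i 1 + Pi.single j 1 + Pi.single k 1)
      - cubicForm (Pi.single i 1 + Pi.single j 1) - cubicForm (Pi.single i 1 + Pi.single k 1)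
      - cubicForm (Pi.single j 1 + Pi.single k 1) + cubicForm (Pi.single i 1)
      + cubicForm (Pi.single j 1) + cubicForm (Pi.single k 1) = 6 * upsilonCoeff i j k := by
    rw [cubicForm_polarization]
    simp [Pi.single_apply]
  linarith

theorem upsilonHat_basis
    (hΥ : ∀ i j k, Υ (e i) (e j) (e k) = upsilonCoeff i j k) (W : V →L[ℝ] V) (x : Fin 5) :
    upsilonHat e Υ W (e x) =
      ∑ i, (4 * ∑ j, ∑ l, ∑ m, ⟪W (e j), e l⟫ * upsilonCoeff j x m * upsilonCoeff l m i) • e i := by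
  have h1 (j : Fin 5) : upsilonOp e Υ (e j) (e x) = ∑ m, upsilonCoeff j x m • e m := by
    simp only [upsilonOp, hΥ]
  have h2 (j m : Fin 5) : upsilonOp e Υ (W (e j)) (e m)
      = ∑ i, (∑ l, ⟪W (e j), e l⟫ * upsilonCoeff l m i) • e i := by
    conv_lhs => rw [← e.sum_repr' (W (e j))]
    unfold upsilonOp
    refine Finset.sum_congr rfl fun i _ ↦ ?_
    congr 1
    simp only [map_sum, map_smul, LinearMap.sum_apply, LinearMap.smul_apply, hΥ, smul_eq_mul,
      real_inner_comm]
  have h3 (j : Fin 5) : upsilonOp e Υ (W (e j)) (upsilonOp e Υ (e j) (e x))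
      = ∑ i, (∑ l, ∑ m, ⟪W (e j), e l⟫ * upsilonCoeff j x m * upsilonCoeff l m i) • e i := by
    have hlin := isLinearMap_upsilonOp_right e Υ (W (e j))
    have h := map_sum (IsLinearMap.mk' _ hlin) (fun m ↦ upsilonCoeff j x m • e m) Finset.univ
    simp only [map_smul, IsLinearMap.mk'_apply] at h
    rw [h1, h]
    simp only [h2, Finset.smul_sum]
    rw [Finset.sum_comm]
    refine Finset.sum_congr rfl fun i _ ↦ ?_
    rw [Finset.sum_comm, Finset.sum_smul]
    simp only [Finset.smul_sum, Finset.sum_smul, smul_smul]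
    refine Finset.sum_congr rfl fun l _ ↦ Finset.sum_congr rfl fun m _ ↦ ?_
    congr 1
    ring
  simp only [upsilonHat, h3]
  rw [Finset.sum_comm, Finset.smul_sum]
  simp only [← Finset.sum_smul, smul_smul]

/-- The eigenvalue equation `Υ̂(W) = 7 W` in coordinates. -/
theorem eq_kappaMat_of_eigen {w : Fin 5 → Fin 5 → ℝ}
    (h : ∀ i x, 4 * ∑ j, ∑ l, ∑ m, w l j * upsilonCoeff j x m * upsilonCoeff l m i = 7 * w i x)
    (i j : Fin 5) : w i j = kappaMat ![w 4 3, w 3 2, w 4 2] i j := by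
  have hr : √3 ^ 2 = 3 := Real.sq_sqrt (by norm_num)
  simp only [Fin.sum_univ_five] at h
  generalize hs : √3 = r at *
  simp only [Fin.forall_fin_succ] at h
  simp [upsilonCoeff, hs] at h
  obtain ⟨⟨h00, h01, h02, h03, h04⟩, ⟨h10, h11, h12, h13, h14⟩, ⟨h20, h21, h22, h23, h24⟩,
    ⟨h30, h31, h32, h33, h34⟩, h40, h41, h42, h43, h44⟩ := h
  -- the equations split into four blocks
  have hq (t : ℝ) : t * (r / 2) * (r / 2) = 3 / 4 * t := by linear_combination t / 4 * hr
  simp only [hq] at h00 h01 h02 h03 h04 h10 h11 h12 h13 h14 h20 h21 h22 h23 h24 h30 h31 h32 h33 h34 h40 h41 h42 h43 h44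
  clear hq
  have b₁ : w 0 0 = 0 ∧ w 1 1 = 0 ∧ w 2 2 = 0 ∧ w 3 3 = 0 ∧ w 4 4 = 0 ∧ w 0 3 = 0 ∧ w 3 0 = 0 := by
    clear hs h01 h02 h04 h10 h12 h13 h14 h20 h21 h23 h24 h31 h32 h34 h40 h41 h42 h43
    have e1 : w 0 3 = w 3 0 := by linarith
    have e2 : r * (w 2 2 - w 4 4) = 7 * w 3 0 := by linarith
    have e3 : w 1 1 = w 3 3 := by linarith
    rw [e1] at h22 h44
    have e4 : 6 * (w 2 2 - w 4 4) = 4 * r * w 3 0 := by linarith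
    have e5 : w 3 0 = 0 := by grind
    have e6 : w 2 2 = w 4 4 := by grind
    grind
  have b₂ : w 0 1 = 0 ∧ w 1 0 = 0 ∧ w 1 3 = -(2 * w 4 2) ∧ w 3 1 = 2 * w 4 2 ∧
      w 2 4 = - w 4 2 := by
    clear hs h00 h02 h03 h04 h11 h12 h14 h20 h21 h22 h23 h30 h32 h33 h34 h40 h41 h43 h44
    grind
  have b₃ : w 0 2 = -(r * w 3 2) ∧ w 2 0 = r * w 3 2 ∧ w 1 4 = - w 3 2 ∧ w 4 1 = w 3 2 ∧
      w 2 3 = - w 3 2 := by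
    clear hs h00 h01 h03 h04 h10 h11 h12 h13 h21 h22 h24 h30 h31 h33 h34 h40 h42 h43 h44
    grind
  have b₄ : w 0 4 = -(r * w 4 3) ∧ w 4 0 = r * w 4 3 ∧ w 1 2 = - w 4 3 ∧ w 2 1 = w 4 3 ∧
      w 3 4 = - w 4 3 := by
    clear hs h00 h01 h02 h03 h10 h11 h13 h14 h20 h22 h23 h24 h30 h31 h32 h33 h41 h42 h44
    grind
  clear h00 h01 h02 h03 h04 h10 h11 h12 h13 h14 h20 h21 h22 h23 h24 h30 h31 h32 h33 h34 h40 h41 h42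
  clear h43 h44
  fin_cases i <;> fin_cases j <;> simp [kappaMat, hs, b₁, b₂, b₃, b₄]

theorem eigen_kappaMat (y : Fin 3 → ℝ) (i x : Fin 5) :
    4 * ∑ j, ∑ l, ∑ m, kappaMat y l j * upsilonCoeff j x m * upsilonCoeff l m i
      = 7 * kappaMat y i x := by
  have hr : √3 ^ 2 = 3 := Real.sq_sqrt (by norm_num)
  generalize hs : √3 = r at *
  fin_cases i <;> fin_cases x <;>
    simp [upsilonCoeff, Fin.sum_univ_five, kappaMat, hs] <;> grind

theorem ext_inner_basis {A B : V →L[ℝ] V} (h : ∀ i j, ⟪A (e j), e i⟫ = ⟪B (e j), e i⟫) : A = B := by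
  refine ContinuousLinearMap.coe_injective (e.toBasis.ext fun j ↦ ?_)
  simp only [OrthonormalBasis.coe_toBasis, ContinuousLinearMap.coe_coe]
  refine e.toBasis.ext_elem fun i ↦ ?_
  simp only [OrthonormalBasis.coe_toBasis_repr_apply, e.repr_apply_apply]
  rw [real_inner_comm, h, real_inner_comm]

/-- `Λ²₃` is spanned by `κ₁, κ₂, κ₃`. -/
theorem mem_lambda23_iff
    (hΥ : ∀ i j k, Υ (e i) (e j) (e k) = upsilonCoeff i j k) (W : V →L[ℝ] V) :
    W ∈ lambda23 e Υ ↔ ∃ y, W = kappaSum e y := by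
  have h1 (x i : Fin 5) : ⟪upsilonHat e Υ W (e x), e i⟫ =
      4 * ∑ j, ∑ l, ∑ m, ⟪W (e j), e l⟫ * upsilonCoeff j x m * upsilonCoeff l m i := by
    rw [upsilonHat_basis e hΥ, sum_inner]
    simp [inner_smul_left, e.inner_eq_ite]
  constructor
  · intro h
    change ∀ x, upsilonHat e Υ W x = _ at h
    refine ⟨![⟪W (e 3), e 4⟫, ⟪W (e 2), e 3⟫, ⟪W (e 2), e 4⟫], ext_inner_basis e fun i j ↦ ?_⟩
    rw [inner_kappaSum]
    refine eq_kappaMat_of_eigen (w := fun i j ↦ ⟪W (e j), e i⟫) (fun i x ↦ ?_) i j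
    simp only [← h1, h (e x), inner_smul_left, RCLike.conj_to_real]
  · rintro ⟨y, rfl⟩
    change ∀ x, upsilonHat e Υ (kappaSum e y) x = _
    have hb (x : Fin 5) :
        upsilonHat e Υ (kappaSum e y) (e x) = (7 : ℝ) • kappaSum e y (e x) := by
      rw [upsilonHat_basis e hΥ, kappaSum_basis, Finset.smul_sum]
      refine Finset.sum_congr rfl fun i _ ↦ ?_
      simp only [inner_kappaSum, eigen_kappaMat, smul_smul]
    have hlin : IsLinearMap ℝ (upsilonHat e Υ (kappaSum e y)) := by
      have hadd (v a b : V) : upsilonOp e Υ v (a + b) = upsilonOp e Υ v a + upsilonOp e Υ v b :=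
        (isLinearMap_upsilonOp_right e Υ v).map_add a b
      have hsmul (v a : V) (c : ℝ) : upsilonOp e Υ v (c • a) = c • upsilonOp e Υ v a :=
        (isLinearMap_upsilonOp_right e Υ v).map_smul c a
      unfold upsilonHat
      exact ⟨fun a b ↦ by simp only [hadd, Finset.sum_add_distrib, smul_add],
        fun c a ↦ by simp only [hsmul, ← Finset.smul_sum, smul_comm c]⟩
    have := e.toBasis.ext (f₁ := IsLinearMap.mk' _ hlin)
      (f₂ := (7 : ℝ) • (kappaSum e y).toLinearMap) fun x ↦ by simpa using hb x
    exact fun x ↦ congr($this x)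

/-- An infinitesimal isometry annihilating `Υ` belongs to the span of `κ₁, κ₂, κ₃`: the Lie algebra
of the stabilizer of `Υ` is `𝔰𝔬(3)`. -/
theorem eq_kappaMat_of_annihilates {g : Fin 5 → Fin 5 → ℝ} (hskew : ∀ i j, g i j = -g j i)
    (h : ∀ i j k, ∑ l, (g l i * upsilonCoeff l j k + g l j * upsilonCoeff i l k
      + g l k * upsilonCoeff i j l) = 0) (i j : Fin 5) :
    g i j = kappaMat ![g 4 3, g 3 2, g 4 2] i j := by
  have hr : √3 ^ 2 = 3 := Real.sq_sqrt (by norm_num)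
  generalize hs : √3 = r at *
  simp only [Fin.sum_univ_five] at h
  -- fifteen components of the equation suffice
  have d (i) : g i i = 0 := by linarith [hskew i i]
  have e1 := h 0 0 1
  have e2 := h 0 0 2
  have e3 := h 0 0 3
  have e4 := h 0 0 4
  have e5 := h 0 1 2
  have e6 := h 0 1 3
  have e7 := h 0 1 4
  have e8 := h 0 2 3
  have e9 := h 0 2 4
  have e10 := h 0 3 4
  have e11 := h 2 2 4
  have e12 := h 1 2 3
  have e13 := h 2 2 2
  have e14 := h 1 2 2
  have e15 := h 2 3 4
  clear h
  have s := fun j i (_ : i < j) ↦ hskew i j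
  simp [upsilonCoeff, hs, d] at e1 e2 e3 e4 e5 e6 e7 e8 e9 e10 e11 e12 e13 e14 e15
  have h01 := hskew 0 1
  have h02 := hskew 0 2
  have h03 := hskew 0 3
  have h04 := hskew 0 4
  have h12 := hskew 1 2
  have h13 := hskew 1 3
  have h14 := hskew 1 4
  have h23 := hskew 2 3
  have h24 := hskew 2 4
  have h34 := hskew 3 4
  clear hskew s
  fin_cases i <;> fin_cases j <;> simp [kappaMat, hs, d] <;> grind

end Upsilon
end SO3Linear

namespace SO3Linear

open Matrix

/-! ### Polynomial identities for `ξ_σ` and `J₊^σ` -/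

section PolynomialIdentities

/-- The differential of `y ↦ xiVec y` at `y` in the direction `v`. -/
def dxiVec (y v : Fin 3 → ℝ) : Fin 5 → ℝ :=
  ![y 0 * v 0 + y 1 * v 1 - 2 * (y 2 * v 2), -(√3 * (y 0 * v 1 + v 0 * y 1)),
    √3 * (y 0 * v 2 + v 0 * y 2), √3 * (y 1 * v 1 - y 0 * v 0),
    -(√3 * (y 1 * v 2 + v 1 * y 2))]

variable {y : Fin 3 → ℝ}

theorem xiVec_dotProduct_self (hy : y 0 ^ 2 + y 1 ^ 2 + y 2 ^ 2 = 1) : xiVec y ⬝ᵥ xiVec y = 1 := by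
  have hr : √3 ^ 2 = 3 := Real.sq_sqrt (by norm_num)
  simp only [dotProduct, Fin.sum_univ_five, xiVec]
  generalize √3 = r at *
  simp
  generalize y 0 = a at *
  generalize y 1 = b at *
  generalize y 2 = c at *
  grind

theorem dxiVec_dotProduct_xiVec {v : Fin 3 → ℝ} (hv : y 0 * v 0 + y 1 * v 1 + y 2 * v 2 = 0) :
    dxiVec y v ⬝ᵥ xiVec y = 0 := by
  have hr : √3 ^ 2 = 3 := Real.sq_sqrt (by norm_num)
  simp only [dotProduct, Fin.sum_univ_five, xiVec, dxiVec]
  generalize √3 = r at *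
  simp
  generalize y 0 = a at *
  generalize y 1 = b at *
  generalize y 2 = c at *
  grind

set_option maxHeartbeats 1000000 in
/-- The commutator of bivectors corresponds to the vector product up to the sign. -/
theorem commutator_kappaMat (z y : Fin 3 → ℝ) :
    kappaMat z * kappaMat y - kappaMat y * kappaMat z = kappaMat (crossProduct y z) := by
  have hr : √3 ^ 2 = 3 := Real.sq_sqrt (by norm_num)
  ext i j
  simp only [Matrix.sub_apply, mul_apply, Fin.sum_univ_five, cross_apply]
  generalize hs : √3 = r at *
  fin_cases i <;> fin_cases j <;> simp [kappaMat, hs] <;> clear hs <;> grind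

/-- The map `σ ↦ ξ_σ` is equivariant under the infinitesimal action of `SO(3)`. -/
theorem dxiVec_cross (y z : Fin 3 → ℝ) :
    dxiVec y (crossProduct y z) = kappaMat z *ᵥ xiVec y := by
  have hr : √3 ^ 2 = 3 := Real.sq_sqrt (by norm_num)
  ext i
  simp only [mulVec, dotProduct, Fin.sum_univ_five, cross_apply]
  generalize hs : √3 = r at *
  fin_cases i <;> simp [kappaMat, dxiVec, xiVec, hs] <;> clear hs <;> grind

theorem jMat_transpose (y : Fin 3 → ℝ) : (jMat y)ᵀ = -jMat y := by
  have hk : (kappaMat y)ᵀ = -kappaMat y := by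
    ext i j
    fin_cases i <;> fin_cases j <;> simp [kappaMat]
  simp only [jMat, transpose_smul, transpose_add, transpose_mul, hk]
  simp [mul_assoc]
  abel

theorem kappaMat_mulVec_xiVec (y : Fin 3 → ℝ) : kappaMat y *ᵥ xiVec y = 0 := by
  rw [← dxiVec_cross, cross_self]
  ext i
  fin_cases i <;> simp [dxiVec]

theorem jMat_mulVec_xiVec (y : Fin 3 → ℝ) : jMat y *ᵥ xiVec y = 0 := by
  simp [jMat, smul_mulVec, add_mulVec, ← mulVec_mulVec, kappaMat_mulVec_xiVec]

set_option maxHeartbeats 1000000 in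
/-- The endomorphism `σ` vanishes on `ξ_σ` and has the eigenvalues `± i`, `± 2i` on `H^σ`. -/
theorem kappaMat_quartic (hy : y 0 ^ 2 + y 1 ^ 2 + y 2 ^ 2 = 1) :
    (5 : ℝ) • (kappaMat y * kappaMat y) + kappaMat y * kappaMat y * (kappaMat y * kappaMat y)
      = (4 : ℝ) • (vecMulVec (xiVec y) (xiVec y) - 1) := by
  have hr : √3 ^ 2 = 3 := Real.sq_sqrt (by norm_num)
  ext i j
  simp only [Matrix.add_apply, Matrix.sub_apply, Matrix.smul_apply, mul_apply, Fin.sum_univ_five,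
    vecMulVec_apply, smul_eq_mul]
  generalize √3 = r at *
  fin_cases i <;> fin_cases j
  all_goals simp [kappaMat, xiVec]
  all_goals generalize y 0 = a at *
  all_goals generalize y 1 = b at *
  all_goals generalize y 2 = c at *
  all_goals grind

/-- `J₊^σ` is a complex structure on `H^σ`. -/
theorem jMat_sq (hy : y 0 ^ 2 + y 1 ^ 2 + y 2 ^ 2 = 1) :
    jMat y * jMat y = vecMulVec (xiVec y) (xiVec y) - 1 := by
  have hq := kappaMat_quartic hy
  have h0 : kappaMat y * vecMulVec (xiVec y) (xiVec y) = 0 := by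
    rw [mul_vecMulVec, kappaMat_mulVec_xiVec, zero_vecMulVec]
  have h6 := congr(kappaMat y * (kappaMat y * $hq))
  set S := kappaMat y
  set P := vecMulVec (xiVec y) (xiVec y)
  have h6' : (5 : ℝ) • (S * S * S * S) + S * S * S * S * S * S = -((4 : ℝ) • (S * S)) := by
    have : S * (S * ((4 : ℝ) • (P - 1))) = -((4 : ℝ) • (S * S)) := by
      rw [mul_smul_comm, mul_sub, h0]; simp
    rw [← this, ← h6]
    simp only [mul_add, mul_smul_comm, mul_assoc]
  have hq' : (5 : ℝ) • (S * S) + S * S * S * S = (4 : ℝ) • (P - 1) := by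
    rw [← hq]; simp only [mul_assoc]
  have hJ : jMat y * jMat y
      = (1 / 36 : ℝ) • ((49 : ℝ) • (S * S) + (14 : ℝ) • (S * S * S * S) + S * S * S * S * S * S) := by
    change ((1 / 6 : ℝ) • ((7 : ℝ) • S + S * S * S)) * ((1 / 6 : ℝ) • ((7 : ℝ) • S + S * S * S)) = _
    simp only [smul_mul_assoc, mul_smul_comm, mul_add, add_mul, mul_assoc]
    module
  rw [hJ, show P - 1 = (1 / 4 : ℝ) • ((4 : ℝ) • (P - 1)) by rw [smul_smul]; norm_num, ← hq',
    show S * S * S * S * S * S = -((4 : ℝ) • (S * S)) - (5 : ℝ) • (S * S * S * S) by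
      rw [← h6']; abel]
  module

/-- The differential of `σ ↦ ξ_σ` intertwines the complex structure `V ↦ -σ × V` of the sphere with
`J₊^σ`. -/
theorem jMat_mulVec_dxiVec (hy : y 0 ^ 2 + y 1 ^ 2 + y 2 ^ 2 = 1) {v : Fin 3 → ℝ}
    (hv : y 0 * v 0 + y 1 * v 1 + y 2 * v 2 = 0) :
    jMat y *ᵥ dxiVec y v = dxiVec y (-crossProduct y v) := by
  have hyy {v : Fin 3 → ℝ} (hv : y 0 * v 0 + y 1 * v 1 + y 2 * v 2 = 0) :
      crossProduct y (crossProduct y v) = -v := by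
    ext i
    fin_cases i <;> simp [cross_apply] <;> grind
  have hneg (v : Fin 3 → ℝ) : dxiVec y (-v) = -dxiVec y v := by
    ext i
    fin_cases i <;> simp [dxiVec] <;> ring
  have hort (v : Fin 3 → ℝ) : y 0 * crossProduct y v 0 + y 1 * crossProduct y v 1
      + y 2 * crossProduct y v 2 = 0 := by
    simp [cross_apply]; ring
  -- `σ` rotates the plane of weight one spanned by the values of the differential
  have hrot (u : Fin 3 → ℝ) : kappaMat y *ᵥ dxiVec y (crossProduct y u)
      = -dxiVec y (crossProduct y (crossProduct y u)) := by
    have h := congr($(commutator_kappaMat y u) *ᵥ xiVec y)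
    rw [sub_mulVec, ← mulVec_mulVec, ← mulVec_mulVec, kappaMat_mulVec_xiVec, mulVec_zero,
      sub_zero, ← dxiVec_cross, ← dxiVec_cross, ← cross_anticomm y u, map_neg, hneg] at h
    exact h
  have hrot' {v : Fin 3 → ℝ} (hv : y 0 * v 0 + y 1 * v 1 + y 2 * v 2 = 0) :
      kappaMat y *ᵥ dxiVec y v = -dxiVec y (crossProduct y v) := by
    have h := hrot (-crossProduct y v)
    simpa only [map_neg, hyy hv, neg_neg] using h
  have h3 : kappaMat y *ᵥ (kappaMat y *ᵥ (kappaMat y *ᵥ dxiVec y v))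
      = dxiVec y (crossProduct y v) := by
    rw [hrot' hv, mulVec_neg, hrot' (hort v), hyy hv, hneg, neg_neg, mulVec_neg, hrot' hv, neg_neg]
  rw [jMat, smul_mulVec, add_mulVec, smul_mulVec, ← mulVec_mulVec, ← mulVec_mulVec, h3, hrot' hv,
    hneg]
  module

end PolynomialIdentities

end SO3Linear

namespace SO3Linear

open Matrix

/-! ### The contractions of a three-form with the vectors `ξ_σ` -/

section ThreeForms

/-- The Hodge star of an alternating `3`-form with components `t`: the entry `(i, j)` is the value
of the `2`-form at `(e_j, e_i)`. -/
def starMat (t : Fin 5 → Fin 5 → Fin 5 → ℝ) : Matrix (Fin 5) (Fin 5) ℝ :=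
  of fun i j ↦ 1 / 6 * ∑ k, ∑ l, ∑ m, t k l m * leviCivita k l m j i

/-- The `2`-form `t(·, ·, ξ_σ)`, `σ = ∑ᵢ yᵢ κᵢ`. -/
def contractXi (t : Fin 5 → Fin 5 → Fin 5 → ℝ) (y : Fin 3 → ℝ) : Matrix (Fin 5) (Fin 5) ℝ :=
  of fun i j ↦ ∑ k, t i j k * xiVec y k

variable {y : Fin 3 → ℝ} {t : Fin 5 → Fin 5 → Fin 5 → ℝ}

set_option maxHeartbeats 1000000 in
theorem starMat_eq (h₁ : ∀ i j k, t i j k = -t j i k) (h₂ : ∀ i j k, t i j k = -t i k j) :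
    starMat t =
    !![0, -t 2 3 4, t 1 3 4, -t 1 2 4, t 1 2 3;
      t 2 3 4, 0, -t 0 3 4, t 0 2 4, -t 0 2 3;
      -t 1 3 4, t 0 3 4, 0, -t 0 1 4, t 0 1 3;
      t 1 2 4, -t 0 2 4, t 0 1 4, 0, -t 0 1 2;
      -t 1 2 3, t 0 2 3, -t 0 1 3, t 0 1 2, 0] := by
  have s₁ (i j k : Fin 5) (_ : j < i) : t i j k = -t j i k := h₁ i j k
  have s₂ (i j k : Fin 5) (_ : k < j) : t i j k = -t i k j := h₂ i j k
  clear h₁ h₂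
  ext i j
  simp only [starMat, Fin.sum_univ_five, of_apply]
  fin_cases i <;> fin_cases j <;> simp [leviCivita, pairSign]
  all_goals simp [s₁, s₂]
  all_goals ring

theorem contractXi_eq (h₁ : ∀ i j k, t i j k = -t j i k) (h₂ : ∀ i j k, t i j k = -t i k j)
    (y : Fin 3 → ℝ) : contractXi t y =
    !![0, t 0 1 2 * xiVec y 2 + t 0 1 3 * xiVec y 3 + t 0 1 4 * xiVec y 4,
        -t 0 1 2 * xiVec y 1 + t 0 2 3 * xiVec y 3 + t 0 2 4 * xiVec y 4,
        -t 0 1 3 * xiVec y 1 - t 0 2 3 * xiVec y 2 + t 0 3 4 * xiVec y 4,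
        -t 0 1 4 * xiVec y 1 - t 0 2 4 * xiVec y 2 - t 0 3 4 * xiVec y 3;
      -(t 0 1 2 * xiVec y 2 + t 0 1 3 * xiVec y 3 + t 0 1 4 * xiVec y 4), 0,
        t 0 1 2 * xiVec y 0 + t 1 2 3 * xiVec y 3 + t 1 2 4 * xiVec y 4,
        t 0 1 3 * xiVec y 0 - t 1 2 3 * xiVec y 2 + t 1 3 4 * xiVec y 4,
        t 0 1 4 * xiVec y 0 - t 1 2 4 * xiVec y 2 - t 1 3 4 * xiVec y 3;
      -(-t 0 1 2 * xiVec y 1 + t 0 2 3 * xiVec y 3 + t 0 2 4 * xiVec y 4),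
        -(t 0 1 2 * xiVec y 0 + t 1 2 3 * xiVec y 3 + t 1 2 4 * xiVec y 4), 0,
        t 0 2 3 * xiVec y 0 + t 1 2 3 * xiVec y 1 + t 2 3 4 * xiVec y 4,
        t 0 2 4 * xiVec y 0 + t 1 2 4 * xiVec y 1 - t 2 3 4 * xiVec y 3;
      -(-t 0 1 3 * xiVec y 1 - t 0 2 3 * xiVec y 2 + t 0 3 4 * xiVec y 4),
        -(t 0 1 3 * xiVec y 0 - t 1 2 3 * xiVec y 2 + t 1 3 4 * xiVec y 4),
        -(t 0 2 3 * xiVec y 0 + t 1 2 3 * xiVec y 1 + t 2 3 4 * xiVec y 4), 0,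
        t 0 3 4 * xiVec y 0 + t 1 3 4 * xiVec y 1 + t 2 3 4 * xiVec y 2;
      -(-t 0 1 4 * xiVec y 1 - t 0 2 4 * xiVec y 2 - t 0 3 4 * xiVec y 3),
        -(t 0 1 4 * xiVec y 0 - t 1 2 4 * xiVec y 2 - t 1 3 4 * xiVec y 3),
        -(t 0 2 4 * xiVec y 0 + t 1 2 4 * xiVec y 1 - t 2 3 4 * xiVec y 3),
        -(t 0 3 4 * xiVec y 0 + t 1 3 4 * xiVec y 1 + t 2 3 4 * xiVec y 2), 0] := by
  have s₁ (i j k : Fin 5) (_ : j < i) : t i j k = -t j i k := h₁ i j k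
  have s₂ (i j k : Fin 5) (_ : k < j) : t i j k = -t i k j := h₂ i j k
  have z₁ (i k : Fin 5) : t i i k = 0 := by linarith [h₁ i i k]
  have z₂ (i k : Fin 5) : t i k k = 0 := by linarith [h₂ i k k]
  clear h₁ h₂
  ext i j
  fin_cases i <;> fin_cases j <;> simp [contractXi, Fin.sum_univ_five, z₁, z₂, s₁, s₂] <;> ring

/-- The contraction of the `3`-form `∗τ`, `τ = ∑ᵢ zᵢ κᵢ`, with the vector of coordinates `x`. -/
def kappaContract (x : Fin 5 → ℝ) (z : Fin 3 → ℝ) : Matrix (Fin 5) (Fin 5) ℝ :=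
    !![0, z 0 * x 2 - z 2 * x 3 + z 1 * x 4, -(z 0 * x 1) + z 1 * x 3 - 2 * z 2 * x 4,
        z 2 * x 1 - z 1 * x 2 + z 0 * x 4, -(z 1 * x 1) + 2 * z 2 * x 2 - z 0 * x 3;
      -(z 0 * x 2 - z 2 * x 3 + z 1 * x 4), 0, z 0 * x 0 - √3 * z 0 * x 3,
        -(z 2 * x 0) + √3 * z 0 * x 2 - √3 * z 1 * x 4, z 1 * x 0 + √3 * z 1 * x 3;
      -(-(z 0 * x 1) + z 1 * x 3 - 2 * z 2 * x 4), -(z 0 * x 0 - √3 * z 0 * x 3), 0,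
        z 1 * x 0 - √3 * z 0 * x 1, -(2 * z 2 * x 0);
      -(z 2 * x 1 - z 1 * x 2 + z 0 * x 4), -(-(z 2 * x 0) + √3 * z 0 * x 2 - √3 * z 1 * x 4),
        -(z 1 * x 0 - √3 * z 0 * x 1), 0, z 0 * x 0 - √3 * z 1 * x 1;
      -(-(z 1 * x 1) + 2 * z 2 * x 2 - z 0 * x 3), -(z 1 * x 0 + √3 * z 1 * x 3), 2 * z 2 * x 0,
        -(z 0 * x 0 - √3 * z 1 * x 1), 0]

theorem contractXi_eq_kappaContract
    (h₁ : ∀ i j k, t i j k = -t j i k) (h₂ : ∀ i j k, t i j k = -t i k j)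
    {z : Fin 3 → ℝ} (hz : starMat t = kappaMat z) (y : Fin 3 → ℝ) :
    contractXi t y = kappaContract (xiVec y) z := by
  rw [starMat_eq h₁ h₂] at hz
  have e012 : t 0 1 2 = z 0 := by simpa [kappaMat] using congr($hz 4 3)
  have e013 : t 0 1 3 = -z 2 := by simpa [kappaMat] using congr($hz 2 4)
  have e014 : t 0 1 4 = z 1 := by simpa [kappaMat] using congr($hz 3 2)
  have e023 : t 0 2 3 = z 1 := by simpa [kappaMat] using congr($hz 4 1)
  have e024 : t 0 2 4 = -(2 * z 2) := by simpa [kappaMat] using congr($hz 1 3)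
  have e034 : t 0 3 4 = z 0 := by simpa [kappaMat] using congr($hz 2 1)
  have e123 : t 1 2 3 = -(√3 * z 0) := by simpa [kappaMat] using congr($hz 0 4)
  have e124 : t 1 2 4 = 0 := by simpa [kappaMat] using congr($hz 3 0)
  have e134 : t 1 3 4 = -(√3 * z 1) := by simpa [kappaMat] using congr($hz 0 2)
  have e234 : t 2 3 4 = 0 := by simpa [kappaMat] using congr($hz 1 0)
  rw [contractXi_eq h₁ h₂ y, e012, e013, e014, e023, e024, e034, e123, e124, e134, e234]
  generalize xiVec y = x
  ext i j
  fin_cases i <;> fin_cases j <;> simp [kappaContract] <;> ring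

set_option maxHeartbeats 1000000 in
/-- The formula `J₊^σ = (2 / 3) σ₊`, in which the Hodge star of `σ` on `H^σ` is, up to the sign, the
contraction of `∗σ` with `ξ_σ`. In this form only quadratic polynomials of `y` occur. -/
theorem jMat_eq_selfDual (hy : y 0 ^ 2 + y 1 ^ 2 + y 2 ^ 2 = 1) :
    jMat y = (1 / 3 : ℝ) • (kappaMat y - kappaContract (xiVec y) y) := by
  have hr : √3 ^ 2 = 3 := Real.sq_sqrt (by norm_num)
  ext i j
  simp only [jMat, Matrix.smul_apply, Matrix.sub_apply, Matrix.add_apply, mul_apply,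
    Fin.sum_univ_five, smul_eq_mul]
  generalize hs : √3 = r at *
  fin_cases i <;> fin_cases j
  all_goals simp [kappaMat, xiVec, kappaContract, hs]
  all_goals clear hs
  all_goals generalize y 0 = a at *
  all_goals generalize y 1 = b at *
  all_goals generalize y 2 = c at *
  all_goals grind

set_option maxHeartbeats 1000000 in
/-- The product of the forms `(∗τ)(·, ·, ξ_σ)` and `3 J₊^σ` is symmetric, that is, they commute. -/
theorem kappaContract_mul_symm (hy : y 0 ^ 2 + y 1 ^ 2 + y 2 ^ 2 = 1) (z : Fin 3 → ℝ)
    (i j : Fin 5) (hij : i < j) :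
    (kappaContract (xiVec y) z * (kappaMat y - kappaContract (xiVec y) y)) i j
      = (kappaContract (xiVec y) z * (kappaMat y - kappaContract (xiVec y) y)) j i := by
  have hr : √3 ^ 2 = 3 := Real.sq_sqrt (by norm_num)
  simp only [Matrix.sub_apply, mul_apply, Fin.sum_univ_five]
  generalize hs : √3 = r at *
  fin_cases i <;> fin_cases j
  all_goals simp at hij
  all_goals simp [kappaMat, xiVec, kappaContract, hs]
  all_goals clear hs
  all_goals generalize y 0 = a at *
  all_goals generalize y 1 = b at *
  all_goals generalize y 2 = c at *
  all_goals generalize z 0 = u at *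
  all_goals generalize z 1 = v at *
  all_goals generalize z 2 = w at *
  all_goals grind

theorem contractXi_mulVec_xiVec (h₂ : ∀ i j k, t i j k = -t i k j) (y : Fin 3 → ℝ) : contractXi t y *ᵥ xiVec y = 0 := by
  ext i
  have h : ∑ j, ∑ k, t i j k * xiVec y k * xiVec y j
      = -∑ j, ∑ k, t i j k * xiVec y k * xiVec y j := by
    conv_lhs => rw [Finset.sum_comm]
    simp only [← Finset.sum_neg_distrib]
    refine Finset.sum_congr rfl fun j _ ↦ Finset.sum_congr rfl fun k _ ↦ ?_
    rw [h₂]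
    ring
  simp only [mulVec, dotProduct, contractXi, of_apply, Finset.sum_mul, Pi.zero_apply]
  linarith

theorem contractXi_transpose (h₁ : ∀ i j k, t i j k = -t j i k) (y : Fin 3 → ℝ) :
    (contractXi t y)ᵀ = -contractXi t y := by
  ext i j
  simp only [contractXi, transpose_apply, of_apply, Matrix.neg_apply, ← Finset.sum_neg_distrib]
  exact Finset.sum_congr rfl fun k _ ↦ by rw [h₁]; ring

/-- The form `(∗τ)(·, ·, ξ_σ)` with `τ` in `Λ²₃` is of type `(1, 1)` for `J₊^σ`. -/
theorem jMat_transpose_mul_contractXi_mul_jMat (h₁ : ∀ i j k, t i j k = -t j i k)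
    (h₂ : ∀ i j k, t i j k = -t i k j) {z : Fin 3 → ℝ} (hz : starMat t = kappaMat z)
    (hy : y 0 ^ 2 + y 1 ^ 2 + y 2 ^ 2 = 1) :
    (jMat y)ᵀ * contractXi t y * jMat y = contractXi t y := by
  have hK := contractXi_transpose h₁ y
  have hξ := contractXi_mulVec_xiVec h₂ y
  have hsymm : (contractXi t y * jMat y)ᵀ = contractXi t y * jMat y := by
    rw [contractXi_eq_kappaContract h₁ h₂ hz, jMat_eq_selfDual hy, mul_smul_comm, transpose_smul]
    congr 1
    ext i j
    rw [transpose_apply]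
    rcases lt_trichotomy i j with h | rfl | h
    · exact (kappaContract_mul_symm hy z i j h).symm
    · rfl
    · exact kappaContract_mul_symm hy z j i h
  -- hence `J` commutes with the form
  have hcomm : jMat y * contractXi t y = contractXi t y * jMat y := by
    rw [← hsymm, transpose_mul, hK, jMat_transpose]; simp
  rw [jMat_transpose, neg_mul, hcomm, neg_mul, mul_assoc, jMat_sq hy, mul_sub, mul_vecMulVec, hξ]
  simp

end ThreeForms
end SO3Linear

namespace SO3Linear

open Matrix

section ThreeForms

variable {y : Fin 3 → ℝ} {t : Fin 5 → Fin 5 → Fin 5 → ℝ}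

theorem jMat_mul_contractXi_comm (hy : y 0 ^ 2 + y 1 ^ 2 + y 2 ^ 2 = 1)
    (h₂ : ∀ i j k, t i j k = -t i k j)
    (h : (jMat y)ᵀ * contractXi t y * jMat y = contractXi t y) :
    jMat y * contractXi t y = contractXi t y * jMat y := by
  have hξ := contractXi_mulVec_xiVec h₂ y
  conv_rhs => rw [← h]
  rw [jMat_transpose, neg_mul, neg_mul, neg_mul, mul_assoc, jMat_sq hy, mul_sub, mul_vecMulVec,
    ← mulVec_mulVec, hξ]
  simp

/-- If all the forms `t(·, ·, ξ_σ)` are of type `(1, 1)` for `J₊^σ`, then `∗t` lies in `Λ²₃`: the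
points `κ₁`, `κ₂`, `κ₃` and `(3 κ₁ + 4 κ₂) / 5` of the sphere give enough linear equations. -/
theorem starMat_eq_kappaMat (h₁ : ∀ i j k, t i j k = -t j i k) (h₂ : ∀ i j k, t i j k = -t i k j)
    (h : ∀ y : Fin 3 → ℝ, y 0 ^ 2 + y 1 ^ 2 + y 2 ^ 2 = 1 →
      jMat y * contractXi t y = contractXi t y * jMat y) :
    starMat t = kappaMat ![t 0 1 2, t 0 1 4, -t 0 1 3] := by
  have hr : √3 ^ 2 = 3 := Real.sq_sqrt (by norm_num)
  have A (y : Fin 3 → ℝ) (hy) (i j : Fin 5) := congr($(h y hy) i j)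
  simp only [contractXi_eq h₁ h₂, mul_apply] at A
  have A1 := A ![1, 0, 0] (by simp)
  have A2 := A ![0, 1, 0] (by simp)
  have A3 := A ![0, 0, 1] (by simp)
  have A4 := A ![3 / 5, 4 / 5, 0] (by simp; norm_num)
  rw [jMat_eq_selfDual (by simp)] at A1 A2 A3
  rw [jMat_eq_selfDual (by simp; norm_num)] at A4
  have a1 := A1 1 3
  have a2 := A1 2 3
  have b1 := A2 1 3
  have b2 := A2 3 4
  have c1 := A3 1 2
  have c2 := A3 1 4
  have d := A4 0 2
  rw [starMat_eq h₁ h₂]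
  clear A A1 A2 A3 A4 h h₁ h₂
  generalize hs : √3 = r at *
  simp [xiVec, kappaMat, kappaContract, Fin.sum_univ_five, hs] at a1 a2 b1 b2 c1 c2
  simp [xiVec, kappaMat, kappaContract, Fin.sum_univ_five, hs] at d
  have e1 : t 0 2 3 = t 0 1 4 := by linarith
  have e2 : t 0 3 4 = t 0 1 2 := by linarith
  have e3 : t 1 3 4 = -r * t 0 1 4 := by grind
  have e4 : t 1 2 3 = -r * t 0 1 2 := by grind
  have e5 : t 2 3 4 = 0 := by grind
  have e6 : t 0 2 4 = 2 * t 0 1 3 := by grind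
  have e7 : t 1 2 4 = 0 := by grind
  ext i j
  fin_cases i <;> fin_cases j <;> simp [kappaMat, e1, e2, e3, e4, e5, e6, e7, hs]

end ThreeForms
end SO3Linear

/-! ### The Levi form in coordinates -/

namespace SO3Linear

open Matrix

/-- The Levi form of `𝒟` in coordinates: its `ξ_σ`-component on the vectors `V + X^h` and `W + Y^h`
with vertical parts `V = ∑ᵢ vᵢ κᵢ`, `W = ∑ᵢ wᵢ κᵢ` and with projections `X`, `Y` of coordinates
`a`, `b`; here `t` are the components of the torsion. -/
def leviCoord (t : Fin 5 → Fin 5 → Fin 5 → ℝ) (y v w : Fin 3 → ℝ) (a b : Fin 5 → ℝ) : ℝ :=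
  -(dxiVec y v ⬝ᵥ b) + dxiVec y w ⬝ᵥ a - a ⬝ᵥ contractXi t y *ᵥ b

variable {t : Fin 5 → Fin 5 → Fin 5 → ℝ}

theorem dxiVec_zero (y : Fin 3 → ℝ) : dxiVec y 0 = 0 := by
  ext i
  fin_cases i <;> simp [dxiVec]

/-- The vertical terms of the Levi form are always `J`-invariant, since `J₊^σ` intertwines them; so
only the torsion term matters. -/
theorem leviCoord_invariant_iff (h₁ : ∀ i j k, t i j k = -t j i k)
    (h₂ : ∀ i j k, t i j k = -t i k j) :
    (∀ y v w : Fin 3 → ℝ, ∀ a b : Fin 5 → ℝ, y 0 ^ 2 + y 1 ^ 2 + y 2 ^ 2 = 1 →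
      y 0 * v 0 + y 1 * v 1 + y 2 * v 2 = 0 → y 0 * w 0 + y 1 * w 1 + y 2 * w 2 = 0 →
      a ⬝ᵥ xiVec y = 0 → b ⬝ᵥ xiVec y = 0 →
      leviCoord t y (-crossProduct y v) (-crossProduct y w) (jMat y *ᵥ a) (jMat y *ᵥ b)
        = leviCoord t y v w a b) ↔ ∃ z, starMat t = kappaMat z := by
  constructor
  · intro h
    refine ⟨_, starMat_eq_kappaMat h₁ h₂ fun y hy ↦ jMat_mul_contractXi_comm hy h₂ ?_⟩
    have hξ := contractXi_mulVec_xiVec h₂ y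
    have hξ' (a : Fin 5 → ℝ) : xiVec y ⬝ᵥ contractXi t y *ᵥ a = 0 := by
      rw [dotProduct_mulVec, ← mulVec_transpose, contractXi_transpose h₁, neg_mulVec, hξ]
      simp
    -- both sides vanish on `ξ`, so it suffices to compare them on `ξ^⊥`
    have key (a b : Fin 5 → ℝ) :
        (jMat y *ᵥ a) ⬝ᵥ contractXi t y *ᵥ (jMat y *ᵥ b) = a ⬝ᵥ contractXi t y *ᵥ b := by
      have hp (a : Fin 5 → ℝ) : (a - (a ⬝ᵥ xiVec y) • xiVec y) ⬝ᵥ xiVec y = 0 := by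
        rw [sub_dotProduct, smul_dotProduct, xiVec_dotProduct_self hy]
        simp
      have h0 := h y 0 0 _ _ hy (by simp) (by simp) (hp a) (hp b)
      simpa [leviCoord, dxiVec_zero, mulVec_sub, mulVec_smul, jMat_mulVec_xiVec, hξ, hξ'] using h0
    ext i j
    have h0 := key (Pi.single i 1) (Pi.single j 1)
    rw [← vecMul_transpose, ← dotProduct_mulVec, mulVec_mulVec, mulVec_mulVec] at h0
    simpa [mul_assoc] using h0
  · rintro ⟨z, hz⟩ y v w a b hy hv hw - -
    have hJJ (u : Fin 3 → ℝ) (hu : y 0 * u 0 + y 1 * u 1 + y 2 * u 2 = 0) (c : Fin 5 → ℝ) :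
        dxiVec y (-crossProduct y u) ⬝ᵥ jMat y *ᵥ c = dxiVec y u ⬝ᵥ c := by
      rw [← jMat_mulVec_dxiVec hy hu, dotProduct_mulVec, ← mulVec_transpose, mulVec_mulVec,
        jMat_transpose, neg_mul, jMat_sq hy, neg_sub, sub_mulVec, vecMulVec_mulVec,
        dotProduct_comm (xiVec y), dxiVec_dotProduct_xiVec hu]
      simp
    have hK : (jMat y *ᵥ a) ⬝ᵥ contractXi t y *ᵥ (jMat y *ᵥ b) = a ⬝ᵥ contractXi t y *ᵥ b := by
      conv_rhs => rw [← jMat_transpose_mul_contractXi_mul_jMat h₁ h₂ hz hy]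
      rw [← vecMul_transpose, ← dotProduct_mulVec, mulVec_mulVec, mulVec_mulVec, mul_assoc]
    rw [leviCoord, leviCoord, hJJ v hv, hJJ w hw, hK]

variable {V : Type*} [NormedAddCommGroup V] [InnerProductSpace ℝ V]
  (e : OrthonormalBasis (Fin 5) ℝ V)

theorem isLinearMap_hodgeStarThree_left (β : V → V → V → ℝ) (y : V) :
    IsLinearMap ℝ fun x ↦ hodgeStarThree e β x y := by
  have h₃ := isLinearMap_slot₃ e.toBasis.det
  unfold hodgeStarThree
  exact ⟨fun _ _ ↦ by simp_rw [(h₃ ..).map_add, mul_add, Finset.sum_add_distrib, mul_add],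
    fun _ _ ↦ by simp_rw [(h₃ ..).map_smul, mul_smul_comm, ← Finset.smul_sum, mul_smul_comm]⟩

theorem isLinearMap_hodgeStarThree_right (β : V → V → V → ℝ) (x : V) :
    IsLinearMap ℝ fun y ↦ hodgeStarThree e β x y := by
  have h₄ := isLinearMap_slot₄ e.toBasis.det
  unfold hodgeStarThree
  exact ⟨fun _ _ ↦ by simp_rw [(h₄ ..).map_add, mul_add, Finset.sum_add_distrib, mul_add],
    fun _ _ ↦ by simp_rw [(h₄ ..).map_smul, mul_smul_comm, ← Finset.smul_sum, mul_smul_comm]⟩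

/-- The condition that `∗β` is in `Λ²₃`, in the components of `β`. -/
theorem exists_hodgeStarThree_iff {Υ : V →ₗ[ℝ] V →ₗ[ℝ] V →ₗ[ℝ] ℝ}
    (hΥ : ∀ i j k, Υ (e i) (e j) (e k) = upsilonCoeff i j k) (β : V → V → V → ℝ) :
    (∃ W ∈ lambda23 e Υ, ∀ x y, ⟪W x, y⟫ = hodgeStarThree e β x y) ↔
      ∃ z, starMat (fun i j k ↦ β (e i) (e j) (e k)) = kappaMat z := by
  have hs (i j : Fin 5) : hodgeStarThree e β (e j) (e i)
      = starMat (fun i j k ↦ β (e i) (e j) (e k)) i j := by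
    simp only [hodgeStarThree, det_basis_eq_leviCivita, starMat, of_apply]
  constructor
  · rintro ⟨W, hW, h⟩
    obtain ⟨z, rfl⟩ := (mem_lambda23_iff e hΥ W).1 hW
    refine ⟨z, ?_⟩
    ext i j
    rw [← hs, ← h, inner_kappaSum]
  · rintro ⟨z, hz⟩
    refine ⟨kappaSum e z, (mem_lambda23_iff e hΥ _).2 ⟨z, rfl⟩, fun x y ↦ ?_⟩
    let B₁ : V →ₗ[ℝ] V →ₗ[ℝ] ℝ := LinearMap.mk₂ ℝ (fun x y ↦ ⟪kappaSum e z x, y⟫)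
      (by simp [inner_add_left]) (by simp [inner_smul_left]) (by simp [inner_add_right])
      (by simp [inner_smul_right])
    let B₂ : V →ₗ[ℝ] V →ₗ[ℝ] ℝ := LinearMap.mk₂ ℝ (hodgeStarThree e β)
      (fun x x' y ↦ (isLinearMap_hodgeStarThree_left e β y).map_add x x')
      (fun c x y ↦ (isLinearMap_hodgeStarThree_left e β y).map_smul c x)
      (fun x y y' ↦ (isLinearMap_hodgeStarThree_right e β x).map_add y y')
      (fun c x y ↦ (isLinearMap_hodgeStarThree_right e β x).map_smul c y)
    have h : B₁ = B₂ := e.toBasis.ext fun j ↦ e.toBasis.ext fun i ↦ by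
      simp only [OrthonormalBasis.coe_toBasis, B₁, B₂, LinearMap.mk₂_apply]
      rw [hs, hz, inner_kappaSum]
    exact congr($h x y)

end SO3Linear

/-! ### Adapted frames -/

namespace IrreducibleSO3Structure

variable {M : Type*} [TopologicalSpace M] [ChartedSpace R5 M] [IsManifold 𝓘(ℝ, R5) ∞ M]
  [RiemannianBundle (fun p : M ↦ TM M p)] (S : IrreducibleSO3Structure M)

theorem isAdapted_adaptedBasis (p : M) : S.IsAdapted (S.adaptedBasis p) :=
  (S.exists_isAdapted p).choose_spec

theorem IsAdapted.upsilon_apply {S : IrreducibleSO3Structure M} {p : M}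
    {a : OrthonormalBasis (Fin 5) ℝ (TM M p)} (ha : S.IsAdapted a) (i j k : Fin 5) :
    S.upsilon p (a i) (a j) (a k) = SO3Linear.upsilonCoeff i j k :=
  SO3Linear.upsilon_basis a (S.upsilon_symm p) ha.2 i j k

/-- Near any point there is a smooth adapted frame which extends a given adapted basis: it is
obtained from any other smooth adapted frame by a constant rotation. -/
theorem exists_frame_extending {p : M} {b : OrthonormalBasis (Fin 5) ℝ (TM M p)}
    (hb : S.IsAdapted b) :
    ∃ U : Set M, IsOpen U ∧ p ∈ U ∧ ∃ E : Fin 5 → Π q : M, TM M q,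
      (∀ i, ContMDiffOn 𝓘(ℝ, R5) 𝓘(ℝ, R5).tangent ∞
        (fun q ↦ (⟨q, E i q⟩ : TangentBundle 𝓘(ℝ, R5) M)) U) ∧ (∀ i, E i p = b i) ∧
      ∀ q ∈ U, ∃ a : OrthonormalBasis (Fin 5) ℝ (TM M q), (∀ i, a i = E i q) ∧
        S.IsAdapted a := by
  obtain ⟨U', hU', E, hE, hEa⟩ := S.exists_frame p
  obtain ⟨U, hUU', hU, hpU⟩ := mem_nhds_iff.1 hU'
  obtain ⟨a₀, ha₀E, ha₀⟩ := hEa p (hUU' hpU)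
  refine ⟨U, hU, hpU, fun i q ↦ ∑ j, ⟪a₀ j, b i⟫ • E j q, fun i ↦ ?_, fun i ↦ ?_, fun q hq ↦ ?_⟩
  · exact ContMDiffOn.sum_section fun j _ ↦ ((hE j).mono hUU').const_smul_section
  · simp only [← ha₀E]
    exact a₀.sum_repr' (b i)
  obtain ⟨a, haE, ha⟩ := hEa q (hUU' hq)
  -- the isometry which maps the first frame at `p` to the first frame at `q`
  let L : TM M p ≃ₗᵢ[ℝ] TM M q := a₀.repr.trans a.repr.symm
  have hL (x : TM M p) : L x = ∑ j, ⟪a₀ j, x⟫ • a j := by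
    rw [← a.sum_repr (L x)]
    simp [L, OrthonormalBasis.repr_apply_apply]
  have hLa : a = a₀.map L := by
    refine DFunLike.ext _ _ fun i ↦ ?_
    simp [L]
  refine ⟨b.map L, fun i ↦ by simp [hL, haE], ?_, fun x ↦ ?_⟩
  · have hor (c : OrthonormalBasis (Fin 5) ℝ (TM M p)) : (c.map L).toBasis.orientation
        = Orientation.map (Fin 5) L.toLinearEquiv c.toBasis.orientation := by
      rw [← Basis.orientation_map]
      congr 1
    rw [← ha.1, hLa, hor, hor, hb.1, ha₀.1]
  · have h1 : ∑ i, x i • (b.map L) i = L (∑ i, x i • b i) := by simp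
    have h2 (w : TM M p) : S.upsilon q (L w) (L w) (L w) = S.upsilon p w w w := by
      rw [hL, ha.2]
      conv_rhs => rw [← a₀.sum_repr' w]
      rw [ha₀.2]
    rw [h1, h2, hb.2]

end IrreducibleSO3Structure

/-! ### The chart of `End(TM)` given by an adapted frame -/

/-- The space of `5 × 5`-matrices, as a normed space. -/
abbrev Mat5 : Type := Fin 5 → Fin 5 → ℝ

/-- Smoothness of a family of linear maps on `ℝ⁵` can be checked on vectors. -/
theorem contMDiffAt_clm_of_apply {E H N F : Type*} [NormedAddCommGroup E] [NormedSpace ℝ E]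
    [TopologicalSpace H] {I : ModelWithCorners ℝ E H} [TopologicalSpace N] [ChartedSpace H N]
    [NormedAddCommGroup F] [NormedSpace ℝ F] {f : N → R5 →L[ℝ] F} {x : N} {n : ℕ∞ω}
    (h : ∀ w, ContMDiffAt I 𝓘(ℝ, F) n (fun y ↦ f y w) x) :
    ContMDiffAt I 𝓘(ℝ, R5 →L[ℝ] F) n f x := by
  have hf : f = fun y ↦ ∑ k, ContinuousLinearMap.smulRightL ℝ R5 F (EuclideanSpace.proj k)
      (f y (EuclideanSpace.single k 1)) := by
    ext y w
    conv_lhs => rw [← (EuclideanSpace.basisFun (Fin 5) ℝ).sum_repr w, map_sum]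
    simp
  rw [hf]
  exact ContMDiffAt.sum fun k _ ↦ (ContinuousLinearMap.contMDiff _).contMDiffAt.comp x (h _)

namespace IrreducibleSO3Structure

variable {M : Type*} [TopologicalSpace M] [ChartedSpace R5 M] [IsManifold 𝓘(ℝ, R5) ∞ M]
  [RiemannianBundle (fun p : M ↦ TM M p)]

/-- A smooth adapted frame on an open neighbourhood of `p`, contained in the domain of the chart
at `p`. -/
structure AdaptedFrame (S : IrreducibleSO3Structure M) (p : M) where
  domain : Set M
  isOpen : IsOpen domain
  mem : p ∈ domain
  subset : domain ⊆ (chartAt R5 p).source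
  E : Fin 5 → Π q : M, TM M q
  smooth (i : Fin 5) : ContMDiffOn 𝓘(ℝ, R5) 𝓘(ℝ, R5).tangent ∞
    (fun q ↦ (⟨q, E i q⟩ : TangentBundle 𝓘(ℝ, R5) M)) domain
  exists_basis (q : M) (hq : q ∈ domain) :
    ∃ a : OrthonormalBasis (Fin 5) ℝ (TM M q), (∀ i, a i = E i q) ∧ S.IsAdapted a

theorem exists_adaptedFrame (S : IrreducibleSO3Structure M) (p : M) :
    ∃ fr : S.AdaptedFrame p, ∀ i, fr.E i p = S.adaptedBasis p i := by
  obtain ⟨U, hU, hpU, E, hE, hEp, hEa⟩ := S.exists_frame_extending (S.isAdapted_adaptedBasis p)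
  exact ⟨⟨U ∩ (chartAt R5 p).source, hU.inter (chartAt R5 p).open_source,
    ⟨hpU, mem_chart_source R5 p⟩, Set.inter_subset_right, E,
    fun i ↦ (hE i).mono Set.inter_subset_left, fun q hq ↦ hEa q hq.1⟩, hEp⟩

namespace AdaptedFrame

variable {S : IrreducibleSO3Structure M} {p : M} (fr : S.AdaptedFrame p)

/-- The adapted basis of `T_q M` given by the frame. -/
def basis {q : M} (hq : q ∈ fr.domain) : OrthonormalBasis (Fin 5) ℝ (TM M q) :=
  (fr.exists_basis q hq).choose

theorem basis_apply {q : M} (hq : q ∈ fr.domain) (i : Fin 5) : fr.basis hq i = fr.E i q :=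
  (fr.exists_basis q hq).choose_spec.1 i

theorem isAdapted {q : M} (hq : q ∈ fr.domain) : S.IsAdapted (fr.basis hq) :=
  (fr.exists_basis q hq).choose_spec.2

theorem contMDiffAt {q : M} (hq : q ∈ fr.domain) (i : Fin 5) :
    ContMDiffAt 𝓘(ℝ, R5) 𝓘(ℝ, R5).tangent ∞
      (fun q ↦ (⟨q, fr.E i q⟩ : TangentBundle 𝓘(ℝ, R5) M)) q :=
  (fr.smooth i).contMDiffAt (fr.isOpen.mem_nhds hq)

theorem mdifferentiableAt {q : M} (hq : q ∈ fr.domain) (i : Fin 5) :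
    MDifferentiableAt 𝓘(ℝ, R5) 𝓘(ℝ, R5).tangent
      (fun q ↦ (⟨q, fr.E i q⟩ : TangentBundle 𝓘(ℝ, R5) M)) q :=
  (fr.contMDiffAt hq i).mdifferentiableAt (by simp)

/-- The matrix of an endomorphism of a tangent space in the frame. -/
def entry (s : EndTM M) : Mat5 := fun i j ↦ ⟪s.2 (fr.E j s.1), fr.E i s.1⟫

/-- The endomorphism `E_j ↦ E_i` of rank one. -/
def elementary (i j : Fin 5) (q : M) : TM M q →L[ℝ] TM M q :=
  (innerSL ℝ (fr.E j q)).smulRight (fr.E i q)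

/-- The endomorphism of `T_q M` with a given matrix in the frame. -/
def ofEntry (q : M) (B : Mat5) : TM M q →L[ℝ] TM M q := ∑ i, ∑ j, B i j • fr.elementary i j q

theorem entry_ofEntry {q : M} (hq : q ∈ fr.domain) (B : Mat5) :
    fr.entry ⟨q, fr.ofEntry q B⟩ = B := by
  ext i j
  have h (i j : Fin 5) : ⟪fr.E i q, fr.E j q⟫ = if i = j then 1 else 0 := by
    rw [← fr.basis_apply hq, ← fr.basis_apply hq, (fr.basis hq).inner_eq_ite]
  simp [entry, ofEntry, elementary, sum_inner, inner_smul_left, h]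

theorem ofEntry_entry {q : M} (hq : q ∈ fr.domain) (A : TM M q →L[ℝ] TM M q) :
    fr.ofEntry q (fr.entry ⟨q, A⟩) = A :=
  SO3Linear.ext_inner_basis (fr.basis hq) fun i j ↦ by
    have h := congr($(fr.entry_ofEntry hq (fr.entry ⟨q, A⟩)) i j)
    simpa only [entry, fr.basis_apply] using h

/-- The chart of `End(TM)` which is given by the chart of `M` at `p` and by the matrices in the
frame. -/
def toModel (s : EndTM M) : R5 × Mat5 := (extChartAt 𝓘(ℝ, R5) p s.1, fr.entry s)

/-- The inverse of the chart `toModel`. -/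
def ofModel (z : R5 × Mat5) : EndTM M :=
  ⟨(extChartAt 𝓘(ℝ, R5) p).symm z.1, fr.ofEntry _ z.2⟩

/-- The image of the chart `toModel`. -/
def modelDomain : Set (R5 × Mat5) :=
  {z | z.1 ∈ (extChartAt 𝓘(ℝ, R5) p).target ∧ (extChartAt 𝓘(ℝ, R5) p).symm z.1 ∈ fr.domain}

theorem isOpen_modelDomain : IsOpen fr.modelDomain :=
  ((continuousOn_extChartAt_symm p).isOpen_inter_preimage (isOpen_extChartAt_target p)
    fr.isOpen).preimage continuous_fst

theorem isOpen_preimage_domain : IsOpen {s : EndTM M | s.1 ∈ fr.domain} :=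
  fr.isOpen.preimage (FiberBundle.continuous_proj (R5 →L[ℝ] R5) (fun p : M ↦ TM M p →L[ℝ] TM M p))

theorem mem_source {q : M} (hq : q ∈ fr.domain) : q ∈ (extChartAt 𝓘(ℝ, R5) p).source := by
  rw [extChartAt_source]
  exact fr.subset hq

theorem toModel_mem {s : EndTM M} (hs : s.1 ∈ fr.domain) : fr.toModel s ∈ fr.modelDomain :=
  ⟨(extChartAt 𝓘(ℝ, R5) p).map_source (fr.mem_source hs),
    by rwa [toModel, (extChartAt 𝓘(ℝ, R5) p).left_inv (fr.mem_source hs)]⟩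

theorem ofModel_toModel {s : EndTM M} (hs : s.1 ∈ fr.domain) : fr.ofModel (fr.toModel s) = s := by
  obtain ⟨q, A⟩ := s
  have h := (extChartAt 𝓘(ℝ, R5) p).left_inv (fr.mem_source hs)
  have key (r : M) (hr : r = q) (B : Mat5) :
      (⟨r, fr.ofEntry r B⟩ : EndTM M) = ⟨q, fr.ofEntry q B⟩ := by
    subst hr
    rfl
  rw [ofModel, toModel, key _ h, fr.ofEntry_entry hs]

theorem toModel_ofModel {z : R5 × Mat5} (hz : z ∈ fr.modelDomain) :
    fr.toModel (fr.ofModel z) = z :=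
  Prod.ext ((extChartAt 𝓘(ℝ, R5) p).right_inv hz.1) (fr.entry_ofEntry hz.2 z.2)

theorem toModel_comp_ofModel {z : R5 × Mat5} (hz : z ∈ fr.modelDomain) :
    fr.toModel ∘ fr.ofModel =ᶠ[𝓝 z] id := by
  filter_upwards [fr.isOpen_modelDomain.mem_nhds hz] with r hr using fr.toModel_ofModel hr

theorem ofModel_comp_toModel {s : EndTM M} (hs : s.1 ∈ fr.domain) :
    fr.ofModel ∘ fr.toModel =ᶠ[𝓝 s] id := by
  filter_upwards [fr.isOpen_preimage_domain.mem_nhds hs] with r hr using fr.ofModel_toModel hr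

variable [IsContMDiffRiemannianBundle 𝓘(ℝ, R5) ∞ R5 (fun p : M ↦ TM M p)]

theorem contMDiffAt_entry {s : EndTM M} (hs : s.1 ∈ fr.domain) :
    ContMDiffAt endModel 𝓘(ℝ, Mat5) ∞ fr.entry s := by
  have hπ : ContMDiffAt endModel 𝓘(ℝ, R5) ∞ (fun s : EndTM M ↦ s.1) s :=
    contMDiff_proj (fun p : M ↦ TM M p →L[ℝ] TM M p) s
  have hE (i : Fin 5) : ContMDiffAt endModel 𝓘(ℝ, R5).tangent ∞
      (fun s : EndTM M ↦ (⟨s.1, fr.E i s.1⟩ : TangentBundle 𝓘(ℝ, R5) M)) s :=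
    (fr.contMDiffAt hs i).comp s hπ
  have hid : ContMDiffAt endModel endModel ∞ (fun s : EndTM M ↦ (⟨s.1, s.2⟩ : EndTM M)) s :=
    contMDiffAt_id
  refine contMDiffAt_pi_space.2 fun i ↦ contMDiffAt_pi_space.2 fun j ↦ ?_
  exact ContMDiffAt.inner_bundle (hid.clm_bundle_apply (hE j)) (hE i)

theorem contMDiffAt_elementary {q : M} (hq : q ∈ fr.domain) (i j : Fin 5) :
    ContMDiffAt 𝓘(ℝ, R5) endModel ∞ (fun q ↦ (⟨q, fr.elementary i j q⟩ : EndTM M)) q := by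
  rw [contMDiffAt_hom_bundle]
  refine ⟨contMDiffAt_id, contMDiffAt_clm_of_apply fun w ↦ ?_⟩
  have h1 : ContMDiffAt 𝓘(ℝ, R5) 𝓘(ℝ, R5) ∞
      (fun r ↦ (trivializationAt R5 (TangentSpace 𝓘(ℝ, R5)) q ⟨r, fr.E i r⟩).2) q :=
    (contMDiffAt_totalSpace.1 (fr.contMDiffAt hq i)).2
  have h2 : ContMDiffAt 𝓘(ℝ, R5) 𝓘(ℝ, R5).tangent ∞ (fun r ↦
      (⟨r, (trivializationAt R5 (TangentSpace 𝓘(ℝ, R5)) q).symmL ℝ r w⟩ :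
        TangentBundle 𝓘(ℝ, R5) M)) q := by
    exact ((trivializationAt R5 (TangentSpace 𝓘(ℝ, R5)) q).contMDiffAt_symmL
      (mem_baseSet_trivializationAt R5 _ q)).clm_bundle_apply (E₁ := Bundle.Trivial M R5) (v := fun _ ↦ w)
      ((Bundle.contMDiffAt_section _).2 contMDiffAt_const)
  have h3 : ContMDiffAt 𝓘(ℝ, R5) 𝓘(ℝ, ℝ) ∞ (fun r ↦
      ⟪fr.E j r, (trivializationAt R5 (TangentSpace 𝓘(ℝ, R5)) q).symmL ℝ r w⟫) q :=
    ContMDiffAt.inner_bundle (fr.contMDiffAt hq j) h2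
  refine (h3.smul h1).congr_of_eventuallyEq ?_
  filter_upwards [(trivializationAt R5 (TangentSpace 𝓘(ℝ, R5)) q).open_baseSet.mem_nhds
    (mem_baseSet_trivializationAt R5 _ q)] with r hr
  simp only [ContinuousLinearMap.inCoordinates, elementary, ContinuousLinearMap.comp_apply,
    ContinuousLinearMap.smulRight_apply, innerSL_apply_apply, map_smul,
    Trivialization.continuousLinearMapAt_apply]
  rw [Trivialization.coe_linearMapAt_of_mem _ hr]
  rfl

theorem contMDiffAt_ofEntry {q : M} (hq : q ∈ fr.domain) (B : Mat5) :
    ContMDiffAt (𝓘(ℝ, R5).prod 𝓘(ℝ, Mat5)) endModel ∞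
      (fun x : M × Mat5 ↦ (⟨x.1, fr.ofEntry x.1 x.2⟩ : EndTM M)) (q, B) := by
  rw [contMDiffAt_hom_bundle]
  refine ⟨contMDiffAt_fst, ?_⟩
  have h (i j : Fin 5) := ((contMDiffAt_hom_bundle _).1 (fr.contMDiffAt_elementary hq i j)).2
  have h' (i j : Fin 5) : ContMDiffAt (𝓘(ℝ, R5).prod 𝓘(ℝ, Mat5)) 𝓘(ℝ, ℝ) ∞
      (fun x : M × Mat5 ↦ x.2 i j) (q, B) :=
    ((ContinuousLinearMap.proj j : (Fin 5 → ℝ) →L[ℝ] ℝ).comp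
      (ContinuousLinearMap.proj i : Mat5 →L[ℝ] (Fin 5 → ℝ))).contMDiff.contMDiffAt.comp (q, B)
      contMDiffAt_snd
  refine (ContMDiffAt.sum (t := Finset.univ) fun i _ ↦ ContMDiffAt.sum (t := Finset.univ) fun j _ ↦
    (h' i j).smul ((h i j).comp (q, B) contMDiffAt_fst)).congr_of_eventuallyEq
    (.of_forall fun x ↦ ?_)
  ext1 w
  simp [ContinuousLinearMap.inCoordinates, ofEntry, map_sum]

theorem contMDiffAt_toModel {s : EndTM M} (hs : s.1 ∈ fr.domain) :
    ContMDiffAt endModel 𝓘(ℝ, R5 × Mat5) ∞ fr.toModel s := by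
  have hπ : ContMDiffAt endModel 𝓘(ℝ, R5) ∞ (fun s : EndTM M ↦ s.1) s :=
    contMDiff_proj (fun p : M ↦ TM M p →L[ℝ] TM M p) s
  exact ((contMDiffAt_extChartAt' (fr.subset hs)).comp s hπ).prodMk_space (fr.contMDiffAt_entry hs)

theorem contMDiffAt_ofModel {z : R5 × Mat5} (hz : z ∈ fr.modelDomain) :
    ContMDiffAt 𝓘(ℝ, R5 × Mat5) endModel ∞ fr.ofModel z := by
  have h1 : ContMDiffAt 𝓘(ℝ, R5 × Mat5) 𝓘(ℝ, R5) ∞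
      (fun z : R5 × Mat5 ↦ (extChartAt 𝓘(ℝ, R5) p).symm z.1) z :=
    ((contMDiffOn_extChartAt_symm p).contMDiffAt
      ((isOpen_extChartAt_target p).mem_nhds hz.1)).comp z contDiff_fst.contMDiff.contMDiffAt
  exact (fr.contMDiffAt_ofEntry hz.2 z.2).comp z (h1.prodMk contDiff_snd.contMDiff.contMDiffAt)

end AdaptedFrame
end IrreducibleSO3Structure

/-! ### Differentials of maps between manifolds and vector spaces -/

theorem ContinuousLinearMap.isInvertible_of_comp {E F : Type*} [AddCommGroup E] [Module ℝ E]
    [TopologicalSpace E] [AddCommGroup F] [Module ℝ F] [TopologicalSpace F] {f : E →L[ℝ] F}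
    {g : F →L[ℝ] E}
    (h₁ : ∀ x, g (f x) = x) (h₂ : ∀ y, f (g y) = y) : f.IsInvertible :=
  ⟨ContinuousLinearEquiv.equivOfInverse f g h₁ h₂, rfl⟩

section ProductSpace

variable {E H N F F' : Type*} [NormedAddCommGroup E] [NormedSpace ℝ E]
  [TopologicalSpace H] {I : ModelWithCorners ℝ E H} [TopologicalSpace N] [ChartedSpace H N]
  [NormedAddCommGroup F] [NormedSpace ℝ F] [NormedAddCommGroup F'] [NormedSpace ℝ F']

theorem mfderiv_clm_comp_apply (L : F →L[ℝ] F') {f : N → F} {x : N}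
    (hf : MDifferentiableAt I 𝓘(ℝ, F) f x) (A : TangentSpace I x) :
    mfderiv I 𝓘(ℝ, F') (fun y ↦ L (f y)) x A = L (mfderiv I 𝓘(ℝ, F) f x A) := by
  have h := (L.hasMFDerivAt (x := f x)).comp x hf.hasMFDerivAt
  exact congr($(h.mfderiv) A)

theorem mfderiv_prod_apply {f : N → F × F'} {x : N} (hf : MDifferentiableAt I 𝓘(ℝ, F × F') f x)
    (A : TangentSpace I x) :
    mfderiv I 𝓘(ℝ, F × F') f x A = ((mfderiv I 𝓘(ℝ, F) (fun y ↦ (f y).1) x A,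
      mfderiv I 𝓘(ℝ, F') (fun y ↦ (f y).2) x A) : F × F') :=
  Prod.ext (mfderiv_clm_comp_apply (ContinuousLinearMap.fst ℝ F F') hf A).symm
    (mfderiv_clm_comp_apply (ContinuousLinearMap.snd ℝ F F') hf A).symm

/-- The derivative of a function `f` which is the linear map `L` on a vector space embedded by `j`. -/
theorem mfderiv_apply_mfderiv_of_comp_eq {W : Type*} [NormedAddCommGroup W] [NormedSpace ℝ W]
    {j : W → N} {f : N → F} {w : W} (L : W →L[ℝ] F) (hL : ∀ V, f (j V) = L V)
    (hj : MDifferentiableAt 𝓘(ℝ, W) I j w) (hf : MDifferentiableAt I 𝓘(ℝ, F) f (j w)) (V : W) :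
    mfderiv I 𝓘(ℝ, F) f (j w) (mfderiv 𝓘(ℝ, W) I j w V) = L V := by
  have h := hf.hasMFDerivAt.comp w hj.hasMFDerivAt
  have h' : f ∘ j = L := funext hL
  rw [h'] at h
  exact congr($(hasMFDerivAt_unique h L.hasMFDerivAt) V)

theorem contMDiffAt_totalSpaceMk {B : Type*} [TopologicalSpace B] [ChartedSpace H B]
    (E' : B → Type*) [∀ b, AddCommGroup (E' b)] [∀ b, Module ℝ (E' b)]
    [TopologicalSpace (TotalSpace F E')] [∀ b, TopologicalSpace (E' b)] [FiberBundle F E']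
    [VectorBundle ℝ F E'] {W : Type*} [NormedAddCommGroup W] [NormedSpace ℝ W] {b : B}
    (L : W →L[ℝ] E' b) (w : W) :
    ContMDiffAt 𝓘(ℝ, W) (I.prod 𝓘(ℝ, F)) ∞ (fun V ↦ (⟨b, L V⟩ : TotalSpace F E')) w := by
  refine contMDiffAt_totalSpace.2 ⟨contMDiffAt_const, ?_⟩
  have h : (fun V ↦ (trivializationAt F E' b (⟨b, L V⟩ : TotalSpace F E')).2)
      = (((trivializationAt F E' b).continuousLinearMapAt ℝ b).comp L : W →L[ℝ] F) := by
    ext1 V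
    rw [ContinuousLinearMap.comp_apply, Trivialization.continuousLinearMapAt_apply,
      Trivialization.coe_linearMapAt_of_mem]
    exact mem_baseSet_trivializationAt ..
  rw [h]
  exact ContinuousLinearMap.contMDiffAt _

end ProductSpace

/-! ### Differentials of locally inverse maps -/

section LocalInverse

variable {E H N E' H' N' : Type*} [NormedAddCommGroup E] [NormedSpace ℝ E]
  [TopologicalSpace H] {I : ModelWithCorners ℝ E H} [TopologicalSpace N] [ChartedSpace H N]
  [NormedAddCommGroup E'] [NormedSpace ℝ E'] [TopologicalSpace H'] {I' : ModelWithCorners ℝ E' H'}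
  [TopologicalSpace N'] [ChartedSpace H' N'] {f : N → N'} {g : N' → N} {y : N'}

theorem mfderiv_mfderiv_of_leftInverse (hf : MDifferentiableAt I I' f (g y))
    (hg : MDifferentiableAt I' I g y) (h : f ∘ g =ᶠ[𝓝 y] id) (w : TangentSpace I' y) :
    mfderiv I I' f (g y) (mfderiv I' I g y w) = w :=
  congr($(hasMFDerivAt_unique (hf.hasMFDerivAt.comp y hg.hasMFDerivAt)
    ((hasMFDerivAt_id (I := I') y).congr_of_eventuallyEq h)) w)

theorem mfderiv_mfderiv_of_rightInverse (hf : MDifferentiableAt I I' f (g y))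
    (hg : MDifferentiableAt I' I g y) (h : g ∘ f =ᶠ[𝓝 (g y)] id) (hy : f (g y) = y)
    (X : TangentSpace I (g y)) :
    mfderiv I' I g y (mfderiv I I' f (g y) X) = X := by
  have hc : HasMFDerivAt I I (g ∘ f) (g y) ((mfderiv I' I g y).comp (mfderiv I I' f (g y))) :=
    HasMFDerivAt.comp (g y) (by rw [hy]; exact hg.hasMFDerivAt) hf.hasMFDerivAt
  exact congr($(hasMFDerivAt_unique hc ((hasMFDerivAt_id (I := I) (g y)).congr_of_eventuallyEq h)) X)

theorem isInvertible_mfderiv_of_inverse (hf : MDifferentiableAt I I' f (g y))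
    (hg : MDifferentiableAt I' I g y) (h : f ∘ g =ᶠ[𝓝 y] id) (h' : g ∘ f =ᶠ[𝓝 (g y)] id) :
    (mfderiv I' I g y).IsInvertible :=
  ContinuousLinearMap.isInvertible_of_comp (g := mfderiv I I' f (g y))
    (mfderiv_mfderiv_of_leftInverse hf hg h)
    (mfderiv_mfderiv_of_rightInverse hf hg h' h.self_of_nhds)

theorem mpullback_apply_of_inverse (hf : MDifferentiableAt I I' f (g y))
    (hg : MDifferentiableAt I' I g y) (h : f ∘ g =ᶠ[𝓝 y] id) (h' : g ∘ f =ᶠ[𝓝 (g y)] id)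
    (V : Π x : N, TangentSpace I x) :
    VectorField.mpullback I' I g V y = mfderiv I I' f (g y) (V (g y)) := by
  rw [VectorField.mpullback_apply]
  have := isInvertible_mfderiv_of_inverse hf hg h h'
  refine this.injective ?_
  rw [mfderiv_mfderiv_of_rightInverse hf hg h' h.self_of_nhds]
  exact this.self_apply_inverse _
end LocalInverse

/-! ### Tangent vectors of `End(TM)` in an adapted frame -/

namespace IrreducibleSO3Structure
variable {M : Type*} [TopologicalSpace M] [ChartedSpace R5 M] [IsManifold 𝓘(ℝ, R5) ∞ M]

theorem mdifferentiableAt_proj (s : EndTM M) :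
    MDifferentiableAt endModel 𝓘(ℝ, R5) (fun s : EndTM M ↦ s.1) s :=
  (contMDiff_proj (fun p : M ↦ TM M p →L[ℝ] TM M p) s).mdifferentiableAt (n := ∞) (by simp)

theorem projDiff_sectionDiff (s : EndTM M) (X : TM M s.1) : projDiff s (sectionDiff s X) = X := by
  have hτ : sectionThrough s s.1 = s.2 := sectionThrough_self s
  have h0 : (⟨s.1, sectionThrough s s.1⟩ : EndTM M) = s := by rw [hτ]
  have h := mfderiv_comp_apply_of_eq (x := s.1) (mdifferentiableAt_proj s)
    (mdifferentiableAt_sectionThrough s) h0 X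
  have h2 : mfderiv 𝓘(ℝ, R5) 𝓘(ℝ, R5)
      ((fun s : EndTM M ↦ s.1) ∘ fun q ↦ (⟨q, sectionThrough s q⟩ : EndTM M)) s.1 X = X :=
    congr($(mfderiv_id (I := 𝓘(ℝ, R5)) (x := s.1)) X)
  exact h.symm.trans h2

variable [RiemannianBundle (fun p : M ↦ TM M p)]

theorem mdifferentiableAt_fibreInclusion (q : M) (A : TM M q →L[ℝ] TM M q) :
    MDifferentiableAt 𝓘(ℝ, TM M q →L[ℝ] TM M q) endModel
      (fun V : TM M q →L[ℝ] TM M q ↦ (⟨q, V⟩ : EndTM M)) A := by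
  exact (contMDiffAt_totalSpaceMk (I := 𝓘(ℝ, R5)) (F := R5 →L[ℝ] R5)
    (fun p : M ↦ TM M p →L[ℝ] TM M p) (ContinuousLinearMap.id ℝ (TM M q →L[ℝ] TM M q)) A).mdifferentiableAt (by simp)

theorem projDiff_verticalLift (s : EndTM M) (V : TM M s.1 →L[ℝ] TM M s.1) :
    projDiff s (verticalLift s V) = 0 := by
  have h := (mdifferentiableAt_proj s).hasMFDerivAt.comp s.2
    (mdifferentiableAt_fibreInclusion s.1 s.2).hasMFDerivAt
  have h2 : HasMFDerivAt 𝓘(ℝ, TM M s.1 →L[ℝ] TM M s.1) 𝓘(ℝ, R5)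
    ((fun s : EndTM M ↦ s.1) ∘ fun V : TM M s.1 →L[ℝ] TM M s.1 ↦ (⟨s.1, V⟩ : EndTM M)) s.2 0 :=
    hasMFDerivAt_const s.1 s.2
  exact congr($(hasMFDerivAt_unique h h2) V)

theorem projDiff_horizontalLift (cov : CovariantDerivative 𝓘(ℝ, R5) R5 (fun p : M ↦ TM M p))
    (s : EndTM M) (X : TM M s.1) : projDiff s (horizontalLift cov s X) = X := by
  simp only [horizontalLift, _root_.sub_apply, ContinuousLinearMap.map_sub, projDiff_sectionDiff,
    ContinuousLinearMap.comp_apply, projDiff_verticalLift, sub_zero]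

namespace AdaptedFrame

variable {S : IrreducibleSO3Structure M} {p : M} (fr : S.AdaptedFrame p)

/-- The differential of the matrix of an endomorphism. -/
def dEntry (s : EndTM M) : TangentSpace endModel s →L[ℝ] Mat5 :=
  mfderiv endModel 𝓘(ℝ, Mat5) fr.entry s

/-- The matrix of an endomorphism of a fixed tangent space, as a linear map. -/
def entryL (q : M) : (TM M q →L[ℝ] TM M q) →L[ℝ] Mat5 :=
  ContinuousLinearMap.pi fun i ↦ ContinuousLinearMap.pi fun j ↦
    (innerSL ℝ (fr.E i q)).comp (ContinuousLinearMap.apply ℝ (TM M q) (fr.E j q))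

theorem entryL_apply (q : M) (A : TM M q →L[ℝ] TM M q) : fr.entryL q A = fr.entry ⟨q, A⟩ := by
  ext i j
  simp [entryL, entry, real_inner_comm]

variable [IsContMDiffRiemannianBundle 𝓘(ℝ, R5) ∞ R5 (fun p : M ↦ TM M p)]

theorem mdifferentiableAt_entry {s : EndTM M} (hs : s.1 ∈ fr.domain) :
    MDifferentiableAt endModel 𝓘(ℝ, Mat5) fr.entry s :=
  (fr.contMDiffAt_entry hs).mdifferentiableAt (by simp)

theorem mdifferentiableAt_toModel {s : EndTM M} (hs : s.1 ∈ fr.domain) :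
    MDifferentiableAt endModel 𝓘(ℝ, R5 × Mat5) fr.toModel s :=
  (fr.contMDiffAt_toModel hs).mdifferentiableAt (by simp)

theorem mdifferentiableAt_ofModel {z : R5 × Mat5} (hz : z ∈ fr.modelDomain) :
    MDifferentiableAt 𝓘(ℝ, R5 × Mat5) endModel fr.ofModel z :=
  (fr.contMDiffAt_ofModel hz).mdifferentiableAt (by simp)

theorem mfderiv_toModel_apply {s : EndTM M} (hs : s.1 ∈ fr.domain) (A : TangentSpace endModel s) :
    mfderiv endModel 𝓘(ℝ, R5 × Mat5) fr.toModel s A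
      = ((mfderiv 𝓘(ℝ, R5) 𝓘(ℝ, R5) (extChartAt 𝓘(ℝ, R5) p) s.1 (projDiff s A), fr.dEntry s A) :
        R5 × Mat5) := by
  have hφ : MDifferentiableAt 𝓘(ℝ, R5) 𝓘(ℝ, R5) (extChartAt 𝓘(ℝ, R5) p) s.1 :=
    mdifferentiableAt_extChartAt (fr.subset hs)
  have h1 : HasMFDerivAt endModel 𝓘(ℝ, R5) (fun s : EndTM M ↦ extChartAt 𝓘(ℝ, R5) p s.1) s
      ((mfderiv 𝓘(ℝ, R5) 𝓘(ℝ, R5) (extChartAt 𝓘(ℝ, R5) p) s.1).comp (projDiff s)) :=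
    hφ.hasMFDerivAt.comp s (mdifferentiableAt_proj s).hasMFDerivAt
  rw [mfderiv_prod_apply (fr.mdifferentiableAt_toModel hs)]
  exact Prod.ext congr($(h1.mfderiv) A) rfl

theorem isInvertible_mfderiv_ofModel {z : R5 × Mat5} (hz : z ∈ fr.modelDomain) :
    (mfderiv 𝓘(ℝ, R5 × Mat5) endModel fr.ofModel z).IsInvertible :=
  isInvertible_mfderiv_of_inverse (fr.mdifferentiableAt_toModel (s := fr.ofModel z) hz.2)
    (fr.mdifferentiableAt_ofModel hz) (fr.toModel_comp_ofModel hz)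
    (fr.ofModel_comp_toModel (s := fr.ofModel z) hz.2)

theorem isInvertible_mfderiv_toModel {s : EndTM M} (hs : s.1 ∈ fr.domain) :
    (mfderiv endModel 𝓘(ℝ, R5 × Mat5) fr.toModel s).IsInvertible :=
  isInvertible_mfderiv_of_inverse (fr.mdifferentiableAt_ofModel (fr.toModel_mem hs))
    (fr.mdifferentiableAt_toModel hs) (fr.ofModel_comp_toModel hs)
    (fr.toModel_comp_ofModel (fr.toModel_mem hs))

/-- A tangent vector of `End(TM)` is determined by its projection and the variation of the
matrix. -/
theorem ext_dEntry {s : EndTM M} (hs : s.1 ∈ fr.domain) {A B : TangentSpace endModel s}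
    (h₁ : projDiff s A = projDiff s B) (h₂ : fr.dEntry s A = fr.dEntry s B) : A = B := by
  refine (fr.isInvertible_mfderiv_toModel hs).injective ?_
  rw [fr.mfderiv_toModel_apply hs A, fr.mfderiv_toModel_apply hs B, h₁, h₂]

theorem dEntry_verticalLift {s : EndTM M} (hs : s.1 ∈ fr.domain) (V : TM M s.1 →L[ℝ] TM M s.1) :
    fr.dEntry s (verticalLift s V) = fr.entry ⟨s.1, V⟩ := by
  rw [← fr.entryL_apply]
  exact mfderiv_apply_mfderiv_of_comp_eq (fr.entryL s.1) (fun V ↦ (fr.entryL_apply s.1 V).symm)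
    (mdifferentiableAt_fibreInclusion s.1 s.2) (fr.mdifferentiableAt_entry hs) V

theorem dEntry_sectionDiff {cov : CovariantDerivative 𝓘(ℝ, R5) R5 (fun p : M ↦ TM M p)}
    (hcov : haveI : IsContMDiffRiemannianBundle 𝓘(ℝ, R5) 1 R5 (fun p : M ↦ TM M p) :=
        IsContMDiffRiemannianBundle.of_le (n := ∞) (by simp)
      cov.IsMetricCompatible) {s : EndTM M} (hs : s.1 ∈ fr.domain) (X : TM M s.1) (i j : Fin 5) :
    fr.dEntry s (sectionDiff s X) i j
      = ⟪cov (fun q ↦ sectionThrough s q (fr.E j q)) s.1 X, fr.E i s.1⟫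
        + ⟪s.2 (fr.E j s.1), cov (fr.E i) s.1 X⟫ := by
  have hτ : sectionThrough s s.1 = s.2 := sectionThrough_self s
  have h0 : (⟨s.1, sectionThrough s s.1⟩ : EndTM M) = s := by rw [hτ]
  have h := mfderiv_comp_apply_of_eq (x := s.1) (fr.mdifferentiableAt_entry hs)
    (mdifferentiableAt_sectionThrough s) h0 X
  have hd : MDifferentiableAt 𝓘(ℝ, R5) 𝓘(ℝ, Mat5)
      (fr.entry ∘ fun q ↦ (⟨q, sectionThrough s q⟩ : EndTM M)) s.1 :=
    MDifferentiableAt.comp_of_eq s.1 (fr.mdifferentiableAt_entry hs)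
      (mdifferentiableAt_sectionThrough s) h0
  have hij := mfderiv_clm_comp_apply ((ContinuousLinearMap.proj j : (Fin 5 → ℝ) →L[ℝ] ℝ).comp
      (ContinuousLinearMap.proj i : Mat5 →L[ℝ] (Fin 5 → ℝ))) hd X
  have h1 : fr.dEntry s (sectionDiff s X) i j
      = mvfderiv 𝓘(ℝ, R5) (fun q ↦ ⟪sectionThrough s q (fr.E j q), fr.E i q⟫) s.1 X :=
    (congr($h i j)).symm.trans hij.symm
  have : IsContMDiffRiemannianBundle 𝓘(ℝ, R5) 1 R5 (fun p : M ↦ TM M p) :=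
    IsContMDiffRiemannianBundle.of_le (n := ∞) (by simp)
  have h2 := hcov.mvfderiv_inner_eq (fun _ ↦ (X : R5))
    ((mdifferentiableAt_sectionThrough s).clm_bundle_apply (fr.mdifferentiableAt hs j))
    (fr.mdifferentiableAt hs i)
  rw [h1, ← hτ]
  exact h2

/-- The value of the section through `s` contributes only by the connection: the derivative of that
section is subtracted in the definition of the horizontal lift. -/
theorem dEntry_horizontalLift {cov : CovariantDerivative 𝓘(ℝ, R5) R5 (fun p : M ↦ TM M p)}
    (hcov : haveI : IsContMDiffRiemannianBundle 𝓘(ℝ, R5) 1 R5 (fun p : M ↦ TM M p) :=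
        IsContMDiffRiemannianBundle.of_le (n := ∞) (by simp)
      cov.IsMetricCompatible) {s : EndTM M} (hs : s.1 ∈ fr.domain) (X : TM M s.1) (i j : Fin 5) :
    fr.dEntry s (horizontalLift cov s X) i j
      = ⟪s.2 (cov (fr.E j) s.1 X), fr.E i s.1⟫ + ⟪s.2 (fr.E j s.1), cov (fr.E i) s.1 X⟫ := by
  have h := TensorialAt.mkHom_apply
    (tensorialAt_endCov cov (sectionThrough s) s.1 (mdifferentiableAt_sectionThrough s))
    (fr.mdifferentiableAt hs j)
  have h' : endCov cov (sectionThrough s) s.1 (mdifferentiableAt_sectionThrough s) (fr.E j s.1)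
      = cov (fun q ↦ sectionThrough s q (fr.E j q)) s.1
        - (sectionThrough s s.1).comp (cov (fr.E j) s.1) := h
  rw [horizontalLift, _root_.sub_apply, ContinuousLinearMap.map_sub, ContinuousLinearMap.comp_apply,
    fr.dEntry_verticalLift hs, Pi.sub_apply, Pi.sub_apply, fr.dEntry_sectionDiff hcov hs]
  simp only [entry, ContinuousLinearMap.flip_apply]
  rw [h', _root_.sub_apply, ContinuousLinearMap.comp_apply, sectionThrough_self, inner_sub_left]
  ring

end AdaptedFrame
end IrreducibleSO3Structure

/-! ### The connection form of the characteristic connection -/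

namespace IrreducibleSO3Structure
variable {M : Type*} [TopologicalSpace M] [ChartedSpace R5 M] [IsManifold 𝓘(ℝ, R5) ∞ M]
  [RiemannianBundle (fun p : M ↦ TM M p)]
namespace AdaptedFrame

variable {S : IrreducibleSO3Structure M} {p : M} (fr : S.AdaptedFrame p)

theorem inner_eq_ite {q : M} (hq : q ∈ fr.domain) (i j : Fin 5) :
    ⟪fr.E i q, fr.E j q⟫ = if i = j then 1 else 0 := by
  rw [← fr.basis_apply hq, ← fr.basis_apply hq, (fr.basis hq).inner_eq_ite]

theorem sum_inner_smul {q : M} (hq : q ∈ fr.domain) (x : TM M q) :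
    ∑ i, ⟪x, fr.E i q⟫ • fr.E i q = x := by
  conv_rhs => rw [← (fr.basis hq).sum_repr' x]
  exact Finset.sum_congr rfl fun i _ ↦ by rw [fr.basis_apply, real_inner_comm]

theorem upsilon_apply {q : M} (hq : q ∈ fr.domain) (i j k : Fin 5) :
    S.upsilon q (fr.E i q) (fr.E j q) (fr.E k q) = SO3Linear.upsilonCoeff i j k := by
  simp only [← fr.basis_apply hq]
  exact (fr.isAdapted hq).upsilon_apply i j k

/-- The matrix of `Y ↦ ∇_X Y - ∑ⱼ X(yⱼ) E_j`, `Y = ∑ⱼ yⱼ E_j`: the value at `X` of the connection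
form with respect to the frame. -/
def connection (cov : CovariantDerivative 𝓘(ℝ, R5) R5 (fun p : M ↦ TM M p)) (q : M) (X : TM M q)
    (i j : Fin 5) : ℝ := ⟪cov (fr.E j) q X, fr.E i q⟫

theorem cov_eq_sum_connection (cov : CovariantDerivative 𝓘(ℝ, R5) R5 (fun p : M ↦ TM M p)) {q : M}
    (hq : q ∈ fr.domain) (X : TM M q) (j : Fin 5) :
    cov (fr.E j) q X = ∑ i, fr.connection cov q X i j • fr.E i q :=
  (fr.sum_inner_smul hq _).symm

theorem mvfderiv_eq_zero_of_const {f : M → ℝ} {c : ℝ} (h : ∀ q ∈ fr.domain, f q = c) {q : M}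
    (hq : q ∈ fr.domain) (X : TM M q) : mvfderiv 𝓘(ℝ, R5) f q X = 0 := by
  have h' : f =ᶠ[𝓝 q] fun _ ↦ c := by
    filter_upwards [fr.isOpen.mem_nhds hq] with r hr using h r hr
  have h2 := (hasMFDerivAt_const (I := 𝓘(ℝ, R5)) (I' := 𝓘(ℝ, ℝ)) c q).congr_of_eventuallyEq h'
  exact congr($(h2.mfderiv) X)

variable [IsContMDiffRiemannianBundle 𝓘(ℝ, R5) ∞ R5 (fun p : M ↦ TM M p)]
  {cov : CovariantDerivative 𝓘(ℝ, R5) R5 (fun p : M ↦ TM M p)}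

theorem connection_skew (hcov : S.IsCharacteristic cov) {q : M} (hq : q ∈ fr.domain) (X : TM M q)
    (i j : Fin 5) : fr.connection cov q X i j = -fr.connection cov q X j i := by
  have : IsContMDiffRiemannianBundle 𝓘(ℝ, R5) 1 R5 (fun p : M ↦ TM M p) :=
    IsContMDiffRiemannianBundle.of_le (n := ∞) (by simp)
  have h := hcov.metric.mvfderiv_inner_eq (fun _ ↦ (X : R5)) (fr.mdifferentiableAt hq j)
    (fr.mdifferentiableAt hq i)
  have h0 : mvfderiv 𝓘(ℝ, R5) (fun r ↦ ⟪fr.E j r, fr.E i r⟫) q X = 0 :=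
    fr.mvfderiv_eq_zero_of_const (fun r hr ↦ fr.inner_eq_ite hr j i) hq X
  have h1 : fr.connection cov q X i j + fr.connection cov q X j i = 0 := by
    rw [connection, connection, real_inner_comm (fr.E j q)]
    exact h.symm.trans h0
  linarith

/-- The connection form takes values in the Lie algebra `so(3)`, identified with `Λ²₃`. -/
theorem exists_connection_eq_kappaMat (hcov : S.IsCharacteristic cov) {q : M} (hq : q ∈ fr.domain)
    (X : TM M q) : ∃ c, ∀ i j, fr.connection cov q X i j = SO3Linear.kappaMat c i j := by
  refine ⟨_, SO3Linear.eq_kappaMat_of_annihilates (fr.connection_skew hcov hq X) fun i j k ↦ ?_⟩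
  have h := hcov.parallel q X _ _ _ (fr.mdifferentiableAt hq i) (fr.mdifferentiableAt hq j)
    (fr.mdifferentiableAt hq k)
  rw [fr.mvfderiv_eq_zero_of_const (fun r hr ↦ fr.upsilon_apply hr i j k) hq X] at h
  simp only [fr.cov_eq_sum_connection cov hq X, map_sum, map_smul, LinearMap.sum_apply,
    LinearMap.smul_apply, smul_eq_mul, fr.upsilon_apply hq] at h
  simp only [Finset.sum_add_distrib]
  exact h.symm

/-- Horizontal vectors at the points of `Λ²₃` are tangent to `Λ²₃`. -/
theorem dEntry_horizontalLift_eq_kappaMat (hcov : S.IsCharacteristic cov) {s : EndTM M}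
    (hs : s.1 ∈ fr.domain) {y c : Fin 3 → ℝ} (hy : ∀ i j, fr.entry s i j = SO3Linear.kappaMat y i j)
    {X : TM M s.1} (hc : ∀ i j, fr.connection cov s.1 X i j = SO3Linear.kappaMat c i j)
    (i j : Fin 5) :
    fr.dEntry s (horizontalLift cov s X) i j
      = SO3Linear.kappaMat (crossProduct c y) i j := by
  rw [fr.dEntry_horizontalLift hcov.metric hs, ← SO3Linear.commutator_kappaMat,
    Matrix.sub_apply, Matrix.mul_apply, Matrix.mul_apply]
  have h1 : ⟪s.2 (cov (fr.E j) s.1 X), fr.E i s.1⟫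
      = ∑ k, SO3Linear.kappaMat y i k * SO3Linear.kappaMat c k j := by
    rw [fr.cov_eq_sum_connection cov hs X j]
    simp only [map_sum, map_smul, sum_inner, inner_smul_left, ← hc, ← hy, entry]
    exact Finset.sum_congr rfl fun k _ ↦ mul_comm _ _
  have h2 : ⟪s.2 (fr.E j s.1), cov (fr.E i) s.1 X⟫
      = -∑ k, SO3Linear.kappaMat c i k * SO3Linear.kappaMat y k j := by
    rw [fr.cov_eq_sum_connection cov hs X i, inner_sum, ← Finset.sum_neg_distrib]
    refine Finset.sum_congr rfl fun k _ ↦ ?_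
    rw [inner_smul_right, fr.connection_skew hcov hs, ← hc, ← hy, entry]
    ring
  rw [h1, h2]
  ring

end AdaptedFrame
end IrreducibleSO3Structure

/-! ### The twistor space and the distribution `𝒟` in an adapted frame -/

namespace SO3Linear

/-- The embedding of `Λ²₃` into the space of matrices. -/
def kappaL : (Fin 3 → ℝ) →L[ℝ] Mat5 :=
  LinearMap.toContinuousLinearMap
    { toFun := fun y i j ↦ kappaMat y i j
      map_add' := fun y z ↦ by
        ext i j
        fin_cases i <;> fin_cases j <;> simp [kappaMat] <;> ring
      map_smul' := fun c y ↦ by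
        ext i j
        fin_cases i <;> fin_cases j <;> simp [kappaMat] <;> ring }

theorem kappaL_apply (y : Fin 3 → ℝ) (i j : Fin 5) : kappaL y i j = kappaMat y i j := rfl

/-- A linear retraction of `kappaL`. -/
def kappaCoord : Mat5 →L[ℝ] (Fin 3 → ℝ) :=
  LinearMap.toContinuousLinearMap
    { toFun := fun B ↦ ![B 4 3, B 3 2, B 4 2]
      map_add' := fun B C ↦ by
        ext i
        fin_cases i <;> simp
      map_smul' := fun c B ↦ by
        ext i
        fin_cases i <;> simp }

theorem kappaCoord_kappaL (y : Fin 3 → ℝ) : kappaCoord (kappaL y) = y := by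
  ext i
  fin_cases i <;> simp [kappaCoord, kappaL_apply, kappaMat]

theorem kappaL_injective : Function.Injective kappaL :=
  Function.LeftInverse.injective kappaCoord_kappaL

end SO3Linear

namespace IrreducibleSO3Structure
variable {M : Type*} [TopologicalSpace M] [ChartedSpace R5 M] [IsManifold 𝓘(ℝ, R5) ∞ M]
  [RiemannianBundle (fun p : M ↦ TM M p)]

theorem projDiff_add_lifts (cov : CovariantDerivative 𝓘(ℝ, R5) R5 (fun p : M ↦ TM M p))
    (s : EndTM M) (V : TM M s.1 →L[ℝ] TM M s.1) (X : TM M s.1) :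
    projDiff s (verticalLift s V + horizontalLift cov s X) = X := by
  rw [ContinuousLinearMap.map_add, projDiff_verticalLift, projDiff_horizontalLift, zero_add]

namespace AdaptedFrame

open SO3Linear

variable {S : IrreducibleSO3Structure M} {p : M} (fr : S.AdaptedFrame p)

theorem entry_kappaSum {q : M} (hq : q ∈ fr.domain) (y : Fin 3 → ℝ) :
    fr.entry ⟨q, kappaSum (fr.basis hq) y⟩ = kappaL y := by
  ext i j
  rw [kappaL_apply, ← inner_kappaSum (fr.basis hq)]
  simp only [entry, fr.basis_apply]

theorem entry_injective {q : M} (hq : q ∈ fr.domain) {A B : TM M q →L[ℝ] TM M q}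
    (h : fr.entry ⟨q, A⟩ = fr.entry ⟨q, B⟩) : A = B := by
  rw [← fr.ofEntry_entry hq A, ← fr.ofEntry_entry hq B, h]

theorem entry_eq_kappaL_iff {q : M} (hq : q ∈ fr.domain) (A : TM M q →L[ℝ] TM M q)
    (y : Fin 3 → ℝ) : fr.entry ⟨q, A⟩ = kappaL y ↔ A = kappaSum (fr.basis hq) y := by
  rw [← fr.entry_kappaSum hq]
  exact ⟨fun h ↦ fr.entry_injective hq h, fun h ↦ by rw [h]⟩

theorem mem_lambda23_iff {q : M} (hq : q ∈ fr.domain) (W : TM M q →L[ℝ] TM M q) :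
    W ∈ S.lambda23 q ↔ ∃ y, W = kappaSum (fr.basis hq) y := by
  rw [IrreducibleSO3Structure.lambda23, lambda23_eq_of_basis _ (fr.basis hq)]
  exact SO3Linear.mem_lambda23_iff _ (fr.isAdapted hq).upsilon_apply W

theorem mem_twistorSpace_iff {s : EndTM M} (hs : s.1 ∈ fr.domain) :
    s ∈ S.twistorSpace ↔ ∃ y : Fin 3 → ℝ, y 0 ^ 2 + y 1 ^ 2 + y 2 ^ 2 = 1 ∧
      s.2 = kappaSum (fr.basis hs) y := by
  change s.2 ∈ S.lambda23 s.1 ∧ bivectorInner (S.adaptedBasis s.1) s.2 s.2 = 5 ↔ _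
  rw [fr.mem_lambda23_iff hs, bivectorInner_eq_of_basis _ (fr.basis hs)]
  constructor
  · rintro ⟨⟨y, hy⟩, h⟩
    refine ⟨y, ?_, hy⟩
    rw [hy, bivectorInner_kappaSum] at h
    linarith
  · rintro ⟨y, hy, h⟩
    refine ⟨⟨y, h⟩, ?_⟩
    rw [h, bivectorInner_kappaSum]
    linarith

theorem mem_verticalSpace_iff {s : EndTM M} (hs : s.1 ∈ fr.domain) {y : Fin 3 → ℝ}
    (hy : s.2 = kappaSum (fr.basis hs) y) (V : TM M s.1 →L[ℝ] TM M s.1) :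
    V ∈ S.verticalSpace s ↔ ∃ v : Fin 3 → ℝ, y 0 * v 0 + y 1 * v 1 + y 2 * v 2 = 0 ∧
      V = kappaSum (fr.basis hs) v := by
  change V ∈ S.lambda23 s.1 ∧ bivectorInner (S.adaptedBasis s.1) V s.2 = 0 ↔ _
  rw [fr.mem_lambda23_iff hs, bivectorInner_eq_of_basis _ (fr.basis hs), hy]
  constructor
  · rintro ⟨⟨v, hv⟩, h⟩
    refine ⟨v, ?_, hv⟩
    rw [hv, bivectorInner_kappaSum] at h
    linarith
  · rintro ⟨v, hv, h⟩
    refine ⟨⟨v, h⟩, ?_⟩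
    rw [h, bivectorInner_kappaSum]
    linarith

/-- The coordinates of a tangent vector in the frame. -/
def coord (q : M) (X : TM M q) (i : Fin 5) : ℝ := ⟪fr.E i q, X⟫

theorem sum_coord_smul {q : M} (hq : q ∈ fr.domain) (X : TM M q) :
    ∑ i, fr.coord q X i • fr.E i q = X := by
  conv_rhs => rw [← fr.sum_inner_smul hq X]
  exact Finset.sum_congr rfl fun i _ ↦ by rw [coord, real_inner_comm]

theorem coord_sum_smul {q : M} (hq : q ∈ fr.domain) (a : Fin 5 → ℝ) :
    fr.coord q (∑ i, a i • fr.E i q) = a := by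
  ext j
  simp [coord, inner_sum, inner_smul_right, fr.inner_eq_ite hq]

theorem xi_eq {s : EndTM M} (hs : s.1 ∈ fr.domain) {y : Fin 3 → ℝ}
    (hy : s.2 = kappaSum (fr.basis hs) y) :
    xi (S.adaptedBasis s.1) s.2 = ∑ i, xiVec y i • fr.E i s.1 := by
  rw [xi_eq_of_basis _ (fr.basis hs)
    ((S.isAdapted_adaptedBasis s.1).1.trans (fr.isAdapted hs).1.symm), hy, xi_kappaSum]
  simp only [fr.basis_apply]

theorem mem_hSpace_iff {s : EndTM M} (hs : s.1 ∈ fr.domain) {y : Fin 3 → ℝ}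
    (hy : s.2 = kappaSum (fr.basis hs) y) (X : TM M s.1) :
    X ∈ hSpace (S.adaptedBasis s.1) s.2 ↔ fr.coord s.1 X ⬝ᵥ xiVec y = 0 := by
  rw [hSpace, Submodule.mem_orthogonal_singleton_iff_inner_right, fr.xi_eq hs hy, sum_inner]
  simp only [inner_smul_left, dotProduct, coord]
  simp [mul_comm]

variable {cov : CovariantDerivative 𝓘(ℝ, R5) R5 (fun p : M ↦ TM M p)}

variable [IsContMDiffRiemannianBundle 𝓘(ℝ, R5) ∞ R5 (fun p : M ↦ TM M p)]

theorem verticalLift_injective {s : EndTM M} (hs : s.1 ∈ fr.domain) :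
    Function.Injective (verticalLift s) := fun V W h ↦ fr.entry_injective hs <| by
  rw [← fr.dEntry_verticalLift hs, h, fr.dEntry_verticalLift hs]

theorem verticalPart_add_lifts {s : EndTM M} (hs : s.1 ∈ fr.domain)
    (V : TM M s.1 →L[ℝ] TM M s.1) (X : TM M s.1) :
    verticalPart cov s (verticalLift s V + horizontalLift cov s X) = V := by
  rw [verticalPart, projDiff_add_lifts cov, add_sub_cancel_right]
  exact Function.leftInverse_invFun (fr.verticalLift_injective hs) V

theorem dEntry_horizontalLift_eq_kappaL (hcov : S.IsCharacteristic cov) {s : EndTM M}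
    (hs : s.1 ∈ fr.domain) {y c : Fin 3 → ℝ} (hy : s.2 = kappaSum (fr.basis hs) y)
    {X : TM M s.1} (hc : ∀ i j, fr.connection cov s.1 X i j = kappaMat c i j) :
    fr.dEntry s (horizontalLift cov s X) = kappaL (crossProduct c y) := by
  ext i j
  refine fr.dEntry_horizontalLift_eq_kappaMat hcov hs (fun i j ↦ ?_) hc i j
  rw [← kappaL_apply, ← (fr.entry_eq_kappaL_iff hs s.2 y).2 hy]

/-- The horizontal lift is tangent to the twistor space. -/
theorem exists_dEntry_horizontalLift (hcov : S.IsCharacteristic cov) {s : EndTM M}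
    (hs : s.1 ∈ fr.domain) {y : Fin 3 → ℝ} (hy : s.2 = kappaSum (fr.basis hs) y) (X : TM M s.1) :
    ∃ v : Fin 3 → ℝ, y 0 * v 0 + y 1 * v 1 + y 2 * v 2 = 0 ∧
      fr.dEntry s (horizontalLift cov s X) = kappaL v := by
  obtain ⟨c, hc⟩ := fr.exists_connection_eq_kappaMat hcov hs X
  refine ⟨crossProduct c y, ?_, fr.dEntry_horizontalLift_eq_kappaL hcov hs hy hc⟩
  simp [cross_apply]
  ring

/-- The distribution `𝒟` in terms of the frame: no connection appears, since horizontal vectors at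
the points of the twistor space are tangent to it. -/
theorem mem_distribution_iff (hcov : S.IsCharacteristic cov) {s : EndTM M} (hs : s.1 ∈ fr.domain)
    {y : Fin 3 → ℝ} (hy : s.2 = kappaSum (fr.basis hs) y) (A : TangentSpace endModel s) :
    A ∈ S.distribution cov s ↔
      (∃ v : Fin 3 → ℝ, y 0 * v 0 + y 1 * v 1 + y 2 * v 2 = 0 ∧ fr.dEntry s A = kappaL v) ∧
        fr.coord s.1 (projDiff s A) ⬝ᵥ xiVec y = 0 := by
  have hhor := fr.exists_dEntry_horizontalLift hcov hs hy
  rw [distribution, Submodule.mem_sup]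
  constructor
  · rintro ⟨_, ⟨V, hV, rfl⟩, _, ⟨X, hX, rfl⟩, rfl⟩
    obtain ⟨v, hv, rfl⟩ := (fr.mem_verticalSpace_iff hs hy V).1 hV
    obtain ⟨w, hw, h⟩ := hhor X
    have hX' := (fr.mem_hSpace_iff hs hy X).1 hX
    refine ⟨⟨v + w, ?_, ?_⟩, ?_⟩
    · simp only [Pi.add_apply]
      linear_combination hv + hw
    · change fr.dEntry s (verticalLift s _ + horizontalLift cov s X) = _
      rw [ContinuousLinearMap.map_add, h, fr.dEntry_verticalLift hs, fr.entry_kappaSum hs,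
        ContinuousLinearMap.map_add]
    · change fr.coord s.1 (projDiff s (verticalLift s _ + horizontalLift cov s X)) ⬝ᵥ _ = _
      rwa [projDiff_add_lifts cov]
  · rintro ⟨⟨u, hu, hA⟩, hA'⟩
    obtain ⟨w, hw, h⟩ := hhor (projDiff s A)
    refine ⟨verticalLift s (kappaSum (fr.basis hs) (u - w)), ⟨_, ?_, rfl⟩,
      horizontalLift cov s (projDiff s A), ⟨_, (fr.mem_hSpace_iff hs hy _).2 hA', rfl⟩, ?_⟩
    · refine (fr.mem_verticalSpace_iff hs hy _).2 ⟨u - w, ?_, rfl⟩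
      simp only [Pi.sub_apply]
      linear_combination hu - hw
    · refine fr.ext_dEntry hs (projDiff_add_lifts ..) ?_
      rw [ContinuousLinearMap.map_add, fr.dEntry_verticalLift hs, fr.entry_kappaSum hs, h,
        ContinuousLinearMap.map_sub, hA, sub_add_cancel]

end AdaptedFrame
end IrreducibleSO3Structure

/-! ### The Lie bracket of sections of `𝒟` in the local model -/

namespace SO3Linear

open Matrix

/-- The polar form of `xiVec`, as a continuous bilinear map. -/
def dxiL : (Fin 3 → ℝ) →L[ℝ] (Fin 3 → ℝ) →L[ℝ] (Fin 5 → ℝ) :=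
  LinearMap.toContinuousBilinearMap <| LinearMap.mk₂ ℝ dxiVec
    (fun x y z ↦ by ext i; fin_cases i <;> simp [dxiVec] <;> ring)
    (fun c y z ↦ by ext i; fin_cases i <;> simp [dxiVec] <;> ring)
    (fun x y z ↦ by ext i; fin_cases i <;> simp [dxiVec] <;> ring)
    (fun c y z ↦ by ext i; fin_cases i <;> simp [dxiVec] <;> ring)

theorem dxiL_apply (y v : Fin 3 → ℝ) : dxiL y v = dxiVec y v := rfl

theorem xiVec_eq (y : Fin 3 → ℝ) : xiVec y = (1 / 2 : ℝ) • dxiL y y := by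
  ext i
  fin_cases i <;> simp [xiVec, dxiL_apply, dxiVec] <;> ring

theorem hasFDerivAt_xiVec (y : Fin 3 → ℝ) : HasFDerivAt xiVec (dxiL y) y := by
  have h := (dxiL.hasFDerivAt_of_bilinear (hasFDerivAt_id y) (hasFDerivAt_id y)).const_smul
    (1 / 2 : ℝ)
  have h' : xiVec = (1 / 2 : ℝ) • fun y ↦ dxiL (id y) (id y) := funext xiVec_eq
  rw [h']
  refine h.congr_fderiv ?_
  ext v i
  fin_cases i <;> simp [dxiL_apply, dxiVec] <;> ring

variable {F : Type*} [NormedAddCommGroup F] [NormedSpace ℝ F]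

/-- The derivative of a function which vanishes on `Ω × S²`, where the unit sphere `S²` is embedded
by `kappaL`, vanishes on the tangent vectors. The curve used is the stereographic parametrization of
a great circle. -/
theorem hasFDerivAt_apply_eq_zero_of_sphere {f : R5 × Mat5 → F}
    {f' : R5 × Mat5 →L[ℝ] F} {x : R5} {y v : Fin 3 → ℝ} (hf : HasFDerivAt f f' (x, kappaL y))
    (hy : y 0 ^ 2 + y 1 ^ 2 + y 2 ^ 2 = 1)
    (hv : y 0 * v 0 + y 1 * v 1 + y 2 * v 2 = 0)
    (h : ∀ᶠ z in 𝓝 (x, kappaL y), ∀ y' : Fin 3 → ℝ, y' 0 ^ 2 + y' 1 ^ 2 + y' 2 ^ 2 = 1 →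
      z.2 = kappaL y' → f z = 0) (a : R5) :
    f' (a, kappaL v) = 0 := by
  set m : ℝ := (v 0 ^ 2 + v 1 ^ 2 + v 2 ^ 2) / 4 with hm
  have hm0 : 0 ≤ m := by positivity
  let n : ℝ → ℝ := fun t ↦ 1 + t ^ 2 * m
  have hn (t : ℝ) : n t ≠ 0 := by simp only [n]; positivity
  let c : ℝ → Fin 3 → ℝ := fun t ↦ ((1 - t ^ 2 * m) / n t) • y + (t / n t) • v
  have hc (t : ℝ) : c t 0 ^ 2 + c t 1 ^ 2 + c t 2 ^ 2 = 1 := by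
    have hnt := hn t
    have h0 : c t 0 ^ 2 + c t 1 ^ 2 + c t 2 ^ 2 = ((1 - t ^ 2 * m) ^ 2 *
        (y 0 ^ 2 + y 1 ^ 2 + y 2 ^ 2) + 2 * (1 - t ^ 2 * m) * t *
        (y 0 * v 0 + y 1 * v 1 + y 2 * v 2) + t ^ 2 * (4 * m)) / n t ^ 2 := by
      simp only [c, Pi.add_apply, Pi.smul_apply, smul_eq_mul, hm]
      field_simp
      ring
    rw [h0, hy, hv, div_eq_one_iff_eq (pow_ne_zero 2 hnt)]
    simp only [n]
    ring
  have hnd : HasDerivAt n 0 0 := by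
    have := ((hasDerivAt_pow 2 (0 : ℝ)).mul_const m).const_add 1
    simpa [n] using this
  have h1 : HasDerivAt (fun t ↦ (1 - t ^ 2 * m) / n t) 0 0 := by
    have h2 : HasDerivAt (fun t : ℝ ↦ 1 - t ^ 2 * m) 0 0 := by
      have := ((hasDerivAt_pow 2 (0 : ℝ)).mul_const m).const_sub 1
      simpa using this
    exact (h2.fun_div hnd (hn 0)).congr_deriv (by simp)
  have h2 : HasDerivAt (fun t ↦ t / n t) 1 0 :=
    ((hasDerivAt_id' (0 : ℝ)).fun_div hnd (hn 0)).congr_deriv (by simp [n])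
  have hcd : HasDerivAt c v 0 :=
    ((h1.smul_const y).add (h2.smul_const v)).congr_deriv (by simp)
  have hc0 : c 0 = y := by simp [c, n]
  let γ : ℝ → R5 × Mat5 := fun t ↦ (x + t • a, kappaL (c t))
  have hγ : HasDerivAt γ (a, kappaL v) 0 := by
    refine HasDerivAt.prodMk ?_ (kappaL.hasFDerivAt.comp_hasDerivAt (0 : ℝ) hcd)
    simpa using ((hasDerivAt_id (0 : ℝ)).smul_const a).const_add x
  have hγ0 : γ 0 = (x, kappaL y) := by simp [γ, hc0]
  have hd := hf.comp_hasDerivAt_of_eq (0 : ℝ) hγ hγ0.symm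
  have hz : f ∘ γ =ᶠ[𝓝 0] fun _ ↦ 0 := by
    have ht := hγ.continuousAt.tendsto
    rw [hγ0] at ht
    filter_upwards [ht.eventually h] with t ht using ht _ (hc t) rfl
  exact hd.unique ((hasDerivAt_const (0 : ℝ) (0 : F)).congr_of_eventuallyEq hz)

theorem exists_hasFDerivAt_dotProduct {E ι : Type*} [NormedAddCommGroup E] [NormedSpace ℝ E]
    [Fintype ι] {p q : E → ι → ℝ} {p' q' : E →L[ℝ] ι → ℝ} {z : E} (hp : HasFDerivAt p p' z)
    (hq : HasFDerivAt q q' z) :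
    ∃ L : E →L[ℝ] ℝ, HasFDerivAt (fun z ↦ p z ⬝ᵥ q z) L z ∧
      ∀ A, L A = p' A ⬝ᵥ q z + p z ⬝ᵥ q' A := by
  refine ⟨_, HasFDerivAt.fun_sum fun i _ ↦
    (hasFDerivAt_pi'.1 hp i).mul (hasFDerivAt_pi'.1 hq i), fun A ↦ ?_⟩
  simp [dotProduct, Finset.sum_add_distrib, add_comm, mul_comm]

/-- The derivative, along a vector tangent to `Ω × S²`, of a section of the distribution `𝒟` in the
local model. -/
theorem fderiv_section_apply {ε : Fin 5 → R5 → R5} {Y : R5 × Mat5 → R5 × Mat5}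
    {d : R5 × Mat5 → Fin 5 → ℝ} {x a : R5} {y v : Fin 3 → ℝ}
    (hy : y 0 ^ 2 + y 1 ^ 2 + y 2 ^ 2 = 1) (hε : ∀ i, DifferentiableAt ℝ (ε i) x)
    (hY : DifferentiableAt ℝ Y (x, kappaL y)) (hd : DifferentiableAt ℝ d (x, kappaL y))
    (hYd : ∀ᶠ z in 𝓝 (x, kappaL y), (Y z).1 = ∑ i, d z i • ε i z.1)
    (hYs : ∀ᶠ z in 𝓝 (x, kappaL y), ∀ y' : Fin 3 → ℝ, y' 0 ^ 2 + y' 1 ^ 2 + y' 2 ^ 2 = 1 →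
      z.2 = kappaL y' → (∃ u : Fin 3 → ℝ, y' 0 * u 0 + y' 1 * u 1 + y' 2 * u 2 = 0 ∧
        (Y z).2 = kappaL u) ∧ d z ⬝ᵥ xiVec y' = 0)
    (hv : y 0 * v 0 + y 1 * v 1 + y 2 * v 2 = 0) :
    ∃ (g : Fin 5 → ℝ) (u : Fin 3 → ℝ),
      fderiv ℝ Y (x, kappaL y) (a, kappaL v) = (∑ i, g i • ε i x +
        ∑ i, d (x, kappaL y) i • fderiv ℝ (ε i) x a, kappaL u) ∧
      v ⬝ᵥ kappaCoord (Y (x, kappaL y)).2 + y ⬝ᵥ u = 0 ∧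
      g ⬝ᵥ xiVec y + d (x, kappaL y) ⬝ᵥ dxiVec y v = 0 := by
  have hD := hY.hasFDerivAt
  have hdD := hd.hasFDerivAt
  have hD₁ : HasFDerivAt (fun z ↦ (Y z).1)
      ((ContinuousLinearMap.fst ℝ R5 Mat5).comp (fderiv ℝ Y (x, kappaL y))) (x, kappaL y) :=
    (ContinuousLinearMap.fst ℝ R5 Mat5).hasFDerivAt.comp _ hD
  have hD₂ : HasFDerivAt (fun z ↦ (Y z).2)
      ((ContinuousLinearMap.snd ℝ R5 Mat5).comp (fderiv ℝ Y (x, kappaL y))) (x, kappaL y) :=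
    (ContinuousLinearMap.snd ℝ R5 Mat5).hasFDerivAt.comp _ hD
  have hD₃ : HasFDerivAt (fun z ↦ kappaCoord (Y z).2) (kappaCoord.comp
      ((ContinuousLinearMap.snd ℝ R5 Mat5).comp (fderiv ℝ Y (x, kappaL y)))) (x, kappaL y) :=
    kappaCoord.hasFDerivAt.comp _ hD₂
  have hid : HasFDerivAt (fun z : R5 × Mat5 ↦ kappaCoord z.2)
      (kappaCoord.comp (ContinuousLinearMap.snd ℝ R5 Mat5)) (x, kappaL y) :=
    kappaCoord.hasFDerivAt.comp (x, kappaL y) (ContinuousLinearMap.snd ℝ R5 Mat5).hasFDerivAt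
  have hξ : HasFDerivAt (fun z : R5 × Mat5 ↦ xiVec (kappaCoord z.2)) ((dxiL y).comp
      (kappaCoord.comp (ContinuousLinearMap.snd ℝ R5 Mat5))) (x, kappaL y) := by
    refine HasFDerivAt.comp (g := xiVec) (x, kappaL y) ?_ hid
    rw [kappaCoord_kappaL]
    exact hasFDerivAt_xiVec y
  refine ⟨fderiv ℝ d (x, kappaL y) (a, kappaL v),
    kappaCoord (fderiv ℝ Y (x, kappaL y) (a, kappaL v)).2, Prod.ext ?_ ?_, ?_, ?_⟩
  · have h0 (i : Fin 5) : HasFDerivAt (fun z : R5 × Mat5 ↦ ε i z.1)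
        ((fderiv ℝ (ε i) x).comp (ContinuousLinearMap.fst ℝ R5 Mat5)) (x, kappaL y) :=
      HasFDerivAt.comp (g := ε i) (x, kappaL y) (hε i).hasFDerivAt
        (ContinuousLinearMap.fst ℝ R5 Mat5).hasFDerivAt
    have h1 := HasFDerivAt.fun_sum (u := Finset.univ)
      fun i _ ↦ (hasFDerivAt_pi'.1 hdD i).fun_smul (h0 i)
    have h2 := congr($(hD₁.unique (h1.congr_of_eventuallyEq hYd)) (a, kappaL v))
    simp only [ContinuousLinearMap.comp_apply, _root_.sum_apply, _root_.add_apply,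
      _root_.smul_apply, ContinuousLinearMap.smulRight_apply, ContinuousLinearMap.coe_fst',
      ContinuousLinearMap.proj_apply, Finset.sum_add_distrib] at h2
    rw [h2, add_comm]
  · have h1 := hasFDerivAt_apply_eq_zero_of_sphere
      (hD₂.fun_sub (kappaL.hasFDerivAt.comp (x, kappaL y) hD₃)) hy hv (by
        filter_upwards [hYs] with z' h y' hy' hz'
        obtain ⟨⟨u, -, hu⟩, -⟩ := h y' hy' hz'
        simp [hu, kappaCoord_kappaL]) a
    exact sub_eq_zero.1 h1
  · obtain ⟨L, hL, hL'⟩ := exists_hasFDerivAt_dotProduct hid hD₃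
    have h1 := hasFDerivAt_apply_eq_zero_of_sphere hL hy hv (by
      filter_upwards [hYs] with z' h y' hy' hz'
      obtain ⟨⟨u, hu', hu⟩, -⟩ := h y' hy' hz'
      rw [hu, hz', kappaCoord_kappaL, kappaCoord_kappaL, dotProduct, Fin.sum_univ_three, hu']) a
    rw [hL'] at h1
    simpa only [ContinuousLinearMap.comp_apply, ContinuousLinearMap.coe_snd',
      kappaCoord_kappaL] using h1
  · obtain ⟨L, hL, hL'⟩ := exists_hasFDerivAt_dotProduct hdD hξ
    have h1 := hasFDerivAt_apply_eq_zero_of_sphere hL hy hv (by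
      filter_upwards [hYs] with z' h y' hy' hz'
      rw [hz', kappaCoord_kappaL, (h y' hy' hz').2]) a
    rw [hL'] at h1
    simpa only [ContinuousLinearMap.comp_apply, ContinuousLinearMap.coe_snd',
      kappaCoord_kappaL, dxiL_apply] using h1

/-- The Lie bracket of two sections of the distribution `𝒟` in the local model: `ε` is the frame,
`c` and `d` are the coordinates of the projections of the two fields. -/
theorem lieBracket_of_sections {ε : Fin 5 → R5 → R5} {X Y : R5 × Mat5 → R5 × Mat5}
    {c d : R5 × Mat5 → Fin 5 → ℝ} {x : R5} {y v w : Fin 3 → ℝ}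
    (hy : y 0 ^ 2 + y 1 ^ 2 + y 2 ^ 2 = 1)
    (hε : ∀ i, DifferentiableAt ℝ (ε i) x)
    (hX : DifferentiableAt ℝ X (x, kappaL y)) (hY : DifferentiableAt ℝ Y (x, kappaL y))
    (hc : DifferentiableAt ℝ c (x, kappaL y)) (hd : DifferentiableAt ℝ d (x, kappaL y))
    (hXc : ∀ᶠ z in 𝓝 (x, kappaL y), (X z).1 = ∑ i, c z i • ε i z.1)
    (hYd : ∀ᶠ z in 𝓝 (x, kappaL y), (Y z).1 = ∑ i, d z i • ε i z.1)
    (hXs : ∀ᶠ z in 𝓝 (x, kappaL y), ∀ y' : Fin 3 → ℝ, y' 0 ^ 2 + y' 1 ^ 2 + y' 2 ^ 2 = 1 →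
      z.2 = kappaL y' → (∃ u : Fin 3 → ℝ, y' 0 * u 0 + y' 1 * u 1 + y' 2 * u 2 = 0 ∧
        (X z).2 = kappaL u) ∧ c z ⬝ᵥ xiVec y' = 0)
    (hYs : ∀ᶠ z in 𝓝 (x, kappaL y), ∀ y' : Fin 3 → ℝ, y' 0 ^ 2 + y' 1 ^ 2 + y' 2 ^ 2 = 1 →
      z.2 = kappaL y' → (∃ u : Fin 3 → ℝ, y' 0 * u 0 + y' 1 * u 1 + y' 2 * u 2 = 0 ∧
        (Y z).2 = kappaL u) ∧ d z ⬝ᵥ xiVec y' = 0)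
    (hv : (X (x, kappaL y)).2 = kappaL v) (hw : (Y (x, kappaL y)).2 = kappaL w) :
    ∃ (g : Fin 5 → ℝ) (u : Fin 3 → ℝ), y 0 * u 0 + y 1 * u 1 + y 2 * u 2 = 0 ∧
      g ⬝ᵥ xiVec y = -(dxiVec y v ⬝ᵥ d (x, kappaL y)) + dxiVec y w ⬝ᵥ c (x, kappaL y) ∧
      VectorField.lieBracket ℝ X Y (x, kappaL y) = (∑ i, g i • ε i x +
        ∑ i, ∑ j, (c (x, kappaL y) i * d (x, kappaL y) j) •
          VectorField.lieBracket ℝ (ε i) (ε j) x, kappaL u) := by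
  have hvy : y 0 * v 0 + y 1 * v 1 + y 2 * v 2 = 0 := by
    obtain ⟨⟨u, hu, hu'⟩, -⟩ := hXs.self_of_nhds y hy rfl
    rwa [kappaL_injective (hv.symm.trans hu')]
  have hwy : y 0 * w 0 + y 1 * w 1 + y 2 * w 2 = 0 := by
    obtain ⟨⟨u, hu, hu'⟩, -⟩ := hYs.self_of_nhds y hy rfl
    rwa [kappaL_injective (hw.symm.trans hu')]
  have hXz : X (x, kappaL y) = ((X (x, kappaL y)).1, kappaL v) := Prod.ext rfl hv
  have hYz : Y (x, kappaL y) = ((Y (x, kappaL y)).1, kappaL w) := Prod.ext rfl hw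
  obtain ⟨g₁, u₁, e₁, f₁, k₁⟩ := fderiv_section_apply (a := (X (x, kappaL y)).1) hy hε hY hd hYd hYs hvy
  obtain ⟨g₂, u₂, e₂, f₂, k₂⟩ := fderiv_section_apply (a := (Y (x, kappaL y)).1) hy hε hX hc hXc hXs hwy
  rw [hw, kappaCoord_kappaL] at f₁
  rw [hv, kappaCoord_kappaL] at f₂
  refine ⟨g₁ - g₂, u₁ - u₂, ?_, ?_, ?_⟩
  · simp only [dotProduct, Fin.sum_univ_three] at f₁ f₂
    simp only [Pi.sub_apply]
    linear_combination f₁ - f₂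
  · rw [sub_dotProduct, dotProduct_comm (dxiVec y v), dotProduct_comm (dxiVec y w)]
    linear_combination k₁ - k₂
  · rw [VectorField.lieBracket, hXz, hYz, e₁, e₂, hXc.self_of_nhds, hYd.self_of_nhds,
      Prod.mk_sub_mk, ← ContinuousLinearMap.map_sub]
    congr 1
    have h1 : ∑ i, ∑ j, (c (x, kappaL y) i * d (x, kappaL y) j) • VectorField.lieBracket ℝ (ε i) (ε j) x
        = ∑ i, d (x, kappaL y) i • fderiv ℝ (ε i) x (∑ j, c (x, kappaL y) j • ε j x)
          - ∑ i, c (x, kappaL y) i • fderiv ℝ (ε i) x (∑ j, d (x, kappaL y) j • ε j x) := by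
      simp only [VectorField.lieBracket, map_sum, map_smul, Finset.smul_sum, smul_sub, smul_smul,
        Finset.sum_sub_distrib]
      congr 1
      · rw [Finset.sum_comm]
        exact Finset.sum_congr rfl fun i _ ↦ Finset.sum_congr rfl fun j _ ↦ by rw [mul_comm]
    rw [h1]
    simp only [Pi.sub_apply, sub_smul, Finset.sum_sub_distrib]
    abel

end SO3Linear

/-! ### The Lie bracket of sections of `𝒟` -/

theorem lieBracket_mpullback_of_inverse {E H N F : Type*} [NormedAddCommGroup E] [NormedSpace ℝ E]
    [CompleteSpace E] [TopologicalSpace H] {I : ModelWithCorners ℝ E H} [TopologicalSpace N]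
    [ChartedSpace H N] [IsManifold I ∞ N] [NormedAddCommGroup F] [NormedSpace ℝ F] [CompleteSpace F]
    {f : N → F} {g : F → N} {y : F} (hf : MDifferentiableAt I 𝓘(ℝ, F) f (g y))
    (hg : ContMDiffAt 𝓘(ℝ, F) I ∞ g y) (h : f ∘ g =ᶠ[𝓝 y] id) (h' : g ∘ f =ᶠ[𝓝 (g y)] id)
    {V W : Π x : N, TangentSpace I x}
    (hV : MDifferentiableAt I I.tangent (fun x ↦ (⟨x, V x⟩ : TangentBundle I N)) (g y))
    (hW : MDifferentiableAt I I.tangent (fun x ↦ (⟨x, W x⟩ : TangentBundle I N)) (g y)) :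
    VectorField.lieBracket ℝ (VectorField.mpullback 𝓘(ℝ, F) I g V)
      (VectorField.mpullback 𝓘(ℝ, F) I g W) y
      = mfderiv I 𝓘(ℝ, F) f (g y) (VectorField.mlieBracket I V W (g y)) := by
  have two_le_infty : minSmoothness ℝ 2 ≤ (∞ : ℕ∞ω) := by
    rw [minSmoothness_of_isRCLikeNormedField]
    exact WithTop.coe_le_coe.2 (OrderTop.le_top (2 : ℕ∞))
  have : IsManifold I (minSmoothness ℝ 2) N := IsManifold.of_le (n := ∞) two_le_infty
  have : IsManifold I 1 N := IsManifold.of_le (n := ∞) (by simp)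
  rw [← mpullback_apply_of_inverse hf (hg.mdifferentiableAt (by simp)) h h',
    VectorField.mpullback_mlieBracket hV hW hg two_le_infty,
    ← VectorField.mlieBracketWithin_univ,
    VectorField.mlieBracketWithin_eq_lieBracketWithin]
  exact congr($(VectorField.lieBracketWithin_univ.symm) y)

section Chart

variable {M : Type*} [TopologicalSpace M] [ChartedSpace R5 M] {p : M} {x : R5}

theorem contMDiffAt_extChartAt_symm_of_mem [IsManifold 𝓘(ℝ, R5) ∞ M] (hx : x ∈ (extChartAt 𝓘(ℝ, R5) p).target) :
    ContMDiffAt 𝓘(ℝ, R5) 𝓘(ℝ, R5) ∞ (extChartAt 𝓘(ℝ, R5) p).symm x :=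
  (contMDiffOn_extChartAt_symm p).contMDiffAt ((isOpen_extChartAt_target p).mem_nhds hx)

theorem extChartAt_comp_symm_eventuallyEq (hx : x ∈ (extChartAt 𝓘(ℝ, R5) p).target) :
    extChartAt 𝓘(ℝ, R5) p ∘ (extChartAt 𝓘(ℝ, R5) p).symm =ᶠ[𝓝 x] id := by
  filter_upwards [(isOpen_extChartAt_target p).mem_nhds hx] with r hr
    using (extChartAt 𝓘(ℝ, R5) p).right_inv hr

end Chart

namespace IrreducibleSO3Structure
variable {M : Type*} [TopologicalSpace M] [ChartedSpace R5 M] [IsManifold 𝓘(ℝ, R5) ∞ M]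
  [RiemannianBundle (fun p : M ↦ TM M p)]

namespace AdaptedFrame

open SO3Linear

variable {S : IrreducibleSO3Structure M} {p : M} (fr : S.AdaptedFrame p)

/-- The frame in the chart of `M` at `p`. -/
def modelFrame (i : Fin 5) : R5 → R5 :=
  VectorField.mpullback 𝓘(ℝ, R5) 𝓘(ℝ, R5) (extChartAt 𝓘(ℝ, R5) p).symm (fr.E i)

theorem mdifferentiableAt_chart {q : M} (hq : q ∈ fr.domain) :
    MDifferentiableAt 𝓘(ℝ, R5) 𝓘(ℝ, R5) (extChartAt 𝓘(ℝ, R5) p) q :=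
  mdifferentiableAt_extChartAt (fr.subset hq)

theorem mfderiv_chart_eq_sum {q : M} (hq : q ∈ fr.domain) (X : TM M q) :
    mfderiv 𝓘(ℝ, R5) 𝓘(ℝ, R5) (extChartAt 𝓘(ℝ, R5) p) q X
      = ∑ i, fr.coord q X i •
        mfderiv 𝓘(ℝ, R5) 𝓘(ℝ, R5) (extChartAt 𝓘(ℝ, R5) p) q (fr.E i q) := by
  conv_lhs => rw [← fr.sum_coord_smul hq X, map_sum]
  simp only [map_smul]

section

variable {x : R5} (hx : x ∈ (extChartAt 𝓘(ℝ, R5) p).target)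
  (hx' : (extChartAt 𝓘(ℝ, R5) p).symm x ∈ fr.domain)

theorem chart_symm_comp_chart {q : M} (hq : q ∈ fr.domain) :
    (extChartAt 𝓘(ℝ, R5) p).symm ∘ extChartAt 𝓘(ℝ, R5) p =ᶠ[𝓝 q] id := by
  filter_upwards [fr.isOpen.mem_nhds hq] with r hr
    using (extChartAt 𝓘(ℝ, R5) p).left_inv (fr.mem_source hr)

include hx hx'

theorem mpullback_chart_symm_apply (V : Π q : M, TM M q) :
    VectorField.mpullback 𝓘(ℝ, R5) 𝓘(ℝ, R5) (extChartAt 𝓘(ℝ, R5) p).symm V x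
      = mfderiv 𝓘(ℝ, R5) 𝓘(ℝ, R5) (extChartAt 𝓘(ℝ, R5) p) ((extChartAt 𝓘(ℝ, R5) p).symm x)
        (V ((extChartAt 𝓘(ℝ, R5) p).symm x)) :=
  mpullback_apply_of_inverse (fr.mdifferentiableAt_chart hx')
    ((contMDiffAt_extChartAt_symm_of_mem hx).mdifferentiableAt (by simp)) (extChartAt_comp_symm_eventuallyEq hx)
    (fr.chart_symm_comp_chart hx') V

theorem contDiffAt_modelFrame (i : Fin 5) : ContDiffAt ℝ ∞ (fr.modelFrame i) x := by
  refine contMDiffAt_vectorSpace_iff_contDiffAt.1 ?_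
  exact ContMDiffAt.mpullback_vectorField_preimage (fr.contMDiffAt hx' i)
    (contMDiffAt_extChartAt_symm_of_mem hx)
    (isInvertible_mfderiv_of_inverse (fr.mdifferentiableAt_chart hx')
    ((contMDiffAt_extChartAt_symm_of_mem hx).mdifferentiableAt (by simp)) (extChartAt_comp_symm_eventuallyEq hx)
    (fr.chart_symm_comp_chart hx')) (by simp)

theorem lieBracket_modelFrame (i j : Fin 5) :
    VectorField.lieBracket ℝ (fr.modelFrame i) (fr.modelFrame j) x
      = mfderiv 𝓘(ℝ, R5) 𝓘(ℝ, R5) (extChartAt 𝓘(ℝ, R5) p) ((extChartAt 𝓘(ℝ, R5) p).symm x)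
        (VectorField.mlieBracket 𝓘(ℝ, R5) (fr.E i) (fr.E j)
          ((extChartAt 𝓘(ℝ, R5) p).symm x)) :=
  lieBracket_mpullback_of_inverse (fr.mdifferentiableAt_chart hx')
    (contMDiffAt_extChartAt_symm_of_mem hx) (extChartAt_comp_symm_eventuallyEq hx)
    (fr.chart_symm_comp_chart hx') (fr.mdifferentiableAt hx' i) (fr.mdifferentiableAt hx' j)

end

theorem eq_kappaSum_of_eq_kappaL {z : R5 × Mat5} (hz : z ∈ fr.modelDomain) {y : Fin 3 → ℝ} (hzy : z.2 = kappaL y) :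
    (fr.ofModel z).2 = kappaSum (fr.basis (q := (fr.ofModel z).1) hz.2) y := by
  refine (fr.entry_eq_kappaL_iff hz.2 _ y).1 ?_
  rw [← hzy]
  exact fr.entry_ofEntry hz.2 z.2

variable [IsContMDiffRiemannianBundle 𝓘(ℝ, R5) ∞ R5 (fun p : M ↦ TM M p)]

theorem contMDiffAt_coord_projDiff {s : EndTM M} (hs : s.1 ∈ fr.domain)
    {X : Π s : EndTM M, TangentSpace endModel s}
    (hX : ContMDiffAt endModel (endModel).tangent ∞
      (fun s ↦ (⟨s, X s⟩ : TangentBundle endModel (EndTM M))) s) :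
    ContMDiffAt endModel 𝓘(ℝ, Fin 5 → ℝ) ∞ (fun r ↦ fr.coord r.1 (projDiff r (X r))) s := by
  have hπ : ContMDiff endModel 𝓘(ℝ, R5) ∞ (fun s : EndTM M ↦ s.1) :=
    contMDiff_proj (fun p : M ↦ TM M p →L[ℝ] TM M p)
  have h1 : ContMDiffAt endModel 𝓘(ℝ, R5).tangent ∞
      (fun r ↦ (⟨r.1, projDiff r (X r)⟩ : TangentBundle 𝓘(ℝ, R5) M)) s :=
    ((hπ.contMDiff_tangentMap (m := ∞) (by simp)) _).comp s hX
  refine contMDiffAt_pi_space.2 fun i ↦ ?_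
  exact ContMDiffAt.inner_bundle ((fr.contMDiffAt hs i).comp s (hπ s)) h1

/-- A vector field of `End(TM)` in the chart `toModel`. -/
def modelField (X : Π s : EndTM M, TangentSpace endModel s) : R5 × Mat5 → R5 × Mat5 :=
  VectorField.mpullback 𝓘(ℝ, R5 × Mat5) endModel fr.ofModel X

/-- The coordinates of the projection of a vector field of `End(TM)`, in the chart `toModel`. -/
def modelCoord (X : Π s : EndTM M, TangentSpace endModel s) (z : R5 × Mat5) : Fin 5 → ℝ :=
  fr.coord (fr.ofModel z).1 (projDiff (fr.ofModel z) (X (fr.ofModel z)))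

theorem modelField_apply {z : R5 × Mat5} (hz : z ∈ fr.modelDomain)
    (X : Π s : EndTM M, TangentSpace endModel s) :
    fr.modelField X z = (∑ i, fr.modelCoord X z i • fr.modelFrame i z.1,
      fr.dEntry (fr.ofModel z) (X (fr.ofModel z))) := by
  have h := mpullback_apply_of_inverse (fr.mdifferentiableAt_toModel (s := fr.ofModel z) hz.2)
    (fr.mdifferentiableAt_ofModel hz) (fr.toModel_comp_ofModel hz)
    (fr.ofModel_comp_toModel (s := fr.ofModel z) hz.2) X
  rw [fr.mfderiv_toModel_apply hz.2] at h
  refine h.trans (Prod.ext ?_ rfl)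
  have h1 (i : Fin 5) := fr.mpullback_chart_symm_apply hz.1 hz.2 (fr.E i)
  simp only [modelFrame, h1]
  exact fr.mfderiv_chart_eq_sum hz.2 _

variable {cov : CovariantDerivative 𝓘(ℝ, R5) R5 (fun p : M ↦ TM M p)}
  {z : R5 × Mat5} {X : Π s : EndTM M, TangentSpace endModel s}

theorem contDiffAt_modelField (hz : z ∈ fr.modelDomain)
    (hX : ContMDiffAt endModel (endModel).tangent ∞
      (fun s ↦ (⟨s, X s⟩ : TangentBundle endModel (EndTM M))) (fr.ofModel z)) :
    ContDiffAt ℝ ∞ (fr.modelField X) z :=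
  contMDiffAt_vectorSpace_iff_contDiffAt.1
    (ContMDiffAt.mpullback_vectorField_preimage hX (fr.contMDiffAt_ofModel hz)
      (fr.isInvertible_mfderiv_ofModel hz) (by simp))

theorem contDiffAt_modelCoord (hz : z ∈ fr.modelDomain)
    (hX : ContMDiffAt endModel (endModel).tangent ∞
      (fun s ↦ (⟨s, X s⟩ : TangentBundle endModel (EndTM M))) (fr.ofModel z)) :
    ContDiffAt ℝ ∞ (fr.modelCoord X) z :=
  ((fr.contMDiffAt_coord_projDiff (s := fr.ofModel z) hz.2 hX).comp z
    (fr.contMDiffAt_ofModel hz)).contDiffAt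

/-- The condition that `X` is a section of `𝒟` along the twistor space, in the local model. -/
theorem eventually_modelField_mem (hcov : S.IsCharacteristic cov) (hz : z ∈ fr.modelDomain)
    (hX : AlmostCR.IsLocalSection endModel S.twistorSpace (S.distribution cov) (fr.ofModel z) X) :
    ∀ᶠ z in 𝓝 z, ∀ y : Fin 3 → ℝ, y 0 ^ 2 + y 1 ^ 2 + y 2 ^ 2 = 1 →
      z.2 = kappaL y → (∃ u : Fin 3 → ℝ, y 0 * u 0 + y 1 * u 1 + y 2 * u 2 = 0 ∧
        (fr.modelField X z).2 = kappaL u) ∧ fr.modelCoord X z ⬝ᵥ xiVec y = 0 := by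
  obtain ⟨W, hW, -, hXD⟩ := hX
  filter_upwards [fr.isOpen_modelDomain.mem_nhds hz,
    (fr.contMDiffAt_ofModel hz).continuousAt.preimage_mem_nhds hW] with z hz hzW y hy hzy
  have h1 := fr.eq_kappaSum_of_eq_kappaL hz hzy
  have h2 := hXD _ ⟨hzW, (fr.mem_twistorSpace_iff (s := fr.ofModel z) hz.2).2 ⟨y, hy, h1⟩⟩
  rw [fr.modelField_apply hz]
  exact (fr.mem_distribution_iff hcov (s := fr.ofModel z) hz.2 h1 _).1 h2

theorem lieBracket_modelField {Y : Π s : EndTM M, TangentSpace endModel s}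
    (hz : z ∈ fr.modelDomain)
    (hX : ContMDiffAt endModel (endModel).tangent ∞
      (fun s ↦ (⟨s, X s⟩ : TangentBundle endModel (EndTM M))) (fr.ofModel z))
    (hY : ContMDiffAt endModel (endModel).tangent ∞
      (fun s ↦ (⟨s, Y s⟩ : TangentBundle endModel (EndTM M))) (fr.ofModel z)) :
    VectorField.lieBracket ℝ (fr.modelField X) (fr.modelField Y) z
      = (mfderiv 𝓘(ℝ, R5) 𝓘(ℝ, R5) (extChartAt 𝓘(ℝ, R5) p) (fr.ofModel z).1
          (projDiff (fr.ofModel z) (VectorField.mlieBracket endModel X Y (fr.ofModel z))),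
        fr.dEntry (fr.ofModel z) (VectorField.mlieBracket endModel X Y (fr.ofModel z))) := by
  have h := lieBracket_mpullback_of_inverse
    (fr.mdifferentiableAt_toModel (s := fr.ofModel z) hz.2)
    (fr.contMDiffAt_ofModel hz) (fr.toModel_comp_ofModel hz)
    (fr.ofModel_comp_toModel (s := fr.ofModel z) hz.2)
    (hX.mdifferentiableAt (by simp)) (hY.mdifferentiableAt (by simp))
  exact h.trans (fr.mfderiv_toModel_apply (s := fr.ofModel z) hz.2 _)

/-- The Lie bracket of two sections of `𝒟`, obtained from the local model. Here `v` and `w` are the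
variations of `y` along the two fields. -/
theorem mlieBracket_of_sections (hcov : S.IsCharacteristic cov) {y v w : Fin 3 → ℝ}
    (hz : z ∈ fr.modelDomain) (hy : y 0 ^ 2 + y 1 ^ 2 + y 2 ^ 2 = 1) (hzy : z.2 = kappaL y)
    {Y : Π s : EndTM M, TangentSpace endModel s}
    (hX : AlmostCR.IsLocalSection endModel S.twistorSpace (S.distribution cov) (fr.ofModel z) X)
    (hY : AlmostCR.IsLocalSection endModel S.twistorSpace (S.distribution cov) (fr.ofModel z) Y)
    (hv : fr.dEntry (fr.ofModel z) (X (fr.ofModel z)) = kappaL v)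
    (hw : fr.dEntry (fr.ofModel z) (Y (fr.ofModel z)) = kappaL w) :
    ∃ (g : Fin 5 → ℝ) (u : Fin 3 → ℝ), y 0 * u 0 + y 1 * u 1 + y 2 * u 2 = 0 ∧
      g ⬝ᵥ xiVec y = -(dxiVec y v ⬝ᵥ fr.modelCoord Y z) + dxiVec y w ⬝ᵥ fr.modelCoord X z ∧
      fr.dEntry (fr.ofModel z) (VectorField.mlieBracket endModel X Y (fr.ofModel z)) = kappaL u ∧
      projDiff (fr.ofModel z) (VectorField.mlieBracket endModel X Y (fr.ofModel z))
        = ∑ i, g i • fr.E i (fr.ofModel z).1 +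
        ∑ i, ∑ j, (fr.modelCoord X z i * fr.modelCoord Y z j) •
          VectorField.mlieBracket 𝓘(ℝ, R5) (fr.E i) (fr.E j) (fr.ofModel z).1 := by
  obtain ⟨x, B⟩ := z
  obtain rfl : B = kappaL y := hzy
  have hX₀ : ContMDiffAt endModel (endModel).tangent ∞
      (fun s ↦ (⟨s, X s⟩ : TangentBundle endModel (EndTM M))) (fr.ofModel (x, kappaL y)) := by
    obtain ⟨W, hW, h, -⟩ := hX
    exact h.contMDiffAt hW
  have hY₀ : ContMDiffAt endModel (endModel).tangent ∞
      (fun s ↦ (⟨s, Y s⟩ : TangentBundle endModel (EndTM M))) (fr.ofModel (x, kappaL y)) := by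
    obtain ⟨W, hW, h, -⟩ := hY
    exact h.contMDiffAt hW
  have hfst (X : Π s : EndTM M, TangentSpace endModel s) : ∀ᶠ z in 𝓝 (x, kappaL y),
      (fr.modelField X z).1 = ∑ i, fr.modelCoord X z i • fr.modelFrame i z.1 := by
    filter_upwards [fr.isOpen_modelDomain.mem_nhds hz] with z hz
    rw [fr.modelField_apply hz]
  have hX₁ : (fr.modelField X (x, kappaL y)).2 = kappaL v := by rw [fr.modelField_apply hz, ← hv]
  have hY₁ : (fr.modelField Y (x, kappaL y)).2 = kappaL w := by rw [fr.modelField_apply hz, ← hw]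
  obtain ⟨g, u, hu, hg, h⟩ := lieBracket_of_sections hy
    (fun i ↦ (fr.contDiffAt_modelFrame hz.1 hz.2 i).differentiableAt (by simp))
    ((fr.contDiffAt_modelField hz hX₀).differentiableAt (by simp))
    ((fr.contDiffAt_modelField hz hY₀).differentiableAt (by simp))
    ((fr.contDiffAt_modelCoord hz hX₀).differentiableAt (by simp))
    ((fr.contDiffAt_modelCoord hz hY₀).differentiableAt (by simp)) (hfst X) (hfst Y)
    (fr.eventually_modelField_mem hcov hz hX) (fr.eventually_modelField_mem hcov hz hY) hX₁ hY₁
  rw [fr.lieBracket_modelField hz hX₀ hY₀] at h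
  refine ⟨g, u, hu, hg, congr($(h).2), ?_⟩
  refine (isInvertible_mfderiv_extChartAt (fr.mem_source hz.2)).injective ?_
  refine congr($(h).1).trans ?_
  have h1 (i : Fin 5) : fr.modelFrame i x = mfderiv 𝓘(ℝ, R5) 𝓘(ℝ, R5) (extChartAt 𝓘(ℝ, R5) p)
      ((extChartAt 𝓘(ℝ, R5) p).symm x) (fr.E i ((extChartAt 𝓘(ℝ, R5) p).symm x)) :=
    fr.mpullback_chart_symm_apply hz.1 hz.2 (fr.E i)
  have h2 (i j : Fin 5) := fr.lieBracket_modelFrame hz.1 hz.2 i j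
  have h3 (q : M) (L : TM M q →L[ℝ] R5) (c d : Fin 5 → ℝ) : L (∑ i, g i • fr.E i q +
        ∑ i, ∑ j, (c i * d j) • VectorField.mlieBracket 𝓘(ℝ, R5) (fr.E i) (fr.E j) q)
      = ∑ i, g i • L (fr.E i q) + ∑ i, ∑ j, (c i * d j) •
        L (VectorField.mlieBracket 𝓘(ℝ, R5) (fr.E i) (fr.E j) q) := by
    simp only [map_add, map_sum, map_smul]
  refine Eq.trans ?_ (h3 _ (mfderiv 𝓘(ℝ, R5) 𝓘(ℝ, R5) (extChartAt 𝓘(ℝ, R5) p) _) _ _).symm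
  simp only [h1]
  congr 1
  exact Finset.sum_congr rfl fun i _ ↦ Finset.sum_congr rfl fun j _ ↦ congrArg _ (h2 i j)

end AdaptedFrame
end IrreducibleSO3Structure

/-! ### The brackets of the frame and the torsion -/

namespace SO3Linear

open Matrix

theorem dotProduct_kappaMat_mulVec (c : Fin 3 → ℝ) (a b : Fin 5 → ℝ) :
    (kappaMat c *ᵥ a) ⬝ᵥ b = -(kappaMat c *ᵥ b ⬝ᵥ a) := by
  simp [kappaMat, dotProduct, mulVec, Fin.sum_univ_succ]
  ring

theorem dxiVec_add (y v w : Fin 3 → ℝ) : dxiVec y (v + w) = dxiVec y v + dxiVec y w := by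
  rw [← dxiL_apply, map_add, dxiL_apply, dxiL_apply]

theorem dxiVec_cross_left (y c : Fin 3 → ℝ) :
    dxiVec y (crossProduct c y) = -(kappaMat c *ᵥ xiVec y) := by
  rw [← dxiVec_cross, ← cross_anticomm, ← dxiL_apply, map_neg, dxiL_apply]

end SO3Linear

namespace IrreducibleSO3Structure
variable {M : Type*} [TopologicalSpace M] [ChartedSpace R5 M] [IsManifold 𝓘(ℝ, R5) ∞ M]
  [RiemannianBundle (fun p : M ↦ TM M p)]

namespace AdaptedFrame

open SO3Linear Matrix

variable {S : IrreducibleSO3Structure M} {p : M} (fr : S.AdaptedFrame p)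
variable (cov : CovariantDerivative 𝓘(ℝ, R5) R5 (fun p : M ↦ TM M p))

/-- The components of the torsion in the frame. -/
def torsionCoeff (q : M) (i j k : Fin 5) : ℝ :=
  torsionForm cov q (fr.E i q) (fr.E j q) (fr.E k q)

/-- The `ξ`-component of `∑ᵢⱼ aᵢ bⱼ [Eᵢ, Eⱼ]`, by the formula
`[Eᵢ, Eⱼ] = ∇_{Eᵢ} Eⱼ - ∇_{Eⱼ} Eᵢ - T(Eᵢ, Eⱼ)`. -/
theorem sum_coord_mlieBracket {q : M} (hq : q ∈ fr.domain) {y c d : Fin 3 → ℝ} {a b : Fin 5 → ℝ}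
    (hc : ∀ i j, fr.connection cov q (∑ i, a i • fr.E i q) i j = kappaMat c i j)
    (hd : ∀ i j, fr.connection cov q (∑ i, b i • fr.E i q) i j = kappaMat d i j) :
    fr.coord q (∑ i, ∑ j, (a i * b j) •
        VectorField.mlieBracket 𝓘(ℝ, R5) (fr.E i) (fr.E j) q) ⬝ᵥ xiVec y
      = (kappaMat c *ᵥ b) ⬝ᵥ xiVec y - (kappaMat d *ᵥ a) ⬝ᵥ xiVec y
        - a ⬝ᵥ contractXi (fr.torsionCoeff cov q) y *ᵥ b := by
  have h1 (i j k : Fin 5) : fr.coord q (VectorField.mlieBracket 𝓘(ℝ, R5) (fr.E i) (fr.E j) q) k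
      = fr.connection cov q (fr.E i q) k j - fr.connection cov q (fr.E j q) k i
        - fr.torsionCoeff cov q i j k := by
    have h := cov.torsion_apply (fr.mdifferentiableAt hq i) (fr.mdifferentiableAt hq j)
    rw [torsionCoeff, torsionForm, h]
    simp only [coord, connection, inner_sub_left]
    rw [real_inner_comm]
    ring
  have h2 (k : Fin 5) : (kappaMat c *ᵥ b) k
      = ∑ i, ∑ j, a i * b j * fr.connection cov q (fr.E i q) k j := by
    simp only [mulVec, dotProduct, ← hc, connection, map_sum, map_smul, sum_inner,
      inner_smul_left, Finset.sum_mul]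
    rw [Finset.sum_comm]
    refine Finset.sum_congr rfl fun i _ ↦ Finset.sum_congr rfl fun j _ ↦ ?_
    simp
    ring
  have h3 (k : Fin 5) : (kappaMat d *ᵥ a) k
      = ∑ i, ∑ j, a i * b j * fr.connection cov q (fr.E j q) k i := by
    simp only [mulVec, dotProduct, ← hd, connection, map_sum, map_smul, sum_inner,
      inner_smul_left, Finset.sum_mul]
    refine Finset.sum_congr rfl fun i _ ↦ Finset.sum_congr rfl fun j _ ↦ ?_
    simp
    ring
  have h4 : a ⬝ᵥ contractXi (fr.torsionCoeff cov q) y *ᵥ b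
      = (fun k ↦ ∑ i, ∑ j, a i * b j * fr.torsionCoeff cov q i j k) ⬝ᵥ xiVec y := by
    simp only [dotProduct, mulVec, contractXi, Finset.mul_sum, Finset.sum_mul, Matrix.of_apply]
    rw [Finset.sum_comm_cycle]
    refine Finset.sum_congr rfl fun i _ ↦ Finset.sum_congr rfl fun j _ ↦
      Finset.sum_congr rfl fun k _ ↦ ?_
    ring
  rw [h4, ← sub_dotProduct, ← sub_dotProduct]
  congr 1
  ext k
  rw [Pi.sub_apply, Pi.sub_apply, h2, h3, ← Finset.sum_sub_distrib, ← Finset.sum_sub_distrib]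
  simp only [coord, inner_sum, inner_smul_right]
  refine Finset.sum_congr rfl fun i _ ↦ ?_
  rw [← Finset.sum_sub_distrib, ← Finset.sum_sub_distrib]
  refine Finset.sum_congr rfl fun j _ ↦ ?_
  have := h1 i j k
  rw [coord] at this
  rw [this]
  ring

end AdaptedFrame
end IrreducibleSO3Structure

/-! ### Extension of the vectors of `𝒟` to local sections -/

namespace SO3Linear

open Matrix

theorem sub_smul_xiVec_dotProduct {y : Fin 3 → ℝ} (hy : y 0 ^ 2 + y 1 ^ 2 + y 2 ^ 2 = 1)
    (a : Fin 5 → ℝ) : (a - (a ⬝ᵥ xiVec y) • xiVec y) ⬝ᵥ xiVec y = 0 := by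
  rw [sub_dotProduct, smul_dotProduct, xiVec_dotProduct_self hy]
  simp

theorem contDiff_xiVec : ContDiff ℝ ∞ xiVec := by
  have h : xiVec = fun y ↦ (1 / 2 : ℝ) • dxiL y y := funext xiVec_eq
  rw [h]
  exact ((dxiL.contDiff.comp contDiff_id).clm_apply contDiff_id).const_smul _

end SO3Linear

namespace IrreducibleSO3Structure
variable {M : Type*} [TopologicalSpace M] [ChartedSpace R5 M] [IsManifold 𝓘(ℝ, R5) ∞ M]
  [RiemannianBundle (fun p : M ↦ TM M p)]

namespace AdaptedFrame

open SO3Linear Matrix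

variable {S : IrreducibleSO3Structure M} {p : M} (fr : S.AdaptedFrame p)

/-- A vector field in the local model which is a section of `𝒟` along the twistor space: the
constant vectors `a` and `v` are projected to `ξ_σ^⊥` and `σ^⊥`. -/
def modelSection (v : Fin 3 → ℝ) (a : Fin 5 → ℝ) (z : R5 × Mat5) : R5 × Mat5 :=
  (∑ i, (a - (a ⬝ᵥ xiVec (kappaCoord z.2)) • xiVec (kappaCoord z.2)) i • fr.modelFrame i z.1,
    kappaL (v - (v ⬝ᵥ kappaCoord z.2) • kappaCoord z.2))

theorem contDiffAt_modelSection {z : R5 × Mat5} (hz : z ∈ fr.modelDomain) (v : Fin 3 → ℝ)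
    (a : Fin 5 → ℝ) : ContDiffAt ℝ ∞ (fr.modelSection v a) z := by
  have hk : ContDiffAt ℝ ∞ (fun z : R5 × Mat5 ↦ kappaCoord z.2) z :=
    kappaCoord.contDiff.contDiffAt.comp z contDiff_snd.contDiffAt
  have hξ : ContDiffAt ℝ ∞ (fun z : R5 × Mat5 ↦ xiVec (kappaCoord z.2)) z :=
    contDiff_xiVec.contDiffAt.comp z hk
  have hdot {ι : Type} [Fintype ι] (a : ι → ℝ) {f : R5 × Mat5 → ι → ℝ} (hf : ContDiffAt ℝ ∞ f z) :
      ContDiffAt ℝ ∞ (fun z ↦ a ⬝ᵥ f z) z :=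
    ContDiffAt.sum fun i _ ↦ contDiffAt_const.mul (contDiffAt_pi.1 hf i)
  have hc : ContDiffAt ℝ ∞ (fun z : R5 × Mat5 ↦
      a - (a ⬝ᵥ xiVec (kappaCoord z.2)) • xiVec (kappaCoord z.2)) z :=
    contDiffAt_const.sub ((hdot a hξ).smul hξ)
  refine ContDiffAt.prodMk (ContDiffAt.sum fun i _ ↦ (contDiffAt_pi.1 hc i).smul ?_) ?_
  · exact (fr.contDiffAt_modelFrame hz.1 hz.2 i).comp z contDiff_fst.contDiffAt
  · exact kappaL.contDiff.contDiffAt.comp z (contDiffAt_const.sub ((hdot v hk).smul hk))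

/-- The vector field of `End(TM)` given by `modelSection`. -/
def sectionField (v : Fin 3 → ℝ) (a : Fin 5 → ℝ) : Π s : EndTM M, TangentSpace endModel s :=
  VectorField.mpullback endModel 𝓘(ℝ, R5 × Mat5) fr.toModel (fr.modelSection v a)

variable [IsContMDiffRiemannianBundle 𝓘(ℝ, R5) ∞ R5 (fun p : M ↦ TM M p)]

theorem contMDiffOn_sectionField (v : Fin 3 → ℝ) (a : Fin 5 → ℝ) :
    ContMDiffOn endModel (endModel).tangent ∞
      (fun s ↦ (⟨s, fr.sectionField v a s⟩ : TangentBundle endModel (EndTM M)))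
      {s | s.1 ∈ fr.domain} := fun s hs ↦ by
  have h := contMDiffAt_vectorSpace_iff_contDiffAt.2
    (fr.contDiffAt_modelSection (fr.toModel_mem hs) v a)
  exact (ContMDiffAt.mpullback_vectorField_preimage h (fr.contMDiffAt_toModel hs)
    (fr.isInvertible_mfderiv_toModel hs) (by simp)).contMDiffWithinAt

theorem mfderiv_toModel_sectionField {s : EndTM M} (hs : s.1 ∈ fr.domain) (v : Fin 3 → ℝ)
    (a : Fin 5 → ℝ) :
    mfderiv endModel 𝓘(ℝ, R5 × Mat5) fr.toModel s (fr.sectionField v a s)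
      = fr.modelSection v a (fr.toModel s) :=
  (fr.isInvertible_mfderiv_toModel hs).self_apply_inverse _

variable {s : EndTM M} {y : Fin 3 → ℝ}

theorem dEntry_sectionField (hs : s.1 ∈ fr.domain) (hsy : s.2 = kappaSum (fr.basis hs) y)
    (v : Fin 3 → ℝ) (a : Fin 5 → ℝ) :
    fr.dEntry s (fr.sectionField v a s) = kappaL (v - (v ⬝ᵥ y) • y) := by
  have h := fr.mfderiv_toModel_sectionField hs v a
  rw [fr.mfderiv_toModel_apply hs] at h
  refine congr($(h).2).trans ?_
  rw [modelSection, toModel, (fr.entry_eq_kappaL_iff hs s.2 y).2 hsy, kappaCoord_kappaL]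

theorem projDiff_sectionField (hs : s.1 ∈ fr.domain) (hsy : s.2 = kappaSum (fr.basis hs) y)
    (v : Fin 3 → ℝ) (a : Fin 5 → ℝ) :
    projDiff s (fr.sectionField v a s)
      = ∑ i, (a - (a ⬝ᵥ xiVec y) • xiVec y) i • fr.E i s.1 := by
  have h := fr.mfderiv_toModel_sectionField hs v a
  rw [fr.mfderiv_toModel_apply hs] at h
  refine (isInvertible_mfderiv_extChartAt (fr.mem_source hs)).injective ?_
  refine congr($(h).1).trans ?_
  have hx := (extChartAt 𝓘(ℝ, R5) p).left_inv (fr.mem_source hs)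
  have hx' : (extChartAt 𝓘(ℝ, R5) p).symm (extChartAt 𝓘(ℝ, R5) p s.1) ∈ fr.domain := by rwa [hx]
  have h1 (i : Fin 5) : fr.modelFrame i (extChartAt 𝓘(ℝ, R5) p s.1)
      = mfderiv 𝓘(ℝ, R5) 𝓘(ℝ, R5) (extChartAt 𝓘(ℝ, R5) p) s.1 (fr.E i s.1) := by
    have h2 := fr.mpullback_chart_symm_apply
      ((extChartAt 𝓘(ℝ, R5) p).map_source (fr.mem_source hs)) hx' (fr.E i)
    have h3 (q : M) (hq : q = s.1) : (mfderiv 𝓘(ℝ, R5) 𝓘(ℝ, R5) (extChartAt 𝓘(ℝ, R5) p) q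
        (fr.E i q) : R5) = mfderiv 𝓘(ℝ, R5) 𝓘(ℝ, R5) (extChartAt 𝓘(ℝ, R5) p) s.1 (fr.E i s.1) := by
      subst hq
      rfl
    exact h2.trans (h3 _ hx)
  have h4 (c : Fin 5 → ℝ) (L : TM M s.1 →L[ℝ] R5) :
      L (∑ i, c i • fr.E i s.1) = ∑ i, c i • L (fr.E i s.1) := by
    simp only [map_sum, map_smul]
  refine Eq.trans ?_ (h4 _ (mfderiv 𝓘(ℝ, R5) 𝓘(ℝ, R5) (extChartAt 𝓘(ℝ, R5) p) s.1)).symm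
  rw [modelSection, toModel, (fr.entry_eq_kappaL_iff hs s.2 y).2 hsy, kappaCoord_kappaL]
  simp only [h1]
  rfl

variable {cov : CovariantDerivative 𝓘(ℝ, R5) R5 (fun p : M ↦ TM M p)}

theorem sectionField_mem (hcov : S.IsCharacteristic cov) (hs : s.1 ∈ fr.domain)
    (hy : y 0 ^ 2 + y 1 ^ 2 + y 2 ^ 2 = 1) (hsy : s.2 = kappaSum (fr.basis hs) y)
    (v : Fin 3 → ℝ) (a : Fin 5 → ℝ) : fr.sectionField v a s ∈ S.distribution cov s := by
  rw [fr.mem_distribution_iff hcov hs hsy, fr.dEntry_sectionField hs hsy,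
    fr.projDiff_sectionField hs hsy, fr.coord_sum_smul hs]
  refine ⟨⟨_, ?_, rfl⟩, sub_smul_xiVec_dotProduct hy a⟩
  simp only [Pi.sub_apply, Pi.smul_apply, smul_eq_mul, dotProduct, Fin.sum_univ_three]
  linear_combination (-(v 0 * y 0 + v 1 * y 1 + v 2 * y 2)) * hy

/-- Every vector of `𝒟` extends to a local section. -/
theorem exists_isLocalSection (hcov : S.IsCharacteristic cov) (hs : s.1 ∈ fr.domain)
    (hsy : s.2 = kappaSum (fr.basis hs) y)
    {A : TangentSpace endModel s} (hA : A ∈ S.distribution cov s) :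
    ∃ X : Π s : EndTM M, TangentSpace endModel s,
      AlmostCR.IsLocalSection endModel S.twistorSpace (S.distribution cov) s X ∧ X s = A := by
  obtain ⟨⟨v, hv, hA₁⟩, hA₂⟩ := (fr.mem_distribution_iff hcov hs hsy A).1 hA
  refine ⟨fr.sectionField v (fr.coord s.1 (projDiff s A)), ⟨{s | s.1 ∈ fr.domain},
    fr.isOpen_preimage_domain.mem_nhds hs, fr.contMDiffOn_sectionField _ _, fun r hr ↦ ?_⟩, ?_⟩
  · obtain ⟨y', hy', hr'⟩ := (fr.mem_twistorSpace_iff hr.1).1 hr.2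
    exact fr.sectionField_mem hcov hr.1 hy' hr' _ _
  · refine fr.ext_dEntry hs ?_ ?_
    · rw [fr.projDiff_sectionField hs hsy, hA₂, zero_smul, sub_zero, fr.sum_coord_smul hs]
    · have hvy : v ⬝ᵥ y = 0 := by
        rw [dotProduct, Fin.sum_univ_three]
        linear_combination hv
      rw [fr.dEntry_sectionField hs hsy, hvy, zero_smul, sub_zero, hA₁]

end AdaptedFrame
end IrreducibleSO3Structure

/-! ### The Levi form of `𝒟` -/

namespace IrreducibleSO3Structure
variable {M : Type*} [TopologicalSpace M] [ChartedSpace R5 M] [IsManifold 𝓘(ℝ, R5) ∞ M]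
  [RiemannianBundle (fun p : M ↦ TM M p)]

namespace AdaptedFrame

open SO3Linear Matrix

variable {S : IrreducibleSO3Structure M} {p : M} (fr : S.AdaptedFrame p)
  (cov : CovariantDerivative 𝓘(ℝ, R5) R5 (fun p : M ↦ TM M p))

/-- The vector `V + X^h_σ` with `V = ∑ᵢ vᵢ κᵢ` and `X = ∑ᵢ aᵢ Eᵢ`. -/
def lift {s : EndTM M} (hs : s.1 ∈ fr.domain) (v : Fin 3 → ℝ) (a : Fin 5 → ℝ) :
    TangentSpace endModel s :=
  verticalLift s (kappaSum (fr.basis hs) v) + horizontalLift cov s (∑ i, a i • fr.E i s.1)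

theorem mem_distribution_iff_exists_lift {s : EndTM M} (hs : s.1 ∈ fr.domain) {y : Fin 3 → ℝ}
    (hsy : s.2 = kappaSum (fr.basis hs) y) (A : TangentSpace endModel s) :
    A ∈ S.distribution cov s ↔ ∃ v a, y 0 * v 0 + y 1 * v 1 + y 2 * v 2 = 0 ∧
      a ⬝ᵥ xiVec y = 0 ∧ A = fr.lift cov hs v a := by
  rw [distribution, Submodule.mem_sup]
  constructor
  · rintro ⟨_, ⟨V, hV, rfl⟩, _, ⟨X, hX, rfl⟩, rfl⟩
    obtain ⟨v, hv, rfl⟩ := (fr.mem_verticalSpace_iff hs hsy V).1 hV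
    refine ⟨v, fr.coord s.1 X, hv, (fr.mem_hSpace_iff hs hsy X).1 hX, ?_⟩
    rw [lift, fr.sum_coord_smul hs]
    rfl
  · rintro ⟨v, a, hv, ha, rfl⟩
    refine ⟨_, ⟨_, (fr.mem_verticalSpace_iff hs hsy _).2 ⟨v, hv, rfl⟩, rfl⟩, _,
      ⟨_, (fr.mem_hSpace_iff hs hsy (∑ i, a i • fr.E i s.1)).2 ?_, rfl⟩, rfl⟩
    rwa [fr.coord_sum_smul hs]

theorem projDiff_lift {s : EndTM M} (hs : s.1 ∈ fr.domain) (v : Fin 3 → ℝ) (a : Fin 5 → ℝ) :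
    projDiff s (fr.lift cov hs v a) = ∑ i, a i • fr.E i s.1 :=
  projDiff_add_lifts ..

variable [IsContMDiffRiemannianBundle 𝓘(ℝ, R5) ∞ R5 (fun p : M ↦ TM M p)] {s : EndTM M}
  {y : Fin 3 → ℝ}

theorem jPlusOne_lift (hs : s.1 ∈ fr.domain) (hy : y 0 ^ 2 + y 1 ^ 2 + y 2 ^ 2 = 1)
    (hsy : s.2 = kappaSum (fr.basis hs) y) (hb : S.adaptedBasis s.1 = fr.basis hs)
    (v : Fin 3 → ℝ) (a : Fin 5 → ℝ) :
    S.jPlusOne cov s (fr.lift cov hs v a)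
      = fr.lift cov hs (-crossProduct y v) (jMat y *ᵥ a) := by
  have h1 : S.fibreJ s (verticalPart cov s (fr.lift cov hs v a))
      = kappaSum (fr.basis hs) (-crossProduct y v) := by
    refine fr.entry_injective hs ?_
    rw [fibreJ, lift, fr.verticalPart_add_lifts hs, hb, hsy, cross_kappaSum, fr.entry_kappaSum,
      map_neg, ← fr.entry_kappaSum hs]
    ext i j
    simp [entry]
  have h2 : jPlus (S.adaptedBasis s.1) s.2 (∑ i, a i • fr.E i s.1)
      = ∑ i, (jMat y *ᵥ a) i • fr.E i s.1 := by
    have hJ := isLinearMap_jPlus (fr.basis hs) s.2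
    have h3 (j : Fin 5) := jPlus_basis (fr.basis hs) hy j
    rw [← hsy] at h3
    simp only [fr.basis_apply] at h3
    rw [hb, ← hJ.mk'_apply, map_sum]
    simp only [map_smul, IsLinearMap.mk'_apply, h3, Finset.smul_sum, mulVec, dotProduct,
      Finset.sum_smul]
    rw [Finset.sum_comm]
    refine Finset.sum_congr rfl fun i _ ↦ Finset.sum_congr rfl fun j _ ↦ ?_
    rw [smul_smul, mul_comm]
  rw [jPlusOne, h1, fr.projDiff_lift cov hs, h2]
  rfl

variable {cov}

theorem dEntry_lift (hcov : S.IsCharacteristic cov) (hs : s.1 ∈ fr.domain)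
    (hsy : s.2 = kappaSum (fr.basis hs) y) (v : Fin 3 → ℝ) {c : Fin 3 → ℝ} {a : Fin 5 → ℝ}
    (hc : ∀ i j, fr.connection cov s.1 (∑ i, a i • fr.E i s.1) i j = kappaMat c i j) :
    fr.dEntry s (fr.lift cov hs v a) = kappaL (v + crossProduct c y) := by
  rw [lift, ContinuousLinearMap.map_add, fr.dEntry_verticalLift hs, fr.entry_kappaSum hs,
    fr.dEntry_horizontalLift_eq_kappaL hcov hs hsy hc, ContinuousLinearMap.map_add]

/-- The Lie bracket of two sections of `𝒟` is tangent to the twistor space, and its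
`ξ_σ`-component depends only on the values of the sections at the point. The connection terms which
come from the differentials of the matrices cancel those which come from the brackets
`[E_i, E_j]`. -/
theorem mlieBracket_of_sections_lift (hcov : S.IsCharacteristic cov) (hs : s.1 ∈ fr.domain)
    (hy : y 0 ^ 2 + y 1 ^ 2 + y 2 ^ 2 = 1) (hsy : s.2 = kappaSum (fr.basis hs) y)
    {v w : Fin 3 → ℝ} {a b : Fin 5 → ℝ} {X Y : Π s : EndTM M, TangentSpace endModel s}
    (hX : AlmostCR.IsLocalSection endModel S.twistorSpace (S.distribution cov) s X)
    (hY : AlmostCR.IsLocalSection endModel S.twistorSpace (S.distribution cov) s Y)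
    (hXs : X s = fr.lift cov hs v a) (hYs : Y s = fr.lift cov hs w b) :
    (∃ u : Fin 3 → ℝ, y 0 * u 0 + y 1 * u 1 + y 2 * u 2 = 0 ∧
      fr.dEntry s (VectorField.mlieBracket endModel X Y s) = kappaL u) ∧
    fr.coord s.1 (projDiff s (VectorField.mlieBracket endModel X Y s)) ⬝ᵥ xiVec y
      = leviCoord (fr.torsionCoeff cov s.1) y v w a b := by
  obtain ⟨c, hc⟩ := fr.exists_connection_eq_kappaMat hcov hs (∑ i, a i • fr.E i s.1)
  obtain ⟨d, hd⟩ := fr.exists_connection_eq_kappaMat hcov hs (∑ i, b i • fr.E i s.1)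
  obtain ⟨z, hz, rfl⟩ : ∃ z ∈ fr.modelDomain, fr.ofModel z = s :=
    ⟨_, fr.toModel_mem hs, fr.ofModel_toModel hs⟩
  have hzy : z.2 = kappaL y :=
    (fr.entry_ofEntry hz.2 z.2).symm.trans ((fr.entry_eq_kappaL_iff hs _ y).2 hsy)
  obtain ⟨g, u, hu, hg, h₁, h₂⟩ := fr.mlieBracket_of_sections hcov hz hy hzy hX hY
    (by rw [hXs, fr.dEntry_lift hcov hs hsy v hc]) (by rw [hYs, fr.dEntry_lift hcov hs hsy w hd])
  have hXc : fr.modelCoord X z = a := by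
    rw [modelCoord, hXs, fr.projDiff_lift cov hs, fr.coord_sum_smul hs]
  have hYc : fr.modelCoord Y z = b := by
    rw [modelCoord, hYs, fr.projDiff_lift cov hs, fr.coord_sum_smul hs]
  rw [hXc, hYc] at hg h₂
  refine ⟨⟨u, hu, h₁⟩, ?_⟩
  have h3 := fr.sum_coord_mlieBracket cov hs (y := y) hc hd
  have h4 (q : M) (x x' : TM M q) : fr.coord q (x + x') = fr.coord q x + fr.coord q x' := by
    ext i
    simp [coord, inner_add_right]
  rw [h₂, h4, add_dotProduct, fr.coord_sum_smul hs, hg, h3, leviCoord, dxiVec_add, dxiVec_add,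
    dxiVec_cross_left, dxiVec_cross_left, dotProduct_kappaMat_mulVec c b,
    dotProduct_kappaMat_mulVec d a]
  simp only [add_dotProduct, neg_dotProduct]
  ring

/-- A vector tangent to the twistor space is determined modulo `𝒟` by its `ξ_σ`-component. -/
theorem mkQ_eq_mkQ_smul_lift (hcov : S.IsCharacteristic cov) (hs : s.1 ∈ fr.domain)
    (hy : y 0 ^ 2 + y 1 ^ 2 + y 2 ^ 2 = 1) (hsy : s.2 = kappaSum (fr.basis hs) y)
    {B : TangentSpace endModel s} {u : Fin 3 → ℝ} {l : ℝ}
    (hu : y 0 * u 0 + y 1 * u 1 + y 2 * u 2 = 0) (h₁ : fr.dEntry s B = kappaL u)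
    (h₂ : fr.coord s.1 (projDiff s B) ⬝ᵥ xiVec y = l) :
    (S.distribution cov s).mkQ B
      = (S.distribution cov s).mkQ (l • fr.lift cov hs 0 (xiVec y)) := by
  obtain ⟨c, hc⟩ := fr.exists_connection_eq_kappaMat hcov hs (∑ i, xiVec y i • fr.E i s.1)
  refine (Submodule.Quotient.eq _).2 ((fr.mem_distribution_iff hcov hs hsy _).2
    ⟨⟨u - l • (0 + crossProduct c y), ?_, ?_⟩, ?_⟩)
  · simp only [Pi.sub_apply, Pi.smul_apply, Pi.add_apply, smul_eq_mul, cross_apply, Pi.zero_apply,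
      cons_val_zero, cons_val_one, cons_val]
    linear_combination hu
  · rw [ContinuousLinearMap.map_sub, ContinuousLinearMap.map_smul, h₁,
      fr.dEntry_lift hcov hs hsy 0 hc, ContinuousLinearMap.map_sub, ContinuousLinearMap.map_smul]
  · have h4 (x x' : TM M s.1) : fr.coord s.1 (x - l • x')
        = fr.coord s.1 x - l • fr.coord s.1 x' := by
      ext i
      simp [coord, inner_sub_right, inner_smul_right]
    rw [ContinuousLinearMap.map_sub, ContinuousLinearMap.map_smul, fr.projDiff_lift cov hs, h4,
      sub_dotProduct, smul_dotProduct, h₂, fr.coord_sum_smul hs, xiVec_dotProduct_self hy]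
    simp

/-- The Levi form of `𝒟`. All the pairs of sections with the given values lead to the same class, so
the choice made in the definition of `leviForm` does not matter. -/
theorem leviForm_lift (hcov : S.IsCharacteristic cov) (hs : s.1 ∈ fr.domain)
    (hy : y 0 ^ 2 + y 1 ^ 2 + y 2 ^ 2 = 1) (hsy : s.2 = kappaSum (fr.basis hs) y)
    {v w : Fin 3 → ℝ} {a b : Fin 5 → ℝ} (hv : y 0 * v 0 + y 1 * v 1 + y 2 * v 2 = 0)
    (hw : y 0 * w 0 + y 1 * w 1 + y 2 * w 2 = 0) (ha : a ⬝ᵥ xiVec y = 0)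
    (hb : b ⬝ᵥ xiVec y = 0) :
    AlmostCR.leviForm endModel S.twistorSpace (S.distribution cov) s (fr.lift cov hs v a)
        (fr.lift cov hs w b)
      = (S.distribution cov s).mkQ
        (leviCoord (fr.torsionCoeff cov s.1) y v w a b • fr.lift cov hs 0 (xiVec y)) := by
  have hA := (fr.mem_distribution_iff_exists_lift cov hs hsy _).2 ⟨v, a, hv, ha, rfl⟩
  have hB := (fr.mem_distribution_iff_exists_lift cov hs hsy _).2 ⟨w, b, hw, hb, rfl⟩
  obtain ⟨X, hX, hXs⟩ := fr.exists_isLocalSection hcov hs hsy hA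
  obtain ⟨Y, hY, hYs⟩ := fr.exists_isLocalSection hcov hs hsy hB
  have key : ∃ c, ∃ X Y : Π s : EndTM M, TangentSpace endModel s,
      AlmostCR.IsLocalSection endModel S.twistorSpace (S.distribution cov) s X ∧
      AlmostCR.IsLocalSection endModel S.twistorSpace (S.distribution cov) s Y ∧
      X s = fr.lift cov hs v a ∧ Y s = fr.lift cov hs w b ∧
      c = (S.distribution cov s).mkQ (VectorField.mlieBracket endModel X Y s) :=
    ⟨_, X, Y, hX, hY, hXs, hYs, rfl⟩
  obtain ⟨X, Y, hX, hY, hXs, hYs, h⟩ := Classical.epsilon_spec key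
  obtain ⟨⟨u, hu, h₁⟩, h₂⟩ := fr.mlieBracket_of_sections_lift hcov hs hy hsy hX hY hXs hYs
  exact h.trans (fr.mkQ_eq_mkQ_smul_lift hcov hs hy hsy hu h₁ h₂)

theorem lift_xiVec_notMem (hcov : S.IsCharacteristic cov) (hs : s.1 ∈ fr.domain)
    (hy : y 0 ^ 2 + y 1 ^ 2 + y 2 ^ 2 = 1) (hsy : s.2 = kappaSum (fr.basis hs) y) :
    fr.lift cov hs 0 (xiVec y) ∉ S.distribution cov s := fun h ↦ by
  have h2 := ((fr.mem_distribution_iff hcov hs hsy _).1 h).2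
  rw [fr.projDiff_lift cov hs, fr.coord_sum_smul hs, xiVec_dotProduct_self hy] at h2
  exact one_ne_zero h2

end AdaptedFrame
end IrreducibleSO3Structure

namespace IrreducibleSO3Structure
variable {M : Type*} [TopologicalSpace M] [ChartedSpace R5 M] [IsManifold 𝓘(ℝ, R5) ∞ M]
  [RiemannianBundle (fun p : M ↦ TM M p)]

namespace AdaptedFrame

open SO3Linear Matrix

variable {S : IrreducibleSO3Structure M} {p : M} (fr : S.AdaptedFrame p)
  {cov : CovariantDerivative 𝓘(ℝ, R5) R5 (fun p : M ↦ TM M p)}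
  [IsContMDiffRiemannianBundle 𝓘(ℝ, R5) ∞ R5 (fun p : M ↦ TM M p)] {s : EndTM M}
  {y : Fin 3 → ℝ}

/-- Since the horizontal lift of `ξ_σ` is not in `𝒟`, the values of the Levi form are compared by
their coefficients. -/
theorem leviForm_jPlusOne_eq_iff (hcov : S.IsCharacteristic cov) (hs : s.1 ∈ fr.domain)
    (hy : y 0 ^ 2 + y 1 ^ 2 + y 2 ^ 2 = 1) (hsy : s.2 = kappaSum (fr.basis hs) y)
    (hb : S.adaptedBasis s.1 = fr.basis hs) {v w : Fin 3 → ℝ} {a b : Fin 5 → ℝ}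
    (hv : y 0 * v 0 + y 1 * v 1 + y 2 * v 2 = 0) (hw : y 0 * w 0 + y 1 * w 1 + y 2 * w 2 = 0)
    (ha : a ⬝ᵥ xiVec y = 0) (hb' : b ⬝ᵥ xiVec y = 0) :
    AlmostCR.leviForm endModel S.twistorSpace (S.distribution cov) s
          (S.jPlusOne cov s (fr.lift cov hs v a)) (S.jPlusOne cov s (fr.lift cov hs w b))
        = AlmostCR.leviForm endModel S.twistorSpace (S.distribution cov) s (fr.lift cov hs v a)
          (fr.lift cov hs w b) ↔
      leviCoord (fr.torsionCoeff cov s.1) y (-crossProduct y v) (-crossProduct y w) (jMat y *ᵥ a)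
        (jMat y *ᵥ b) = leviCoord (fr.torsionCoeff cov s.1) y v w a b := by
  have hcross (v : Fin 3 → ℝ) : y 0 * (-crossProduct y v) 0 + y 1 * (-crossProduct y v) 1
      + y 2 * (-crossProduct y v) 2 = 0 := by
    simp only [Pi.neg_apply, cross_apply, cons_val_zero, cons_val_one, cons_val]
    ring
  have hJ (a : Fin 5 → ℝ) : (jMat y *ᵥ a) ⬝ᵥ xiVec y = 0 := by
    rw [dotProduct_comm, dotProduct_mulVec, ← mulVec_transpose, jMat_transpose, neg_mulVec,
      jMat_mulVec_xiVec]
    simp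
  rw [fr.jPlusOne_lift cov hs hy hsy hb, fr.jPlusOne_lift cov hs hy hsy hb,
    fr.leviForm_lift hcov hs hy hsy (hcross v) (hcross w) (hJ a) (hJ b),
    fr.leviForm_lift hcov hs hy hsy hv hw ha hb']
  constructor
  · intro h
    have h1 := (Submodule.Quotient.eq _).1 h
    rw [← sub_smul] at h1
    by_contra hne
    exact fr.lift_xiVec_notMem hcov hs hy hsy
      (((S.distribution cov s).smul_mem_iff (sub_ne_zero.2 hne)).1 h1)
  · intro h
    rw [h]

end AdaptedFrame

open SO3Linear

variable [IsContMDiffRiemannianBundle 𝓘(ℝ, R5) ∞ R5 (fun p : M ↦ TM M p)]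

/-- At each point `p`, both sides of the equivalence are conditions on the torsion at `p`, which are
read in an adapted frame. -/
theorem leviForm_invariant_at_iff (S : IrreducibleSO3Structure M)
    {cov : CovariantDerivative 𝓘(ℝ, R5) R5 (fun p : M ↦ TM M p)} (hcov : S.IsCharacteristic cov)
    (p : M) :
    (∀ s ∈ S.twistorSpace, s.1 = p → ∀ A ∈ S.distribution cov s, ∀ B ∈ S.distribution cov s,
      AlmostCR.leviForm endModel S.twistorSpace (S.distribution cov) s (S.jPlusOne cov s A)
          (S.jPlusOne cov s B)
        = AlmostCR.leviForm endModel S.twistorSpace (S.distribution cov) s A B) ↔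
      ∃ W ∈ S.lambda23 p, ∀ x y : TM M p,
        ⟪W x, y⟫ = hodgeStarThree (S.adaptedBasis p) (torsionForm cov p) x y := by
  obtain ⟨fr, hfr⟩ := S.exists_adaptedFrame p
  have hb : S.adaptedBasis p = fr.basis fr.mem :=
    DFunLike.ext _ _ fun i ↦ by rw [fr.basis_apply, hfr]
  have hT₁ (i j k : Fin 5) : fr.torsionCoeff cov p i j k = -fr.torsionCoeff cov p j i k := by
    rw [AdaptedFrame.torsionCoeff, AdaptedFrame.torsionCoeff, torsionForm, cov.torsion_antisymm,
      inner_neg_left]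
    rfl
  have hT₂ (i j k : Fin 5) : fr.torsionCoeff cov p i j k = -fr.torsionCoeff cov p i k j :=
    hcov.skew p _ _ _
  have h1 := exists_hodgeStarThree_iff (S.adaptedBasis p) (Υ := S.upsilon p)
    (S.isAdapted_adaptedBasis p).upsilon_apply (torsionForm cov p)
  have h2 : (fun i j k ↦ torsionForm cov p (S.adaptedBasis p i) (S.adaptedBasis p j)
      (S.adaptedBasis p k)) = fr.torsionCoeff cov p := by
    ext i j k
    rw [AdaptedFrame.torsionCoeff, hfr, hfr, hfr]
  rw [h2] at h1
  refine Iff.trans ?_ h1.symm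
  rw [← leviCoord_invariant_iff hT₁ hT₂]
  constructor
  · intro h y v w a b hy hv hw ha hb'
    let s : EndTM M := ⟨p, kappaSum (fr.basis fr.mem) y⟩
    refine (fr.leviForm_jPlusOne_eq_iff (s := s) hcov fr.mem hy rfl hb hv hw ha hb').1 ?_
    exact h s ((fr.mem_twistorSpace_iff (s := s) fr.mem).2 ⟨y, hy, rfl⟩) rfl _
      ((fr.mem_distribution_iff_exists_lift cov (s := s) fr.mem rfl _).2 ⟨v, a, hv, ha, rfl⟩) _
      ((fr.mem_distribution_iff_exists_lift cov (s := s) fr.mem rfl _).2 ⟨w, b, hw, hb', rfl⟩)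
  · rintro h s hs rfl A hA B hB
    obtain ⟨y, hy, hsy⟩ := (fr.mem_twistorSpace_iff fr.mem).1 hs
    obtain ⟨v, a, hv, ha, rfl⟩ := (fr.mem_distribution_iff_exists_lift cov fr.mem hsy _).1 hA
    obtain ⟨w, b, hw, hb', rfl⟩ := (fr.mem_distribution_iff_exists_lift cov fr.mem hsy _).1 hB
    exact (fr.leviForm_jPlusOne_eq_iff hcov fr.mem hy hsy hb hv hw ha hb').2
      (h y v w a b hy hv hw ha hb')

end IrreducibleSO3Structure

end

theorem mainTheorem5 {M : Type*} [TopologicalSpace M] [T2Space M] [SecondCountableTopology M]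
    [ChartedSpace R5 M] [IsManifold 𝓘(ℝ, R5) ∞ M]
    [RiemannianBundle (fun p : M ↦ TM M p)]
    [IsContMDiffRiemannianBundle 𝓘(ℝ, R5) ∞ R5 (fun p : M ↦ TM M p)]
    (S : IrreducibleSO3Structure M)
    (cov : CovariantDerivative 𝓘(ℝ, R5) R5 (fun p : M ↦ TM M p))
    (hcov : S.IsCharacteristic cov) :
    AlmostCR.LeviInvariant endModel S.twistorSpace (S.distribution cov) (S.jPlusOne cov) ↔
      S.StarTorsionInLambda23 cov := by
  constructor
  · intro h p
    exact (S.leviForm_invariant_at_iff hcov p).1 fun s hs _ ↦ h s hs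
  · intro h s hs A hA B hB
    exact (S.leviForm_invariant_at_iff hcov s.1).2 (h s.1) s hs rfl A hA B hB
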